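/- Let $(\Omega,\mathcal F,\mathbb P)$ be a probability space and let $\theta_1,\theta_2,\dots$ be independent random variables on it, each uniformly distributed on $[0,1]$; put $X_n=e^{2\pi i\theta_n}$. Let $\phi_n:\mathbb R\to\mathbb C$ $(n\ge 1)$ satisfy $\sup_n\sup_{x}|\phi_n(x)|<\infty$ and suppose there are constants $L\ge 1$, $\delta>0$ such that $$L^{-1}|x-y|\le|\phi_n(x)-\phi_n(y)|\le L|x-y|\qquad\text{for all } n\ge 1 \text{ and all } x,y\in\mathbb R \text{ with } |x-y|\le\delta .$$ Let $a_n\in\mathbb C\setminus\{0\}$ with $\sum_{n\ge1}|a_n|<\infty$, and let $(\lambda_n)_{n\ge1}$ be a nondecreasing real sequence with $\lambda_1=1$ and $q:=\sup_n\lambda_{n+1}/\lambda_n<\infty$, $q>1$ (the last condition is automatic if $(\lambda_n)$ is strictly increasing). Define $$s_k=\Bigl(\sum_{q^k\le\lambda_n<q^{k+1}}|a_n|^2\Bigr)^{1/2},\qquad \sigma=\liminf_{k\to\infty}\frac{-\log s_k}{k\log q},\qquad \tau=\limsup_{k\to\infty}\frac{-\log s_k}{k\log q}$$ (extended real numbers,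 with $-\log 0=+\infty$), the random series $$S(x)=\sum_{n=1}^\infty a_nX_n\phi_n(\lambda_nx)\qquad(x\in\mathbb R),$$ and, for $A\subset\mathbb R$, its graph $G_S(A)=\{(x,S(x)):x\in A\}\subset\mathbb R^3$, where $\mathbb C$ is identified with $\mathbb R^2$. Let $\dim_{\mathcal H}$ denote Hausdorff dimension. (i) If $0<\sigma\le\tau\le1$, then for every Borel set $A\subset\mathbb R$, almost surely $$\min\Bigl\{\frac{\dim_{\mathcal H}A}{\tau},\ \dim_{\mathcal H}A+2-2\tau\Bigr\}\le\dim_{\mathcal H}G_S(A)\le\min\Bigl\{\frac{\dim_{\mathcal H}A}{\sigma},\ \dim_{\mathcal H}A+2-2\sigma\Bigr\}.$$ (ii) If $\tau=0$, then for every Borel set $A\subset\mathbb R$ with $\dim_{\mathcal H}A>0$, almost surely $\dim_{\mathcal H}G_S(A)=2+\dim_{\mathcal H}A$. -/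

import Mathlib

open MeasureTheory ProbabilityTheory Filter

noncomputable section

namespace SteinhausSeries

/-- Local uniform bi-Lipschitz property, with constants `L` and `δ` common to all `n`:
`L⁻¹ |x - y| ≤ |φ n x - φ n y| ≤ L |x - y|` whenever `|x - y| ≤ δ`. -/
def LocallyUniformlyBiLipschitz (φ : ℕ → ℝ → ℂ) : Prop :=
  ∃ L δ : ℝ, 1 ≤ L ∧ 0 < δ ∧ ∀ (n : ℕ) (x y : ℝ), |x - y| ≤ δ →
    L⁻¹ * |x - y| ≤ ‖φ n x - φ n y‖ ∧ ‖φ n x - φ n y‖ ≤ L * |x - y|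

/-- Uniform boundedness of a sequence of functions. -/
def UniformlyBounded (φ : ℕ → ℝ → ℂ) : Prop :=
  ∃ C : ℝ, ∀ (n : ℕ) (x : ℝ), ‖φ n x‖ ≤ C

/-- The block norm `s k = (∑_{q ^ k ≤ lam n < q ^ (k + 1)} |a n| ^ 2) ^ (1 / 2)`. -/
def blockNorm (a : ℕ → ℂ) (lam : ℕ → ℝ) (q : ℝ) (k : ℕ) : ℝ :=
  Real.sqrt (∑' n : {n : ℕ // q ^ k ≤ lam n ∧ lam n < q ^ (k + 1)}, ‖a n‖ ^ 2)

/-- The quotient `-log (s k) / (k log q)`, as an extended real: it is `+∞` if `s k = 0`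
(for `k ≥ 1` and `q > 1`). -/
def blockRate (a : ℕ → ℂ) (lam : ℕ → ℝ) (q : ℝ) (k : ℕ) : EReal :=
  -ENNReal.log (ENNReal.ofReal (blockNorm a lam q k)) / ((k * Real.log q : ℝ) : EReal)

/-- `σ = liminf_k -log (s k) / (k log q)`. -/
def lowerRate (a : ℕ → ℂ) (lam : ℕ → ℝ) (q : ℝ) : EReal :=
  liminf (blockRate a lam q) atTop

/-- `τ = limsup_k -log (s k) / (k log q)`. -/
def upperRate (a : ℕ → ℂ) (lam : ℕ → ℝ) (q : ℝ) : EReal :=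
  limsup (blockRate a lam q) atTop

/-- `θ 0, θ 1, …` are independent random variables, each uniformly distributed on `[0, 1]`. -/
def IsIIDUniform {Ω : Type*} [MeasurableSpace Ω] (P : Measure Ω) (θ : ℕ → Ω → ℝ) : Prop :=
  (∀ n, Measurable (θ n)) ∧ iIndepFun θ P ∧
    ∀ n, P.map (θ n) = (volume : Measure ℝ).restrict (Set.Icc 0 1)

/-- The function `x ↦ ∑ a n * exp (2 π i t n) * φ n (lam n * x)` with phases `t`. -/
def phaseSeries (a : ℕ → ℂ) (lam : ℕ → ℝ) (φ : ℕ → ℝ → ℂ) (t : ℕ → ℝ) (x : ℝ) : ℂ :=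
  ∑' n, a n * Complex.exp (2 * Real.pi * Complex.I * t n) * φ n (lam n * x)

/-- The graph over `A` of a complex function of a real variable, as a subset of Euclidean
three-space. -/
def graphOver (f : ℝ → ℂ) (A : Set ℝ) : Set (EuclideanSpace ℝ (Fin 3)) :=
  (fun x => !₂[x, (f x).re, (f x).im]) '' A

end SteinhausSeries

end

/-! An increment `S x - S y` is a Steinhaus sum with coefficients `a n * (φ n (lam n * x) - φ n (lam
n * y))`. Two opposite probabilistic estimates for such sums give the two bounds.

Upper bound. Steinhaus sums are sub-Gaussian with variance proxy the squared `ℓ²` norm of the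
coefficients. Each `φ n` is Hölder of every exponent in `[0, 1]` with a common constant, and `∑ ‖a
n‖ ^ 2 * lam n ^ (2 * β)` converges for `0 ≤ β < σ`. Kolmogorov's criterion
(`ae_locallyHolder_of_measure_le`) therefore makes the paths locally `β`-Hölder for every `0 < β <
σ`. The rest is deterministic: such a graph has dimension at most `dimH A / β`
(`dimH_graphOver_le_div`) and at most `dimH A + 2 - 2β` (`dimH_graphOver_le_add`). When `τ = 0`,
boundedness of `S`, that is exponent `0`, suffices.

Lower bound. The characteristic function of a Steinhaus sum is a product of values of the Bessel
function `J₀`. For an exponent `τ'` above the upper rate, 24 consecutive frequency blocks just below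
the scale `1 / |x - y|` each contribute `ℓ²` norm at least of order `|x - y| ^ τ'`. This makes the
product decay like `(1 + R² |ξ|²)⁻²` with `R` of that order. Integrability in the plane gives `P (‖S
x - S y‖ ≤ r) ≤ C (r / |x - y| ^ τ') ^ 2` (`exists_measure_norm_increment_le`). Frostman's lemma
supplies a measure on `A` with finite Riesz potentials. Integrating the small ball bound against it
and summing over dyadic scales shows that the lifted measure almost surely has small balls of the
right order. The mass distribution principle (`le_dimH_graphOver_of_ae_measure_le`) concludes.

Frostman's lemma for Borel sets comes from a dyadic net content, which is strongly subadditive and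
continuous along increasing sequences, so that a capacitability argument extracts a compact subset
of positive content. -/

namespace SteinhausSeries

open scoped ENNReal NNReal Topology InnerProductSpace

/-! ### Dyadic net content: strong subadditivity and increasing sets. -/

section DyadicContent

/-- The half-open dyadic interval `[j 2⁻ᵏ, (j + 1) 2⁻ᵏ)`, for `p = (k, j)`. -/
def dyadicCell (p : ℕ × ℤ) : Set ℝ := {x | ⌊(2 : ℝ) ^ p.1 * x⌋ = p.2}

/-- The sum of `(2⁻ᵏ)ˢ` over a family of dyadic intervals. -/
noncomputable def dyadicCost (s : ℝ) (W : Set (ℕ × ℤ)) : ℝ≥0∞ :=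
  ∑' p, W.indicator (fun p => ((2 : ℝ≥0∞)⁻¹ ^ p.1) ^ s) p

/-- A family of dyadic intervals covers a set. -/
def DyadicCovers (W : Set (ℕ × ℤ)) (E : Set ℝ) : Prop :=
  ∀ x ∈ E, ∃ k : ℕ, (k, ⌊(2 : ℝ) ^ k * x⌋) ∈ W

/-- The `s`-dimensional dyadic net content. -/
noncomputable def dyadicContent (s : ℝ) (E : Set ℝ) : ℝ≥0∞ :=
  ⨅ (W : Set (ℕ × ℤ)) (_ : DyadicCovers W E), dyadicCost s W

/-- The members of a family of dyadic intervals that lie in no longer member. -/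
def maximalCells (W : Set (ℕ × ℤ)) : Set (ℕ × ℤ) :=
  {p | p ∈ W ∧ ∀ p' ∈ W, p'.1 < p.1 → ¬ dyadicCell p ⊆ dyadicCell p'}

theorem floor_two_pow_congr {k k' : ℕ} (h : k ≤ k') {x y : ℝ}
    (hxy : ⌊(2 : ℝ) ^ k' * x⌋ = ⌊(2 : ℝ) ^ k' * y⌋) : ⌊(2 : ℝ) ^ k * x⌋ = ⌊(2 : ℝ) ^ k * y⌋ := by
  have key : ∀ z : ℝ, ⌊(2 : ℝ) ^ k * z⌋ = ⌊(2 : ℝ) ^ k' * z⌋ / ((2 ^ (k' - k) : ℕ) : ℤ) := by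
    intro z
    rw [← Int.floor_div_natCast]
    congr 1
    obtain ⟨m, rfl⟩ := Nat.exists_eq_add_of_le h
    simp only [Nat.add_sub_cancel_left, pow_add]
    push_cast
    field_simp
  rw [key, key, hxy]

theorem dyadicCell_subset {k k' : ℕ} (h : k ≤ k') (x : ℝ) :
    dyadicCell (k', ⌊(2 : ℝ) ^ k' * x⌋) ⊆ dyadicCell (k, ⌊(2 : ℝ) ^ k * x⌋) := by
  intro y hy
  exact floor_two_pow_congr h hy

theorem exists_mem_maximalCells {W : Set (ℕ × ℤ)} {x : ℝ} {k : ℕ}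
    (h : (k, ⌊(2 : ℝ) ^ k * x⌋) ∈ W) :
    ∃ l ≤ k, (l, ⌊(2 : ℝ) ^ l * x⌋) ∈ maximalCells W := by
  classical
  have hex : ∃ k : ℕ, (k, ⌊(2 : ℝ) ^ k * x⌋) ∈ W := ⟨k, h⟩
  refine ⟨Nat.find hex, Nat.find_min' hex h, Nat.find_spec hex, ?_⟩
  rintro ⟨k', j'⟩ hp' hlt hsub
  have hx : x ∈ dyadicCell (k', j') := hsub (by simp [dyadicCell])
  simp only [dyadicCell, Set.mem_ofPred_eq] at hx
  subst hx
  exact Nat.find_min hex hlt hp'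

theorem dyadicContent_le {s : ℝ} {W : Set (ℕ × ℤ)} {E : Set ℝ} (h : DyadicCovers W E) :
    dyadicContent s E ≤ dyadicCost s W := iInf₂_le W h

theorem exists_dyadicCost_lt {s : ℝ} {E : Set ℝ} {c : ℝ≥0∞} (h : dyadicContent s E < c) :
    ∃ W, DyadicCovers W E ∧ dyadicCost s W < c := by
  simpa [dyadicContent, iInf_lt_iff] using h

theorem dyadicContent_mono (s : ℝ) {E E' : Set ℝ} (h : E ⊆ E') :
    dyadicContent s E ≤ dyadicContent s E' :=
  le_iInf₂ fun _ hW => dyadicContent_le fun x hx => hW x (h hx)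

theorem dyadicCost_union_le (s : ℝ) (U V : Set (ℕ × ℤ)) :
    dyadicCost s (U ∪ V) ≤ dyadicCost s U + dyadicCost s V := by
  rw [dyadicCost, dyadicCost, dyadicCost, ← ENNReal.tsum_add]
  refine ENNReal.tsum_le_tsum fun p => ?_
  by_cases h1 : p ∈ U <;> by_cases h2 : p ∈ V <;> simp [h1, h2]

theorem dyadicContent_union_le (s : ℝ) (E E' : Set ℝ) :
    dyadicContent s (E ∪ E') ≤ dyadicContent s E + dyadicContent s E' := by
  refine ENNReal.le_of_forall_pos_le_add fun ε hε hfin => ?_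
  have hE : dyadicContent s E ≠ ∞ := fun h => by simp [h] at hfin
  have hE' : dyadicContent s E' ≠ ∞ := fun h => by simp [h] at hfin
  have hε2 : (ε / 2 : ℝ≥0∞) ≠ 0 := by simpa using hε.ne'
  obtain ⟨U, hU, hUc⟩ := exists_dyadicCost_lt (ENNReal.lt_add_right hE hε2)
  obtain ⟨V, hV, hVc⟩ := exists_dyadicCost_lt (ENNReal.lt_add_right hE' hε2)
  have hUV : DyadicCovers (U ∪ V) (E ∪ E') := by
    rintro x (hx | hx)
    · obtain ⟨k, hk⟩ := hU x hx; exact ⟨k, Or.inl hk⟩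
    · obtain ⟨k, hk⟩ := hV x hx; exact ⟨k, Or.inr hk⟩
  calc dyadicContent s (E ∪ E') ≤ dyadicCost s (U ∪ V) := dyadicContent_le hUV
    _ ≤ _ := dyadicCost_union_le s U V
    _ ≤ (dyadicContent s E + ε / 2) + (dyadicContent s E' + ε / 2) := add_le_add hUc.le hVc.le
    _ = dyadicContent s E + dyadicContent s E' + ε := by
      rw [add_add_add_comm, ENNReal.add_halves]

/-- Strong subadditivity of the dyadic content, in terms of families. -/
theorem dyadicCost_maximalCells_add_le (s : ℝ) {U V : Set (ℕ × ℤ)} {E E' : Set ℝ}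
    (hU : DyadicCovers U E) (hV : DyadicCovers V E') :
    dyadicCost s (maximalCells (U ∪ V)) + dyadicContent s (E ∩ E') ≤
      dyadicCost s U + dyadicCost s V := by
  -- `R` collects the cells left over after the maximal ones are used. A point of `E ∩ E'` lies in a
  -- cell of `U` and a cell of `V`: these coincide, or the shorter one is not maximal. Cell by cell,
  -- the maximal family and `R` together use each cell at most as often as `U` and `V` do.
  set R : Set (ℕ × ℤ) := (U ∩ V) ∪ ((U ∪ V) \ maximalCells (U ∪ V)) with hR
  have hmax : ∀ x : ℝ, ∀ k k' : ℕ, k < k' → (k, ⌊(2 : ℝ) ^ k * x⌋) ∈ U ∪ V →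
      (k', ⌊(2 : ℝ) ^ k' * x⌋) ∈ U ∪ V → (k', ⌊(2 : ℝ) ^ k' * x⌋) ∈ R := by
    intro x k k' hkk hk hk'
    exact Or.inr ⟨hk', fun hm => hm.2 _ hk hkk (dyadicCell_subset hkk.le x)⟩
  have hcov : DyadicCovers R (E ∩ E') := by
    rintro x ⟨hx, hx'⟩
    obtain ⟨k, hk⟩ := hU x hx
    obtain ⟨k', hk'⟩ := hV x hx'
    rcases lt_trichotomy k k' with h | h | h
    · exact ⟨k', hmax x k k' h (Or.inl hk) (Or.inr hk')⟩
    · subst h; exact ⟨k, Or.inl ⟨hk, hk'⟩⟩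
    · exact ⟨k, hmax x k' k h (Or.inr hk') (Or.inl hk)⟩
  refine (add_le_add le_rfl (dyadicContent_le hcov)).trans ?_
  rw [dyadicCost, dyadicCost, dyadicCost, dyadicCost, ← ENNReal.tsum_add, ← ENNReal.tsum_add]
  refine ENNReal.tsum_le_tsum fun p => ?_
  have hsub : p ∈ maximalCells (U ∪ V) → p ∈ U ∪ V := fun h => h.1
  by_cases h1 : p ∈ U <;> by_cases h2 : p ∈ V <;> by_cases h3 : p ∈ maximalCells (U ∪ V) <;>
    simp_all

/-- The dyadic content is continuous along increasing sequences of sets. -/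
theorem dyadicContent_iUnion_le {s : ℝ} {E : ℕ → Set ℝ} (hE : Monotone E) {c : ℝ≥0∞}
    (hc : c ≠ ∞) (h : ∀ n, dyadicContent s (E n) ≤ c) : dyadicContent s (⋃ n, E n) ≤ c := by
  refine ENNReal.le_of_forall_pos_le_add fun ε hε _ => ?_
  obtain ⟨δ, hδ0, hδ⟩ := ENNReal.exists_pos_sum_of_countable (ε := (ε : ℝ≥0∞)) (by simpa using hε.ne') ℕ
  have hex : ∀ n, ∃ V, DyadicCovers V (E n) ∧ dyadicCost s V ≤ dyadicContent s (E n) + δ n := by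
    intro n
    obtain ⟨V, hV, hVc⟩ := exists_dyadicCost_lt
      (ENNReal.lt_add_right (ne_top_of_le_ne_top hc (h n)) (ENNReal.coe_ne_zero.2 (hδ0 n).ne'))
    exact ⟨V, hV, hVc.le⟩
  choose V hV hVc using hex
  -- Merging the near-optimal covers one at a time and keeping only maximal cells loses just `δ n`
  -- at step `n`, by strong subadditivity, since `E n ∩ E (n + 1) = E n`.
  let W : ℕ → Set (ℕ × ℤ) := fun n => Nat.rec (V 0) (fun n W => maximalCells (W ∪ V (n + 1))) n
  have hW : ∀ n, W (n + 1) = maximalCells (W n ∪ V (n + 1)) := fun n => rfl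
  have hcov : ∀ n, DyadicCovers (W n) (E n) := by
    intro n
    cases n with
    | zero => exact hV 0
    | succ n =>
      intro x hx
      obtain ⟨k, hk⟩ := hV (n + 1) x hx
      obtain ⟨l, -, hl⟩ := exists_mem_maximalCells (W := W n ∪ V (n + 1)) (Or.inr hk)
      exact ⟨l, hl⟩
  have hcost : ∀ n, dyadicCost s (W n) ≤
      dyadicContent s (E n) + ∑ i ∈ Finset.range (n + 1), (δ i : ℝ≥0∞) := by
    intro n
    induction n with
    | zero =>
      rw [show W 0 = V 0 from rfl]
      simpa using hVc 0
    | succ n ih =>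
      have h1 := dyadicCost_maximalCells_add_le s (hcov n) (hV (n + 1))
      rw [← hW, Set.inter_eq_left.2 (hE n.le_succ)] at h1
      have hfin : dyadicContent s (E n) ≠ ∞ := ne_top_of_le_ne_top hc (h n)
      have h2 : dyadicCost s (W (n + 1)) + dyadicContent s (E n) ≤
          (dyadicContent s (E (n + 1)) + ∑ i ∈ Finset.range (n + 1 + 1), (δ i : ℝ≥0∞)) +
            dyadicContent s (E n) := by
        refine h1.trans ((add_le_add ih (hVc (n + 1))).trans (le_of_eq ?_))
        rw [Finset.sum_range_succ _ (n + 1)]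
        ring
      exact (ENNReal.add_le_add_iff_right hfin).1 h2
  have hcost' : ∀ n, dyadicCost s (W n) ≤ c + ε := fun n =>
    (hcost n).trans (add_le_add (h n) ((ENNReal.sum_le_tsum _).trans hδ.le))
  let L : Set (ℕ × ℤ) := {p | ∀ᶠ n in atTop, p ∈ W n}
  have hL : DyadicCovers L (⋃ n, E n) := by
    intro x hx
    obtain ⟨m, hm⟩ := Set.mem_iUnion.1 hx
    -- Once the longest cell ever used around `x` appears, it can be replaced only by a longer one,
    -- so it stays forever and belongs to the limit family `L`.
    obtain ⟨K, ⟨n, hn, hmem⟩, hmin⟩ : ∃ K : ℕ, (∃ n ≥ m, (K, ⌊(2 : ℝ) ^ K * x⌋) ∈ W n) ∧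
        ∀ l : ℕ, (∃ n ≥ m, (l, ⌊(2 : ℝ) ^ l * x⌋) ∈ W n) → K ≤ l := by
      classical
      obtain ⟨k, hk⟩ := hcov m x hm
      have hex : ∃ k : ℕ, ∃ n ≥ m, (k, ⌊(2 : ℝ) ^ k * x⌋) ∈ W n := ⟨k, m, le_rfl, hk⟩
      exact ⟨Nat.find hex, Nat.find_spec hex, fun l hl => Nat.find_min' hex hl⟩
    refine ⟨K, eventually_atTop.2 ⟨n, Nat.le_induction hmem fun r hr ih => ?_⟩⟩
    obtain ⟨l, hl, hlm⟩ := exists_mem_maximalCells (W := W r ∪ V (r + 1)) (Or.inl ih)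
    rw [le_antisymm (hmin l ⟨r + 1, by omega, hlm⟩) hl]
    exact hlm
  refine (dyadicContent_le hL).trans ?_
  rw [dyadicCost, ENNReal.tsum_eq_iSup_sum]
  refine iSup_le fun F => ?_
  have hev : ∀ᶠ n in atTop, ∀ p ∈ F, p ∈ L → p ∈ W n :=
    (Finset.eventually_all F).2 fun p _ => by
      by_cases hp : p ∈ L
      · exact hp.mono fun n hn _ => hn
      · exact Eventually.of_forall fun n hn => absurd hn hp
  obtain ⟨n, hn⟩ := hev.exists
  refine le_trans ?_ ((ENNReal.sum_le_tsum F).trans (hcost' n))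
  refine Finset.sum_le_sum fun p hp => ?_
  by_cases hpL : p ∈ L
  · simp [hpL, hn p hp hpL]
  · simp [hpL]

end DyadicContent

/-! ### Positivity of the content, and compact subsets of Borel sets. -/

section FrostmanCompact

theorem dyadicCost_finset (s : ℝ) (F : Finset (ℕ × ℤ)) :
    dyadicCost s (F : Set (ℕ × ℤ)) = ∑ p ∈ F, ((2 : ℝ≥0∞)⁻¹ ^ p.1) ^ s := by
  rw [dyadicCost, tsum_eq_sum (s := F)]
  · exact Finset.sum_congr rfl fun p hp => by simp [hp]
  · intro p hp
    simp [hp]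

/-- Passing from half-open dyadic intervals to open neighbourhoods at most doubles the cost. -/
theorem exists_isOpen_dyadicContent_le (s : ℝ) {W : Set (ℕ × ℤ)} {E : Set ℝ}
    (hW : DyadicCovers W E) :
    ∃ U, IsOpen U ∧ E ⊆ U ∧ dyadicContent s U ≤ dyadicCost s W + dyadicCost s W := by
  refine ⟨⋃ p ∈ W, {x : ℝ | |(2 : ℝ) ^ p.1 * x - p.2| < 1}, ?_, ?_, ?_⟩
  · refine isOpen_biUnion fun p _ => isOpen_lt (by fun_prop) continuous_const
  · intro x hx
    obtain ⟨k, hk⟩ := hW x hx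
    refine Set.mem_biUnion hk ?_
    have h1 := Int.floor_le ((2 : ℝ) ^ k * x)
    have h2 := Int.lt_floor_add_one ((2 : ℝ) ^ k * x)
    simp only [Set.mem_ofPred_eq, abs_lt]
    constructor <;> linarith
  · let e : ℕ × ℤ ≃ ℕ × ℤ := Equiv.prodCongr (Equiv.refl ℕ) (Equiv.addRight 1)
    have he : dyadicCost s (e ⁻¹' W) = dyadicCost s W := by
      rw [dyadicCost, dyadicCost, ← Equiv.tsum_eq e (W.indicator _)]
      refine tsum_congr fun p => ?_
      have h : p ∈ e ⁻¹' W ↔ e p ∈ W := Iff.rfl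
      by_cases hp : e p ∈ W
      · rw [Set.indicator_of_mem (h.2 hp), Set.indicator_of_mem hp]
        rfl
      · rw [Set.indicator_of_notMem (h.not.2 hp), Set.indicator_of_notMem hp]
    refine (dyadicContent_le (W := W ∪ e ⁻¹' W) ?_).trans
      ((dyadicCost_union_le s _ _).trans (by rw [he]))
    intro x hx
    obtain ⟨⟨k, j⟩, hp, hx⟩ := Set.mem_iUnion₂.1 hx
    simp only [Set.mem_ofPred_eq, abs_lt] at hx
    refine ⟨k, ?_⟩
    rcases lt_or_ge ((2 : ℝ) ^ k * x) j with h | h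
    · right
      have : ⌊(2 : ℝ) ^ k * x⌋ = j - 1 := by
        rw [Int.floor_eq_iff]; push_cast; constructor <;> linarith
      simpa [e, this] using hp
    · left
      have : ⌊(2 : ℝ) ^ k * x⌋ = j := by
        rw [Int.floor_eq_iff]; constructor <;> linarith
      simpa [this] using hp

/-- An interval of length in `(2⁻ᵏ⁻¹, 2⁻ᵏ]` meets at most two cells of generation `k`. -/
theorem dyadicContent_Ioc_le {s : ℝ} (hs : 0 ≤ s) {x y : ℝ} (hxy : x < y) (h1 : y - x ≤ 1) :
    dyadicContent s (Set.Ioc x y) ≤ 2 * ENNReal.ofReal (2 * (y - x)) ^ s := by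
  classical
  obtain ⟨k, hk, hk'⟩ := exists_nat_pow_near_of_lt_one (sub_pos.2 hxy) h1
    (by norm_num : (0 : ℝ) < 2⁻¹) (by norm_num)
  have hpos : (0 : ℝ) < 2 ^ k := by positivity
  have hcov : DyadicCovers (({(k, ⌊(2 : ℝ) ^ k * x⌋), (k, ⌊(2 : ℝ) ^ k * x⌋ + 1)} :
      Finset (ℕ × ℤ)) : Set (ℕ × ℤ)) (Set.Ioc x y) := by
    rintro z ⟨hxz, hzy⟩
    refine ⟨k, ?_⟩
    have h2 : (2 : ℝ) ^ k * z ≤ 2 ^ k * x + 1 := by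
      have : (2 : ℝ) ^ k * (y - x) ≤ 1 := by
        calc (2 : ℝ) ^ k * (y - x) ≤ 2 ^ k * 2⁻¹ ^ k := by gcongr
          _ = 1 := by rw [← mul_pow]; norm_num
      nlinarith
    have h3 : (2 : ℝ) ^ k * x ≤ 2 ^ k * z := by gcongr
    have h4 := Int.floor_mono h3
    have h5 := Int.floor_mono h2
    rw [Int.floor_add_one] at h5
    have : ⌊(2 : ℝ) ^ k * z⌋ = ⌊(2 : ℝ) ^ k * x⌋ ∨ ⌊(2 : ℝ) ^ k * z⌋ = ⌊(2 : ℝ) ^ k * x⌋ + 1 := by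
      omega
    simpa using this
  refine (dyadicContent_le hcov).trans ?_
  rw [dyadicCost_finset, Finset.sum_pair (by simp), two_mul]
  have : (2 : ℝ≥0∞)⁻¹ ^ k ≤ ENNReal.ofReal (2 * (y - x)) := by
    have h6 : (2 : ℝ)⁻¹ ^ k ≤ 2 * (y - x) := by
      rw [pow_succ] at hk
      linarith
    refine le_trans (le_of_eq ?_) (ENNReal.ofReal_le_ofReal h6)
    rw [ENNReal.ofReal_pow (by norm_num), ENNReal.ofReal_inv_of_pos (by norm_num)]
    norm_num
  gcongr

theorem dyadicContent_lt_top {s : ℝ} (hs : 0 ≤ s) {E : Set ℝ} {a b : ℝ} (hE : E ⊆ Set.Icc a b) :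
    dyadicContent s E < ∞ := by
  have hcov : DyadicCovers (((Finset.Icc ⌊a⌋ ⌊b⌋).image fun j => ((0 : ℕ), j) :
      Finset (ℕ × ℤ)) : Set (ℕ × ℤ)) E := by
    intro x hx
    refine ⟨0, ?_⟩
    have := hE hx
    simp [Int.floor_mono this.1, Int.floor_mono this.2]
  refine (dyadicContent_le hcov).trans_lt ?_
  rw [dyadicCost_finset]
  refine ENNReal.sum_lt_top.2 fun p _ => ENNReal.rpow_lt_top_of_nonneg hs ?_
  exact ENNReal.pow_ne_top (by simp)

/-- The content puts no explicit smallness condition on the cells, but a cover of cost below `ε ^ s`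
has only cells of diameter at most `ε`. Zero content would thus force zero Hausdorff measure,
whereas that measure is infinite below the dimension. -/
theorem dyadicContent_ne_zero_of_lt_dimH {s : ℝ≥0} (hs : 0 < s) {A : Set ℝ} (h : s < dimH A) :
    dyadicContent s A ≠ 0 := by
  classical
  intro h0
  have hex : ∀ n : ℕ, ∃ W, DyadicCovers W A ∧
      dyadicCost s W < ((n : ℝ≥0∞) + 1)⁻¹ ^ (s : ℝ) := by
    intro n
    refine exists_dyadicCost_lt ?_
    rw [h0]
    refine ENNReal.rpow_pos (by simp) ?_
    simp
  choose W hW hWc using hex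
  have hzero : Tendsto (fun n : ℕ => ((n : ℝ≥0∞) + 1)⁻¹) atTop (𝓝 0) := by
    have := (tendsto_add_atTop_iff_nat 1).2 ENNReal.tendsto_inv_nat_nhds_zero
    simpa using this
  have hdiam : ∀ n (p : ℕ × ℤ), Metric.ediam (if p ∈ W n then dyadicCell p else ∅) ^ (s : ℝ) ≤
      (W n).indicator (fun p => ((2 : ℝ≥0∞)⁻¹ ^ p.1) ^ (s : ℝ)) p := by
    intro n p
    by_cases hp : p ∈ W n
    · simp only [hp, if_true, Set.indicator_of_mem]
      gcongr
      refine Metric.ediam_le fun x hx y hy => ?_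
      have hpos : (0 : ℝ) < 2 ^ p.1 := by positivity
      simp only [dyadicCell, Set.mem_ofPred_eq, Int.floor_eq_iff] at hx hy
      have : |x - y| ≤ 2⁻¹ ^ p.1 := by
        have h1 : (2 : ℝ) ^ p.1 * |x - y| ≤ 1 := by
          rw [← abs_of_pos hpos, ← abs_mul, mul_sub, abs_le]
          constructor <;> linarith
        rw [inv_pow, ← one_div, le_div_iff₀ hpos]
        linarith
      rw [edist_dist, Real.dist_eq]
      refine (ENNReal.ofReal_le_ofReal this).trans (le_of_eq ?_)
      rw [ENNReal.ofReal_pow (by norm_num), ENNReal.ofReal_inv_of_pos (by norm_num)]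
      norm_num
    · simp [hp, hs]
  have hle := Measure.hausdorffMeasure_le_liminf_tsum (s : ℝ) A (l := atTop) (ι := fun _ : ℕ => ℕ × ℤ)
    (fun n : ℕ => ((n : ℝ≥0∞) + 1)⁻¹) hzero
    (fun n p => if p ∈ W n then dyadicCell p else ∅) ?_ ?_
  · rw [hausdorffMeasure_of_lt_dimH h] at hle
    have hlim : liminf (fun n => ∑' p : ℕ × ℤ,
        Metric.ediam (if p ∈ W n then dyadicCell p else ∅) ^ (s : ℝ)) atTop ≤ 0 := by
      have h2 : Tendsto (fun n : ℕ => ((n : ℝ≥0∞) + 1)⁻¹ ^ (s : ℝ)) atTop (𝓝 0) := by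
        have := (ENNReal.continuous_rpow_const (y := (s : ℝ))).tendsto 0 |>.comp hzero
        simpa [hs, Function.comp_def] using this
      rw [← h2.liminf_eq]
      refine liminf_le_liminf (Eventually.of_forall fun n => ?_)
      exact (ENNReal.tsum_le_tsum (hdiam n)).trans (hWc n).le
    simpa using hle.trans hlim
  · refine Eventually.of_forall fun n p => ?_
    have h3 : Metric.ediam (if p ∈ W n then dyadicCell p else ∅) ^ (s : ℝ) ≤
        ((n : ℝ≥0∞) + 1)⁻¹ ^ (s : ℝ) :=
      (hdiam n p).trans ((ENNReal.le_tsum p).trans (hWc n).le)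
    exact (ENNReal.rpow_le_rpow_iff (by exact_mod_cast hs)).1 h3
  · refine Eventually.of_forall fun n x hx => ?_
    obtain ⟨k, hk⟩ := hW n x hx
    refine Set.mem_iUnion.2 ⟨(k, ⌊(2 : ℝ) ^ k * x⌋), ?_⟩
    rw [if_pos hk]
    simp [dyadicCell]

/-- Borel sets are inner regular for positivity of the dyadic content. -/
theorem exists_isCompact_dyadicContent_ne_zero {s : ℝ} {A : Set ℝ} (hA : MeasurableSet A)
    (h : dyadicContent s A ≠ 0) : ∃ K ⊆ A, IsCompact K ∧ dyadicContent s K ≠ 0 := by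
  have han := hA.analyticSet
  rw [AnalyticSet] at han
  rcases han with rfl | ⟨f, hf, rfl⟩
  · exact ⟨∅, le_rfl, isCompact_empty, h⟩
  obtain ⟨c, hc0, hc⟩ := ENNReal.lt_iff_exists_nnreal_btwn.1 (pos_iff_ne_zero.2 h)
  let C : (k : ℕ) → (Fin k → ℕ) → Set (ℕ → ℕ) := fun k n => {x | ∀ i : Fin k, x i ≤ n i}
  -- Choquet's scheme: continuity along increasing sequences lets one coordinate at a time be
  -- bounded while the content of the image stays above `c`.
  have hstep : ∀ D : Set (ℕ → ℕ), ∀ k : ℕ, c < dyadicContent s (f '' D) →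
      ∃ N, c < dyadicContent s (f '' (D ∩ {x | x k ≤ N})) := by
    intro D k hD
    by_contra! hcon
    refine absurd hD (not_lt.2 ?_)
    have := dyadicContent_iUnion_le (E := fun N => f '' (D ∩ {x | x k ≤ N})) ?_
      ENNReal.coe_ne_top hcon
    · refine le_trans (dyadicContent_mono s ?_) this
      rintro _ ⟨x, hx, rfl⟩
      exact Set.mem_iUnion.2 ⟨x k, x, ⟨hx, by simp⟩, rfl⟩
    · intro N N' hN
      refine Set.image_mono (Set.inter_subset_inter_right _ fun x hx => ?_)
      exact le_trans hx hN
  choose! g hg using hstep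
  let D : ℕ → Set (ℕ → ℕ) := fun k => Nat.rec Set.univ (fun k D => D ∩ {x | x k ≤ g D k}) k
  have hD0 : D 0 = Set.univ := rfl
  have hDs : ∀ k, D (k + 1) = D k ∩ {x | x k ≤ g (D k) k} := fun k => rfl
  have hDc : ∀ k, c < dyadicContent s (f '' D k) := by
    intro k
    induction k with
    | zero => rwa [hD0, Set.image_univ]
    | succ k ih => rw [hDs]; exact hg _ _ ih
  let n : ℕ → ℕ := fun k => g (D k) k
  have hDmem : ∀ k x, x ∈ D k ↔ ∀ i < k, x i ≤ n i := by
    intro k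
    induction k with
    | zero => simp [hD0]
    | succ k ih =>
      intro x
      rw [hDs, Set.mem_inter_iff, ih]
      simp only [Set.mem_ofPred_eq, Nat.lt_succ_iff_lt_or_eq]
      constructor
      · rintro ⟨h1, h2⟩ i (hi | rfl)
        · exact h1 i hi
        · exact h2
      · exact fun h => ⟨fun i hi => h i (Or.inl hi), h k (Or.inr rfl)⟩
  let Q : Set (ℕ → ℕ) := Set.pi Set.univ fun i => Set.Iic (n i)
  have hQ : IsCompact Q := isCompact_univ_pi fun i => (Set.finite_Iic (n i)).isCompact
  refine ⟨f '' Q, Set.image_subset_range f Q, hQ.image hf, fun hzero => ?_⟩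
  have hc2 : (0 : ℝ≥0∞) < c / 2 := ENNReal.div_pos hc0.ne' (by simp)
  obtain ⟨W, hW, hWc⟩ := exists_dyadicCost_lt (hzero.trans_lt hc2)
  obtain ⟨U, hUo, hKU, hUc⟩ := exists_isOpen_dyadicContent_le s hW
  have hUlt : dyadicContent s U < c := by
    refine hUc.trans_lt ?_
    calc dyadicCost s W + dyadicCost s W < c / 2 + c / 2 := ENNReal.add_lt_add hWc hWc
      _ = c := ENNReal.add_halves _
  have hV : IsOpen (f ⁻¹' U) := hUo.preimage hf
  have hQV : Q ⊆ f ⁻¹' U := fun x hx => hKU ⟨x, hx, rfl⟩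
  have hcyl : ∀ x ∈ Q, ∃ m, PiNat.cylinder x m ⊆ f ⁻¹' U := by
    intro x hx
    obtain ⟨v, ⟨y, m, rfl⟩, hxv, hvU⟩ :=
      (PiNat.isTopologicalBasis_cylinders fun _ => ℕ).exists_subset_of_mem_open (hQV hx) hV
    exact ⟨m, by rwa [PiNat.mem_cylinder_iff_eq.1 hxv]⟩
  choose! m hm using hcyl
  obtain ⟨T, hTQ, hT⟩ := hQ.elim_nhds_subcover (fun x => PiNat.cylinder x (m x)) fun x _ =>
    (PiNat.isOpen_cylinder _ x (m x)).mem_nhds (PiNat.self_mem_cylinder x _)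
  let k := T.sup m
  have hDU : D k ⊆ f ⁻¹' U := by
    intro y hy
    -- Truncating `y ∈ D k` gives a point of `Q` with the same first `k` coordinates. As `k` exceeds
    -- the length of every cylinder of the finite subcover or equals it, `y` lies in the same
    -- cylinder.
    have hz : (fun i => min (y i) (n i)) ∈ Q := fun i _ => by simp
    obtain ⟨x, hxT, hx⟩ := Set.mem_iUnion₂.1 (hT hz)
    refine hm x (hTQ x hxT) ?_
    rw [PiNat.mem_cylinder_iff] at hx ⊢
    intro i hi
    rw [← hx i hi, min_eq_left]
    exact (hDmem k y).1 hy i (hi.trans_le (Finset.le_sup hxT))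
  exact absurd ((hDc k).trans_le (dyadicContent_mono s (Set.image_subset_iff.2 hDU))) hUlt.not_gt

end FrostmanCompact

/-! ### Frostman's lemma on the line. -/

section Frostman

/-- Frostman's lemma for compact sets: the measure with distribution function
`x ↦ dyadicContent s (K ∩ Iic x)` is supported on `K`. -/
theorem exists_frostman_measure_of_isCompact {s : ℝ} (hs : 0 < s) {K : Set ℝ} (hK : IsCompact K)
    (h : dyadicContent s K ≠ 0) :
    ∃ μ : Measure ℝ, IsFiniteMeasure μ ∧ μ ≠ 0 ∧ μ Kᶜ = 0 ∧
      ∃ C : ℝ≥0, ∀ x r : ℝ, 0 < r → μ (Metric.closedBall x r) ≤ C * ENNReal.ofReal r ^ s := by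
  have hfin : ∀ x, dyadicContent s (K ∩ Set.Iic x) ≠ ∞ := by
    intro x
    obtain ⟨R, hR⟩ := hK.isBounded.subset_closedBall 0
    rw [Real.closedBall_eq_Icc] at hR
    exact (dyadicContent_lt_top hs.le (Set.inter_subset_left.trans hR)).ne
  set F : ℝ → ℝ := fun x => (dyadicContent s (K ∩ Set.Iic x)).toReal with hF
  have hmono : Monotone F := fun x y hxy => ENNReal.toReal_mono (hfin y)
    (dyadicContent_mono s (Set.inter_subset_inter_right _ (Set.Iic_subset_Iic.2 hxy)))
  -- Subadditivity of the content controls the increments of `F`, which yields right continuity, the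
  -- Frostman bound, and the vanishing of the measure off `K`.
  have hincr : ∀ x y, x ≤ y →
      ENNReal.ofReal (F y - F x) ≤ dyadicContent s (K ∩ Set.Ioc x y) := by
    intro x y hxy
    rw [ENNReal.ofReal_sub _ ENNReal.toReal_nonneg, ENNReal.ofReal_toReal (hfin _),
      ENNReal.ofReal_toReal (hfin _), tsub_le_iff_left]
    refine le_trans (dyadicContent_mono s ?_) (dyadicContent_union_le s _ _)
    rw [← Set.inter_union_distrib_left, Set.Iic_union_Ioc_eq_Iic hxy]
  have hholder : ∀ x y, x < y → y - x ≤ 1 →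
      ENNReal.ofReal (F y - F x) ≤ 2 * ENNReal.ofReal (2 * (y - x)) ^ s := fun x y hxy h1 =>
    (hincr x y hxy.le).trans
      ((dyadicContent_mono s Set.inter_subset_right).trans (dyadicContent_Ioc_le hs.le hxy h1))
  have hcont : ∀ x, ContinuousWithinAt F (Set.Ici x) x := by
    intro x
    have hlim : Tendsto (fun y => F x + 2 * (2 * (y - x)) ^ s) (𝓝[≥] x) (𝓝 (F x)) := by
      have : ContinuousAt (fun y => F x + 2 * (2 * (y - x)) ^ s) x := by
        refine continuousAt_const.add (continuousAt_const.mul ?_)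
        exact ContinuousAt.rpow_const (by fun_prop) (Or.inr hs.le)
      have h2 := this.tendsto
      simp only [sub_self, mul_zero, Real.zero_rpow hs.ne', add_zero] at h2
      exact h2.mono_left nhdsWithin_le_nhds
    refine tendsto_of_tendsto_of_tendsto_of_le_of_le' tendsto_const_nhds hlim ?_ ?_
    · filter_upwards [self_mem_nhdsWithin] with y hy using hmono hy
    · have hev : ∀ᶠ y in 𝓝[≥] x, y < x + 1 :=
        nhdsWithin_le_nhds (Iio_mem_nhds (by linarith))
      filter_upwards [self_mem_nhdsWithin, hev] with y hy hy1
      have hxy : x ≤ y := hy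
      rcases hxy.eq_or_lt with rfl | hlt
      · simp [Real.zero_rpow hs.ne']
      · have h3 := hholder x y hlt (by linarith)
        have h4 : (2 : ℝ≥0∞) * ENNReal.ofReal (2 * (y - x)) ^ s =
            ENNReal.ofReal (2 * (2 * (y - x)) ^ s) := by
          rw [ENNReal.ofReal_rpow_of_nonneg (by linarith) hs.le,
            ENNReal.ofReal_mul (p := 2) (by norm_num)]
          norm_num
        rw [h4, ENNReal.ofReal_le_ofReal_iff (by
          have : (0 : ℝ) ≤ 2 * (y - x) := by linarith
          positivity)] at h3
        linarith
  let G : StieltjesFunction ℝ := ⟨F, hmono, hcont⟩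
  have hGIoc : ∀ x y, G.measure (Set.Ioc x y) = ENNReal.ofReal (F y - F x) := G.measure_Ioc
  have hKc : G.measure Kᶜ = 0 := by
    refine measure_null_of_locally_null _ fun x hx => ?_
    obtain ⟨ε, hε, hball⟩ := Metric.isOpen_iff.1 hK.isClosed.isOpen_compl x hx
    refine ⟨Set.Ioc (x - ε / 2) (x + ε / 2), mem_nhdsWithin_of_mem_nhds
      (Ioc_mem_nhds (by linarith) (by linarith)), ?_⟩
    rw [hGIoc, ← nonpos_iff_eq_zero]
    refine (hincr _ _ (by linarith)).trans (le_of_eq ?_)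
    have hempty : K ∩ Set.Ioc (x - ε / 2) (x + ε / 2) = ∅ := by
      rw [Set.eq_empty_iff_forall_notMem]
      rintro y ⟨hyK, hy1, hy2⟩
      refine hball ?_ hyK
      rw [Metric.mem_ball, Real.dist_eq, abs_lt]
      constructor <;> linarith
    rw [hempty, ← nonpos_iff_eq_zero]
    refine (dyadicContent_le (W := ∅) fun x hx => hx.elim).trans ?_
    simp [dyadicCost]
  obtain ⟨R, hR⟩ := hK.isBounded.subset_ball 0
  rw [Real.ball_eq_Ioo] at hR
  have hR' : K ⊆ Set.Ioc (0 - R) (0 + R) := hR.trans Set.Ioo_subset_Ioc_self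
  have hFR : F (0 - R) = 0 := by
    have hempty : K ∩ Set.Iic (0 - R) = ∅ := by
      rw [Set.eq_empty_iff_forall_notMem]
      rintro y ⟨hyK, hy⟩
      exact (hR' hyK).1.not_ge hy
    have h0 : dyadicContent s ∅ = 0 := by
      rw [← nonpos_iff_eq_zero]
      refine (dyadicContent_le (W := ∅) fun x hx => hx.elim).trans ?_
      simp [dyadicCost]
    simp only [hF, hempty, h0, ENNReal.toReal_zero]
  have hKR : K ∩ Set.Iic (0 + R) = K := Set.inter_eq_left.2 fun x hx => (hR' hx).2
  have huniv : G.measure Set.univ = dyadicContent s K := by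
    have h1 : G.measure Set.univ = G.measure (Set.Ioc (0 - R) (0 + R)) := by
      refine le_antisymm ?_ (measure_mono (Set.subset_univ _))
      calc G.measure Set.univ ≤ G.measure (Set.Ioc (0 - R) (0 + R) ∪ Kᶜ) := by
            refine measure_mono fun x _ => ?_
            by_cases hx : x ∈ K
            · exact Or.inl (hR' hx)
            · exact Or.inr hx
        _ ≤ G.measure (Set.Ioc (0 - R) (0 + R)) + G.measure Kᶜ := measure_union_le _ _
        _ = _ := by rw [hKc, add_zero]
    rw [h1, hGIoc, hFR, sub_zero, hF]
    simp only []
    rw [ENNReal.ofReal_toReal (hfin _), hKR]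
  have hKfin : dyadicContent s K ≠ ∞ := by
    have h2 := hfin (0 + R)
    rwa [hKR] at h2
  refine ⟨G.measure, ⟨by rw [huniv]; exact hKfin.lt_top⟩, fun h0 => h ?_, hKc,
    2 * 6 ^ s + (dyadicContent s K).toNNReal * 3 ^ s, fun x r hr => ?_⟩
  · rw [← huniv, h0]; simp
  have hcoe : (((2 * 6 ^ s + (dyadicContent s K).toNNReal * 3 ^ s : ℝ≥0) : ℝ≥0∞)) =
      2 * 6 ^ s + dyadicContent s K * 3 ^ s := by
    push_cast
    rw [ENNReal.coe_toNNReal hKfin, ENNReal.coe_rpow_of_nonneg _ hs.le,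
      ENNReal.coe_rpow_of_nonneg _ hs.le]
    norm_num
  rw [hcoe]
  rcases le_or_gt (3 * r) 1 with hr1 | hr1
  -- The left end is moved to `x - 2 * r` because `Ioc (x - r) (x + r)` would miss the endpoint `x -
  -- r`; the interval then has length `3 * r`.
  · calc G.measure (Metric.closedBall x r) ≤ G.measure (Set.Ioc (x - 2 * r) (x + r)) := by
          refine measure_mono fun y hy => ?_
          rw [Metric.mem_closedBall, Real.dist_eq, abs_le] at hy
          constructor <;> linarith
      _ ≤ 2 * ENNReal.ofReal (2 * ((x + r) - (x - 2 * r))) ^ s := by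
          rw [hGIoc]
          exact hholder _ _ (by linarith) (by linarith)
      _ = 2 * 6 ^ s * ENNReal.ofReal r ^ s := by
          rw [mul_assoc, ← ENNReal.mul_rpow_of_nonneg _ _ hs.le,
            show (6 : ℝ≥0∞) = ENNReal.ofReal 6 by norm_num, ← ENNReal.ofReal_mul (by norm_num)]
          ring_nf
      _ ≤ _ := by gcongr; exact le_self_add
  · calc G.measure (Metric.closedBall x r) ≤ dyadicContent s K * 1 := by
          rw [mul_one, ← huniv]
          exact measure_mono (Set.subset_univ _)
      _ ≤ dyadicContent s K * (3 ^ s * ENNReal.ofReal r ^ s) := by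
          gcongr
          rw [← ENNReal.mul_rpow_of_nonneg _ _ hs.le,
            show (3 : ℝ≥0∞) = ENNReal.ofReal 3 by norm_num, ← ENNReal.ofReal_mul (by norm_num)]
          refine ENNReal.one_le_rpow ?_ hs
          rw [← ENNReal.ofReal_one]
          exact ENNReal.ofReal_le_ofReal hr1.le
      _ = dyadicContent s K * 3 ^ s * ENNReal.ofReal r ^ s := by rw [mul_assoc]
      _ ≤ _ := by gcongr; exact le_add_self

/-- Frostman's lemma for Borel subsets of the real line. -/
theorem exists_frostman_measure {s : ℝ≥0} (hs : 0 < s) {A : Set ℝ} (hA : MeasurableSet A)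
    (h : s < dimH A) :
    ∃ μ : Measure ℝ, IsFiniteMeasure μ ∧ μ ≠ 0 ∧ μ Aᶜ = 0 ∧
      ∃ C : ℝ≥0, ∀ x r : ℝ, 0 < r →
        μ (Metric.closedBall x r) ≤ C * ENNReal.ofReal r ^ (s : ℝ) := by
  obtain ⟨K, hKA, hK, hK0⟩ := exists_isCompact_dyadicContent_ne_zero hA
    (dyadicContent_ne_zero_of_lt_dimH hs h)
  obtain ⟨μ, hfin, h0, hKc, C, hC⟩ :=
    exists_frostman_measure_of_isCompact (by exact_mod_cast hs) hK hK0
  exact ⟨μ, hfin, h0, measure_mono_null (Set.compl_subset_compl.2 hKA) hKc, C, hC⟩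

end Frostman

/-! ### Dimension bounds for graphs of Hölder functions. -/

section HolderGraph

/-- Hölder continuity of exponent `β` on bounded sets. -/
def LocallyHolder (β : ℝ) (f : ℝ → ℂ) : Prop :=
  ∀ N : ℕ, ∃ C : ℝ, 0 ≤ C ∧ ∀ x ∈ Set.Icc (-N : ℝ) N, ∀ y ∈ Set.Icc (-N : ℝ) N,
    ‖f x - f y‖ ≤ C * |x - y| ^ β

theorem dist_graph_le (f : ℝ → ℂ) (x y : ℝ) :
    dist (!₂[x, (f x).re, (f x).im] : EuclideanSpace ℝ (Fin 3)) !₂[y, (f y).re, (f y).im] ≤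
      |x - y| + |(f x).re - (f y).re| + |(f x).im - (f y).im| := by
  rw [EuclideanSpace.dist_eq, Fin.sum_univ_three]
  simp only [Real.dist_eq]
  refine Real.sqrt_le_iff.2 ⟨by positivity, ?_⟩
  simp
  nlinarith [sq_abs (x - y), sq_abs ((f x).re - (f y).re), sq_abs ((f x).im - (f y).im),
    mul_nonneg (abs_nonneg (x - y)) (abs_nonneg ((f x).re - (f y).re)),
    mul_nonneg (abs_nonneg (x - y)) (abs_nonneg ((f x).im - (f y).im)),
    mul_nonneg (abs_nonneg ((f x).re - (f y).re)) (abs_nonneg ((f x).im - (f y).im))]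

/-- As `β ≤ 1`, the identity is also `β`-Hölder at distances at most `1`, so `x ↦ (x, f x)` is
locally `β`-Hölder. -/
theorem dimH_graphOver_le_div {β : ℝ≥0} (hβ : 0 < β) (hβ1 : β ≤ 1) {f : ℝ → ℂ}
    (hf : LocallyHolder β f) (A : Set ℝ) : dimH (graphOver f A) ≤ dimH A / β := by
  refine dimH_image_le_of_locally_holder_on hβ fun x _ => ?_
  obtain ⟨N, hN⟩ := exists_nat_ge (|x| + 1)
  obtain ⟨C, hC0, hC⟩ := hf N
  refine ⟨(1 + 2 * C).toNNReal, Metric.ball x (1 / 2),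
    mem_nhdsWithin_of_mem_nhds (Metric.ball_mem_nhds x (by norm_num)), ?_⟩
  have hmem : ∀ y ∈ Metric.ball x (1 / 2), y ∈ Set.Icc (-N : ℝ) N := by
    intro y hy
    rw [Metric.mem_ball, Real.dist_eq, abs_lt] at hy
    have := abs_le.1 (le_refl |x|)
    constructor <;> linarith
  intro y hy z hz
  have h1 := hC y (hmem y hy) z (hmem z hz)
  have hyz : |y - z| ≤ 1 := by
    rw [Metric.mem_ball, Real.dist_eq, abs_lt] at hy hz
    rw [abs_le]
    constructor <;> linarith
  have h2 : |y - z| ≤ |y - z| ^ (β : ℝ) :=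
    Real.self_le_rpow_of_le_one (abs_nonneg _) hyz (by exact_mod_cast hβ1)
  have h3 := Complex.abs_re_le_norm (f y - f z)
  have h4 := Complex.abs_im_le_norm (f y - f z)
  rw [Complex.sub_re] at h3
  rw [Complex.sub_im] at h4
  rw [edist_dist, edist_dist, Real.dist_eq, ENNReal.ofReal_rpow_of_nonneg (abs_nonneg _) β.coe_nonneg]
  rw [← ENNReal.ofReal, ← ENNReal.ofReal_mul (by positivity)]
  refine ENNReal.ofReal_le_ofReal ((dist_graph_le f y z).trans ?_)
  linarith

/-- The part of the graph over `B` lying over one square of the grid of mesh `ρ`. -/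
def graphPiece (f : ℝ → ℂ) (B : Set ℝ) (ρ : ℝ) (p : ℤ × ℤ) : Set (EuclideanSpace ℝ (Fin 3)) :=
  graphOver f {x | x ∈ B ∧ ⌊(f x).re / ρ⌋ = p.1 ∧ ⌊(f x).im / ρ⌋ = p.2}

theorem ediam_graphPiece_le {f : ℝ → ℂ} {B : Set ℝ} {ρ : ℝ} (hρ : 0 ≤ ρ)
    (hB : ∀ x ∈ B, ∀ y ∈ B, |x - y| ≤ ρ) (p : ℤ × ℤ) :
    Metric.ediam (graphPiece f B ρ p) ≤ ENNReal.ofReal (3 * ρ) := by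
  refine Metric.ediam_le ?_
  rintro _ ⟨x, ⟨hx, hx1, hx2⟩, rfl⟩ _ ⟨y, ⟨hy, hy1, hy2⟩, rfl⟩
  have hxy := hB x hx y hy
  rw [edist_dist]
  refine ENNReal.ofReal_le_ofReal ?_
  rcases hρ.eq_or_lt with rfl | hpos
  · have : x = y := by
      have := abs_nonpos_iff.1 hxy
      linarith
    simp [this]
  · have key : ∀ u v : ℝ, ⌊u / ρ⌋ = ⌊v / ρ⌋ → |u - v| ≤ ρ := by
      intro u v huv
      have := Int.abs_sub_lt_one_of_floor_eq_floor huv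
      rw [← sub_div, abs_div, abs_of_pos hpos, div_lt_one hpos] at this
      exact this.le
    have h1 := key _ _ (hx1.trans hy1.symm)
    have h2 := key _ _ (hx2.trans hy2.symm)
    linarith [dist_graph_le f x y]

theorem card_Icc_floor_le {a b : ℝ} (h : a ≤ b) :
    ((Finset.Icc ⌊a⌋ ⌊b⌋).card : ℝ) ≤ b - a + 2 := by
  rw [Int.card_Icc]
  have h1 : ⌊a⌋ ≤ ⌊b⌋ := Int.floor_mono h
  have h2 : (((⌊b⌋ + 1 - ⌊a⌋).toNat : ℤ) : ℝ) = ⌊b⌋ + 1 - ⌊a⌋ := by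
    rw [Int.toNat_of_nonneg (by omega)]
    push_cast
    ring
  rw [Int.cast_natCast] at h2
  rw [h2]
  linarith [Int.floor_le b, Int.lt_floor_add_one a]

/-- The image of `B` has diameter at most `C * ρ ^ β`, so it meets `O(ρ ^ (2 * (β - 1)))` squares of
mesh `ρ`, and each piece has diameter at most `3 * ρ`. The extra exponent `2 - 2 * β` exactly
compensates this count. -/
theorem tsum_ediam_graphPiece_le {f : ℝ → ℂ} {B : Set ℝ} {ρ β C d : ℝ} (hρ : 0 ≤ ρ) (hρ1 : ρ ≤ 1)
    (hβ0 : 0 ≤ β) (hβ1 : β ≤ 1) (hC : 0 ≤ C) (hd : 0 < d)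
    (hB : ∀ x ∈ B, ∀ y ∈ B, |x - y| ≤ ρ)
    (hf : ∀ x ∈ B, ∀ y ∈ B, ‖f x - f y‖ ≤ C * |x - y| ^ β) :
    ∑' p, Metric.ediam (graphPiece f B ρ p) ^ (d + (2 - 2 * β)) ≤
      ENNReal.ofReal ((2 * C + 2) ^ 2 * 3 ^ (d + (2 - 2 * β))) * ENNReal.ofReal ρ ^ d := by
  set e := d + (2 - 2 * β) with he
  have he0 : 0 < e := by linarith
  rcases B.eq_empty_or_nonempty with rfl | ⟨x₀, hx₀⟩
  · simp [graphPiece, graphOver, he0]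
  -- Mesh `0` does occur, for covering sets of diameter `0`; then `B` is a single point and every
  -- piece has diameter `0`.
  rcases hρ.eq_or_lt with rfl | hpos
  · have : ∀ p, Metric.ediam (graphPiece f B 0 p) = 0 := by
      intro p
      have := ediam_graphPiece_le (f := f) le_rfl hB p
      simpa using this
    simp [this, he0]
  have hdiv : ∀ x ∈ B, ∀ T : ℂ → ℝ, |T (f x) - T (f x₀)| ≤ ‖f x - f x₀‖ →
      ⌊T (f x) / ρ⌋ ∈ Finset.Icc ⌊T (f x₀) / ρ - C * ρ ^ (β - 1)⌋
        ⌊T (f x₀) / ρ + C * ρ ^ (β - 1)⌋ := by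
    intro x hx T hT
    have h1 : |T (f x) - T (f x₀)| ≤ C * ρ ^ (β - 1) * ρ := by
      refine hT.trans ((hf x hx x₀ hx₀).trans ?_)
      rw [mul_assoc, ← Real.rpow_add_one hpos.ne']
      have := hB x hx x₀ hx₀
      rw [sub_add_cancel]
      gcongr
    have h2 : |T (f x) / ρ - T (f x₀) / ρ| ≤ C * ρ ^ (β - 1) := by
      rw [← sub_div, abs_div, abs_of_pos hpos, div_le_iff₀ hpos]
      exact h1
    rw [abs_le] at h2
    rw [Finset.mem_Icc]
    exact ⟨Int.floor_mono (by linarith), Int.floor_mono (by linarith)⟩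
  set I : (ℂ → ℝ) → Finset ℤ := fun T => Finset.Icc ⌊T (f x₀) / ρ - C * ρ ^ (β - 1)⌋
        ⌊T (f x₀) / ρ + C * ρ ^ (β - 1)⌋ with hI
  have hCρ : 0 ≤ C * ρ ^ (β - 1) := by positivity
  have hone : 1 ≤ ρ ^ (β - 1) := Real.one_le_rpow_of_pos_of_le_one_of_nonpos hpos hρ1 (by linarith)
  have hcard : ∀ T, ((I T).card : ℝ) ≤ (2 * C + 2) * ρ ^ (β - 1) := by
    intro T
    refine (card_Icc_floor_le (by linarith)).trans ?_
    linarith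
  have hsupp : ∀ p ∉ (I Complex.re ×ˢ I Complex.im),
      Metric.ediam (graphPiece f B ρ p) ^ e = 0 := by
    intro p hp
    have : graphPiece f B ρ p = ∅ := by
      rw [graphPiece, graphOver, Set.image_eq_empty, Set.eq_empty_iff_forall_notMem]
      rintro x ⟨hx, hx1, hx2⟩
      refine hp (Finset.mem_product.2 ⟨?_, ?_⟩)
      · rw [← hx1]
        exact hdiv x hx Complex.re (by rw [← Complex.sub_re]; exact Complex.abs_re_le_norm _)
      · rw [← hx2]
        exact hdiv x hx Complex.im (by rw [← Complex.sub_im]; exact Complex.abs_im_le_norm _)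
    rw [this, Metric.ediam_empty, ENNReal.zero_rpow_of_pos he0]
  rw [tsum_eq_sum hsupp]
  calc ∑ p ∈ I Complex.re ×ˢ I Complex.im, Metric.ediam (graphPiece f B ρ p) ^ e
      ≤ ∑ p ∈ I Complex.re ×ˢ I Complex.im, ENNReal.ofReal (3 * ρ) ^ e := by
        refine Finset.sum_le_sum fun p _ => ?_
        gcongr
        exact ediam_graphPiece_le hρ hB p
    _ = ENNReal.ofReal ((I Complex.re).card * (I Complex.im).card * (3 * ρ) ^ e) := by
        rw [Finset.sum_const, Finset.card_product, nsmul_eq_mul,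
          ENNReal.ofReal_rpow_of_nonneg (by positivity) he0.le,
          ENNReal.ofReal_mul (by positivity), ENNReal.ofReal_mul (by positivity)]
        simp
    _ ≤ ENNReal.ofReal ((2 * C + 2) ^ 2 * 3 ^ e * ρ ^ d) := by
        refine ENNReal.ofReal_le_ofReal ?_
        calc ((I Complex.re).card : ℝ) * (I Complex.im).card * (3 * ρ) ^ e
            ≤ ((2 * C + 2) * ρ ^ (β - 1)) * ((2 * C + 2) * ρ ^ (β - 1)) * (3 * ρ) ^ e := by
              gcongr
              · exact hcard _
              · exact hcard _
          _ = (2 * C + 2) ^ 2 * 3 ^ e * (ρ ^ (β - 1) * ρ ^ (β - 1) * ρ ^ e) := by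
              rw [Real.mul_rpow (by norm_num) hρ]; ring
          _ = (2 * C + 2) ^ 2 * 3 ^ e * ρ ^ d := by
              rw [← Real.rpow_add hpos, ← Real.rpow_add hpos, he]
              congr 2
              ring
    _ = _ := by
        rw [ENNReal.ofReal_mul (by positivity), ENNReal.ofReal_rpow_of_nonneg hρ hd.le]

/-- Each member of an efficient cover of `A` is refined into the graph pieces over it, with mesh
equal to its own diameter. The total cost grows only by a constant factor. -/
theorem hausdorffMeasure_graphOver_ne_top {f : ℝ → ℂ} {A : Set ℝ} {β C d : ℝ}
    (hβ0 : 0 ≤ β) (hβ1 : β ≤ 1) (hC : 0 ≤ C) (hd : 0 < d)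
    (hf : ∀ x ∈ A, ∀ y ∈ A, ‖f x - f y‖ ≤ C * |x - y| ^ β) (hA : μH[d] A = 0) :
    μH[d + (2 - 2 * β)] (graphOver f A) ≠ ∞ := by
  set e := d + (2 - 2 * β) with he
  have he0 : 0 < e := by linarith
  have hex : ∀ m : ℕ, ∃ t : ℕ → Set ℝ, A ⊆ ⋃ n, t n ∧
      (∀ n, Metric.ediam (t n) ≤ ENNReal.ofReal ((m : ℝ) + 1)⁻¹) ∧
      ∑' n, ⨆ _ : (t n).Nonempty, Metric.ediam (t n) ^ d < 1 := by
    intro m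
    rw [Measure.hausdorffMeasure_apply] at hA
    have h1 := (ENNReal.iSup_eq_zero.1 (ENNReal.iSup_eq_zero.1 hA
      (ENNReal.ofReal ((m : ℝ) + 1)⁻¹)) (by rw [ENNReal.ofReal_pos]; positivity))
    have h2 := h1.trans_lt one_pos
    obtain ⟨t, h3⟩ := iInf_lt_iff.1 h2
    simp only [iInf_lt_iff] at h3
    obtain ⟨h4, h5, h6⟩ := h3
    exact ⟨t, h4, h5, h6⟩
  choose t htA htd htc using hex
  have hle1 : ∀ m : ℕ, ((m : ℝ) + 1)⁻¹ ≤ 1 := fun m => inv_le_one_of_one_le₀ (by simp)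
  have htop : ∀ m i, Metric.ediam (t m i) ≠ ∞ := fun m i =>
    ne_top_of_le_ne_top ENNReal.ofReal_ne_top (htd m i)
  set ρ : ℕ → ℕ → ℝ := fun m i => (Metric.ediam (t m i)).toReal with hρ
  have hρ0 : ∀ m i, 0 ≤ ρ m i := fun m i => ENNReal.toReal_nonneg
  have hρm : ∀ m i, ρ m i ≤ ((m : ℝ) + 1)⁻¹ := fun m i =>
    ENNReal.toReal_le_of_le_ofReal (by positivity) (htd m i)
  have hB : ∀ m i, ∀ x ∈ A ∩ t m i, ∀ y ∈ A ∩ t m i, |x - y| ≤ ρ m i := by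
    intro m i x hx y hy
    have := Metric.edist_le_ediam_of_mem hx.2 hy.2
    rw [← Real.dist_eq, dist_edist]
    exact ENNReal.toReal_mono (htop m i) this
  set K := ENNReal.ofReal ((2 * C + 2) ^ 2 * 3 ^ e) with hK
  have hlim : Tendsto (fun m : ℕ => ENNReal.ofReal (3 * ((m : ℝ) + 1)⁻¹)) atTop (𝓝 0) := by
    rw [← ENNReal.ofReal_zero]
    refine ENNReal.tendsto_ofReal ?_
    have := (tendsto_one_div_add_atTop_nhds_zero_nat (𝕜 := ℝ)).const_mul 3
    simpa using this
  have hmain := Measure.hausdorffMeasure_le_liminf_tsum e (graphOver f A) (l := atTop)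
    (ι := fun _ : ℕ => ℕ × ℤ × ℤ) _ hlim
    (fun m q => graphPiece f (A ∩ t m q.1) (ρ m q.1) q.2) ?_ ?_
  · refine ne_top_of_le_ne_top (b := K) ENNReal.ofReal_ne_top (hmain.trans ?_)
    refine liminf_le_of_frequently_le' (Eventually.frequently (Eventually.of_forall fun m => ?_))
    rw [ENNReal.tsum_prod']
    calc ∑' i, ∑' p : ℤ × ℤ, Metric.ediam (graphPiece f (A ∩ t m i) (ρ m i) p) ^ e
        ≤ ∑' i, K * ⨆ _ : (t m i).Nonempty, Metric.ediam (t m i) ^ d := by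
          refine ENNReal.tsum_le_tsum fun i => ?_
          rcases (t m i).eq_empty_or_nonempty with hemp | hne
          · simp [graphPiece, graphOver, he0, hemp]
          · refine (tsum_ediam_graphPiece_le (hρ0 m i) ((hρm m i).trans (hle1 m)) hβ0 hβ1 hC hd
              (hB m i) fun x hx y hy => hf x hx.1 y hy.1).trans ?_
            simp only [hρ, ENNReal.ofReal_toReal (htop m i), hne, ciSup_pos]
            exact le_rfl
      _ ≤ K * 1 := by
          rw [ENNReal.tsum_mul_left]
          gcongr
          exact (htc m).le
      _ = K := mul_one K
  · refine Eventually.of_forall fun m q => ?_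
    refine (ediam_graphPiece_le (hρ0 m q.1) (hB m q.1) q.2).trans (ENNReal.ofReal_le_ofReal ?_)
    have := hρm m q.1
    gcongr
  · refine Eventually.of_forall fun m => ?_
    rintro _ ⟨x, hx, rfl⟩
    obtain ⟨i, hi⟩ := Set.mem_iUnion.1 (htA m hx)
    exact Set.mem_iUnion.2 ⟨(i, ⌊(f x).re / ρ m i⌋, ⌊(f x).im / ρ m i⌋), x,
      ⟨⟨hx, hi⟩, rfl, rfl⟩, rfl⟩

/-- Countable stability reduces to bounded parts of `A`, where one Hölder constant is available.
Exponent `β = 0` is allowed and serves the case `τ = 0`. -/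
theorem dimH_graphOver_le_add {β : ℝ} (hβ0 : 0 ≤ β) (hβ1 : β ≤ 1) {f : ℝ → ℂ}
    (hf : LocallyHolder β f) (A : Set ℝ) :
    dimH (graphOver f A) ≤ dimH A + ENNReal.ofReal (2 - 2 * β) := by
  have hU : graphOver f A = ⋃ N : ℕ, graphOver f (A ∩ Set.Icc (-N : ℝ) N) := by
    have : A = ⋃ N : ℕ, A ∩ Set.Icc (-N : ℝ) N := by
      ext x
      simp only [Set.mem_iUnion, Set.mem_inter_iff, Set.mem_Icc, ← abs_le]
      obtain ⟨N, hN⟩ := exists_nat_ge |x|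
      exact ⟨fun h => ⟨N, h, hN⟩, fun ⟨_, h, _⟩ => h⟩
    conv_lhs => rw [this]
    simp only [graphOver, Set.image_iUnion]
  rw [hU, dimH_iUnion]
  refine iSup_le fun N => ENNReal.le_of_forall_pos_le_add fun ε hε hfin => ?_
  obtain ⟨C, hC0, hC⟩ := hf N
  have hdA : dimH A ≠ ∞ := fun h => by simp [h] at hfin
  set d : ℝ≥0 := (dimH A).toNNReal + ε with hd
  have hd0 : 0 < d := by positivity
  have hdlt : dimH (A ∩ Set.Icc (-N : ℝ) N) < d := by
    refine (dimH_mono Set.inter_subset_left).trans_lt ?_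
    rw [hd, ENNReal.coe_add, ENNReal.coe_toNNReal hdA]
    exact ENNReal.lt_add_right hdA (by simpa using hε.ne')
  have hne := hausdorffMeasure_graphOver_ne_top hβ0 hβ1 hC0 (d := d) (by exact_mod_cast hd0)
    (A := A ∩ Set.Icc (-N : ℝ) N) (fun x hx y hy => hC x hx.2 y hy.2)
    (hausdorffMeasure_of_dimH_lt hdlt)
  have hcast : (d : ℝ) + (2 - 2 * β) = ((d + (2 - 2 * β).toNNReal : ℝ≥0) : ℝ) := by
    rw [NNReal.coe_add d (2 - 2 * β).toNNReal, Real.coe_toNNReal _ (by linarith)]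
  rw [hcast] at hne
  refine (dimH_le_of_hausdorffMeasure_ne_top hne).trans (le_of_eq ?_)
  rw [ENNReal.coe_add, hd, ENNReal.coe_add, ENNReal.coe_toNNReal hdA, ENNReal.ofReal]
  ring

end HolderGraph

/-! ### Chaining and Kolmogorov's continuity criterion. -/

section HolderPaths

/-- The left end point of the dyadic interval of generation `n` that contains `x`. -/
noncomputable def dyadicFloor (n : ℕ) (x : ℝ) : ℝ := ⌊(2 : ℝ) ^ n * x⌋ / 2 ^ n

theorem tendsto_dyadicFloor (x : ℝ) : Tendsto (fun n => dyadicFloor n x) atTop (𝓝 x) := by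
  have h0 : Tendsto (fun n : ℕ => x - (1 / 2 : ℝ) ^ n) atTop (𝓝 x) := by
    simpa using tendsto_const_nhds.sub
      (tendsto_pow_atTop_nhds_zero_of_lt_one (r := (1 / 2 : ℝ)) (by norm_num) (by norm_num))
  refine tendsto_of_tendsto_of_tendsto_of_le_of_le h0 tendsto_const_nhds (fun n => ?_) fun n => ?_
  · have h1 := Int.lt_floor_add_one ((2 : ℝ) ^ n * x)
    simp only [dyadicFloor]
    rw [le_div_iff₀ (by positivity), sub_mul, ← mul_pow]
    norm_num
    linarith
  · simp only [dyadicFloor]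
    rw [div_le_iff₀ (by positivity)]
    linarith [Int.floor_le ((2 : ℝ) ^ n * x)]

/-- Control of the increments over dyadic intervals gives Hölder continuity. -/
theorem exists_holder_of_dyadic_increments {f : ℝ → ℂ} (hf : Continuous f) {β : ℝ} (hβ : 0 < β)
    {N n₀ : ℕ} (h : ∀ n ≥ n₀, ∀ j : ℤ, |j| ≤ N * 2 ^ n →
      ‖f ((j + 1) / 2 ^ n) - f (j / 2 ^ n)‖ ≤ ((2 : ℝ) ^ (-β)) ^ n) :
    ∃ C : ℝ, 0 ≤ C ∧ ∀ x ∈ Set.Icc (-N : ℝ) N, ∀ y ∈ Set.Icc (-N : ℝ) N,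
      ‖f x - f y‖ ≤ C * |x - y| ^ β := by
  set r : ℝ := (2 : ℝ) ^ (-β) with hr
  have hr0 : 0 < r := by positivity
  have hr1 : r < 1 := Real.rpow_lt_one_of_one_lt_of_neg (by norm_num) (by linarith)
  have hrn : ∀ n : ℕ, r ^ n = ((2 : ℝ)⁻¹ ^ n) ^ β := by
    intro n
    rw [hr, Real.rpow_neg (by norm_num), ← Real.inv_rpow (by norm_num), ← Real.rpow_natCast,
      ← Real.rpow_mul (by norm_num), mul_comm, Real.rpow_mul (by norm_num), Real.rpow_natCast]
  have habs : ∀ x ∈ Set.Icc (-N : ℝ) N, ∀ n : ℕ, |⌊(2 : ℝ) ^ n * x⌋| ≤ N * 2 ^ n := by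
    intro x hx n
    have hp : (0 : ℝ) < 2 ^ n := by positivity
    rw [abs_le]
    constructor
    · rw [Int.le_floor]
      push_cast
      nlinarith [hx.1]
    · have : (⌊(2 : ℝ) ^ n * x⌋ : ℝ) ≤ N * 2 ^ n := by
        have := Int.floor_le ((2 : ℝ) ^ n * x)
        nlinarith [hx.2]
      exact_mod_cast this
  -- Consecutive dyadic approximations of `x` agree or are neighbours at the finer generation, so
  -- the telescoping series is dominated by a geometric one.
  have happrox : ∀ x ∈ Set.Icc (-N : ℝ) N, ∀ n ≥ n₀,
      ‖f (dyadicFloor n x) - f x‖ ≤ r ^ n * (r / (1 - r)) := by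
    intro x hx n hn
    have hstep : ∀ m, dist (f (dyadicFloor (n + m) x)) (f (dyadicFloor (n + (m + 1)) x)) ≤
        r ^ (n + 1) * r ^ m := by
      intro m
      rw [dist_comm, dist_eq_norm]
      set j := ⌊(2 : ℝ) ^ (n + m) * x⌋ with hj
      have h1 := Int.floor_le ((2 : ℝ) ^ (n + m) * x)
      have h2 := Int.lt_floor_add_one ((2 : ℝ) ^ (n + m) * x)
      have hpow : (2 : ℝ) ^ (n + (m + 1)) * x = 2 * ((2 : ℝ) ^ (n + m) * x) := by
        rw [← add_assoc, pow_succ]; ring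
      have hcases : ⌊(2 : ℝ) ^ (n + (m + 1)) * x⌋ = 2 * j ∨
          ⌊(2 : ℝ) ^ (n + (m + 1)) * x⌋ = 2 * j + 1 := by
        have h3 : 2 * j ≤ ⌊(2 : ℝ) ^ (n + (m + 1)) * x⌋ := by
          rw [Int.le_floor, hpow]; push_cast; linarith
        have h4 : ⌊(2 : ℝ) ^ (n + (m + 1)) * x⌋ < 2 * j + 2 := by
          rw [Int.floor_lt, hpow]; push_cast; linarith
        omega
      have hj2 : dyadicFloor (n + m) x = ((2 * j : ℤ) : ℝ) / 2 ^ (n + (m + 1)) := by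
        rw [dyadicFloor, ← hj, ← add_assoc, pow_succ]
        push_cast
        field_simp
      rcases hcases with hc | hc
      · rw [hj2, dyadicFloor, hc, sub_self, norm_zero]
        positivity
      · rw [hj2, dyadicFloor, hc]
        refine le_trans ?_ (le_of_eq (by rw [← pow_add]; congr 1; ring : r ^ (n + (m + 1)) = _))
        have h5 := h (n + (m + 1)) (by omega) (2 * j) ?_
        · push_cast at h5 ⊢
          exact h5
        · have := habs x hx (n + m)
          rw [← hj] at this
          rw [abs_mul, ← add_assoc, pow_succ]
          norm_num
          linarith
    have hlim : Tendsto (fun m => f (dyadicFloor (n + m) x)) atTop (𝓝 (f x)) :=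
      (hf.tendsto x).comp ((tendsto_dyadicFloor x).comp (tendsto_add_atTop_nat n |>.congr
        fun m => by rw [add_comm]))
    have := dist_le_of_le_geometric_of_tendsto₀ r (r ^ (n + 1)) hr1 hstep hlim
    rw [add_zero, dist_eq_norm] at this
    refine this.trans (le_of_eq ?_)
    rw [pow_succ]; ring
  obtain ⟨M, hM⟩ := (isCompact_Icc (a := (-N : ℝ)) (b := N)).exists_bound_of_continuousOn
    hf.continuousOn
  -- One increment between neighbouring dyadic points, plus the two tails leading to `x` and to `y`.
  set D := 1 + 2 * (r / (1 - r)) with hD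
  have hD0 : 0 ≤ D := by
    have : 0 < 1 - r := by linarith
    positivity
  have hr2 : 0 < r ^ n₀ := by positivity
  have hclose : ∀ x ∈ Set.Icc (-N : ℝ) N, ∀ y ∈ Set.Icc (-N : ℝ) N, x < y →
      y - x ≤ 2⁻¹ ^ n₀ → ‖f x - f y‖ ≤ D * 2 ^ β * |x - y| ^ β := by
    intro x hx y hy hxy hle
    obtain ⟨n, hn, hn'⟩ := exists_nat_pow_near_of_lt_one (sub_pos.2 hxy)
      (hle.trans (pow_le_one₀ (by norm_num) (by norm_num)))
      (by norm_num : (0 : ℝ) < 2⁻¹) (by norm_num)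
    have hnn : n₀ ≤ n := by
      by_contra hlt
      have : (2 : ℝ)⁻¹ ^ n₀ ≤ 2⁻¹ ^ (n + 1) :=
        pow_le_pow_of_le_one (by norm_num) (by norm_num) (by omega)
      linarith
    have hadj : ‖f (dyadicFloor n x) - f (dyadicFloor n y)‖ ≤ r ^ n := by
      rw [norm_sub_rev]
      have hp : (0 : ℝ) < 2 ^ n := by positivity
      have h2 : (2 : ℝ) ^ n * y ≤ 2 ^ n * x + 1 := by
        have : (2 : ℝ) ^ n * (y - x) ≤ 1 := by
          calc (2 : ℝ) ^ n * (y - x) ≤ 2 ^ n * 2⁻¹ ^ n := by gcongr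
            _ = 1 := by rw [← mul_pow]; norm_num
        linarith
      have h3 : (2 : ℝ) ^ n * x ≤ 2 ^ n * y := by gcongr
      have h4 := Int.floor_mono h3
      have h5 := Int.floor_mono h2
      rw [Int.floor_add_one] at h5
      have hc : ⌊(2 : ℝ) ^ n * y⌋ = ⌊(2 : ℝ) ^ n * x⌋ ∨
          ⌊(2 : ℝ) ^ n * y⌋ = ⌊(2 : ℝ) ^ n * x⌋ + 1 := by omega
      rcases hc with hc | hc
      · rw [dyadicFloor, dyadicFloor, hc, sub_self, norm_zero]
        positivity
      · have := h n hnn _ (habs x hx n)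
        rw [dyadicFloor, dyadicFloor, hc]
        push_cast
        exact this
    have hsum : ‖f x - f y‖ ≤ r ^ n * D := by
      have e : f x - f y = -(f (dyadicFloor n x) - f x) +
        (f (dyadicFloor n x) - f (dyadicFloor n y)) + (f (dyadicFloor n y) - f y) := by ring
      rw [e]
      refine (norm_add₃_le).trans ?_
      rw [norm_neg]
      have h6 := happrox x hx n hnn
      have h7 := happrox y hy n hnn
      rw [hD]
      linarith
    refine hsum.trans ?_
    have hpow : r ^ n ≤ 2 ^ β * |x - y| ^ β := by
      rw [hrn, abs_sub_comm, abs_of_pos (sub_pos.2 hxy), ← Real.mul_rpow (by norm_num)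
        (sub_pos.2 hxy).le]
      rw [pow_succ] at hn
      gcongr
      linarith
    calc r ^ n * D ≤ 2 ^ β * |x - y| ^ β * D := by gcongr
      _ = _ := by ring
  refine ⟨max (D * 2 ^ β) (2 * |M| / r ^ n₀), le_max_of_le_left (by positivity), ?_⟩
  have hall : ∀ x ∈ Set.Icc (-N : ℝ) N, ∀ y ∈ Set.Icc (-N : ℝ) N, x < y →
      ‖f x - f y‖ ≤ max (D * 2 ^ β) (2 * |M| / r ^ n₀) * |x - y| ^ β := by
    intro x hx y hy hxy
    rcases le_or_gt (y - x) (2⁻¹ ^ n₀) with hle | hgt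
    · exact (hclose x hx y hy hxy hle).trans (by gcongr; exact le_max_left _ _)
    · calc ‖f x - f y‖ ≤ ‖f x‖ + ‖f y‖ := norm_sub_le _ _
        _ ≤ 2 * |M| := by linarith [hM x hx, hM y hy, le_abs_self M]
        _ = 2 * |M| / r ^ n₀ * r ^ n₀ := by field_simp
        _ ≤ 2 * |M| / r ^ n₀ * |x - y| ^ β := by
            rw [hrn n₀, abs_sub_comm, abs_of_pos (sub_pos.2 hxy)]
            gcongr
        _ ≤ _ := by gcongr; exact le_max_right _ _
  intro x hx y hy
  rcases lt_trichotomy x y with hlt | rfl | hgt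
  · exact hall x hx y hy hlt
  · simp only [sub_self, norm_zero]
    positivity
  · rw [norm_sub_rev, abs_sub_comm]
    exact hall y hy x hx hgt

/-- A form of Kolmogorov's continuity criterion. -/
theorem ae_locallyHolder_of_measure_le {Ω : Type*} [MeasurableSpace Ω] {P : Measure Ω}
    {S : ℝ → Ω → ℂ} (hS : ∀ ω, Continuous fun x => S x ω) {β β' : ℝ} (hβ' : 0 < β')
    (h : ∀ p : ℕ, ∃ C : ℝ≥0, ∀ x y : ℝ, x ≠ y → ∀ ε : ℝ, 0 < ε →
      P {ω | ε ≤ ‖S x ω - S y ω‖} ≤ C * ENNReal.ofReal (|x - y| ^ β / ε) ^ (2 * p)) (hββ' : β' < β) :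
    ∀ᵐ ω ∂P, LocallyHolder β' fun x => S x ω := by
  -- The moment is chosen so high that a single dyadic increment fails with probability `O(4⁻ⁿ)`;
  -- there are `O(2ⁿ)` of them, so Borel–Cantelli applies.
  obtain ⟨m, hm⟩ := exists_nat_ge (2 / (β - β'))
  rw [div_le_iff₀ (by linarith)] at hm
  obtain ⟨C, hC⟩ := h m
  set p := 2 * m with hp
  have hp2 : 2 ≤ p * (β - β') := by
    rw [hp]
    push_cast
    linarith
  refine ae_all_iff.2 fun N => ?_
  set r : ℝ := (2 : ℝ) ^ (-β') with hr
  have hr0 : 0 < r := by positivity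
  let J : ℕ → Finset ℤ := fun n => Finset.Icc (-(N * 2 ^ n)) (N * 2 ^ n)
  let E : ℕ → Set Ω := fun n =>
    ⋃ j ∈ J n, {ω | r ^ n ≤ ‖S ((j + 1) / 2 ^ n) ω - S (j / 2 ^ n) ω‖}
  have hcard : ∀ n, ((J n).card : ℝ) ≤ (2 * N + 1) * 2 ^ n := by
    intro n
    have h1 : (((J n).card : ℤ) : ℝ) = 2 * (N * 2 ^ n) + 1 := by
      have h0 : (0 : ℤ) ≤ N * 2 ^ n := by positivity
      rw [Int.card_Icc, Int.toNat_of_nonneg (by linarith)]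
      push_cast
      ring
    rw [Int.cast_natCast] at h1
    rw [h1]
    have : (1 : ℝ) ≤ 2 ^ n := one_le_pow₀ (by norm_num)
    linarith
  have hratio : ∀ n : ℕ, (((2 : ℝ)⁻¹ ^ n) ^ β / r ^ n) ^ p ≤ (1 / 4) ^ n := by
    intro n
    have h1 : ((2 : ℝ)⁻¹ ^ n) ^ β / r ^ n = (2 : ℝ) ^ (-(n * (β - β'))) := by
      rw [hr, ← Real.rpow_natCast, ← Real.rpow_natCast, ← Real.rpow_mul (by norm_num),
        ← Real.rpow_mul (by norm_num), Real.inv_rpow (by norm_num), ← Real.rpow_neg (by norm_num),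
        ← Real.rpow_sub (by norm_num)]
      congr 1
      ring
    have h2 : (1 / 4 : ℝ) ^ n = (2 : ℝ) ^ (-(n * 2 : ℝ)) := by
      rw [Real.rpow_neg (by norm_num), mul_comm, Real.rpow_mul (by norm_num), Real.rpow_natCast,
        one_div, inv_pow]
      norm_num
    rw [h1, h2, ← Real.rpow_natCast, ← Real.rpow_mul (by norm_num)]
    refine Real.rpow_le_rpow_of_exponent_le (by norm_num) ?_
    have : (n : ℝ) * 2 ≤ n * (p * (β - β')) := by gcongr
    linarith
  have hE : ∀ n, P (E n) ≤ ENNReal.ofReal ((2 * N + 1) * C * (1 / 2) ^ n) := by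
    intro n
    refine (measure_biUnion_finset_le _ _).trans ?_
    have hterm : ∀ j ∈ J n, P {ω | r ^ n ≤ ‖S ((j + 1) / 2 ^ n) ω - S (j / 2 ^ n) ω‖} ≤
        ENNReal.ofReal (C * (1 / 4) ^ n) := by
      intro j _
      have hsub : ((j : ℝ) + 1) / 2 ^ n - j / 2 ^ n = 2⁻¹ ^ n := by
        rw [← sub_div, inv_pow]; ring
      have hne : ((j : ℝ) + 1) / 2 ^ n ≠ j / 2 ^ n := by
        intro heq
        rw [heq, sub_self] at hsub
        exact absurd hsub (by positivity)
      refine (hC _ _ hne _ (by positivity)).trans ?_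
      rw [hsub, abs_of_pos (by positivity), ← ENNReal.ofReal_pow (by positivity),
        ENNReal.ofReal_mul C.coe_nonneg, ENNReal.ofReal_coe_nnreal]
      gcongr
      exact hratio n
    refine (Finset.sum_le_sum hterm).trans ?_
    rw [Finset.sum_const, nsmul_eq_mul, ← ENNReal.ofReal_natCast,
      ← ENNReal.ofReal_mul (by positivity)]
    refine ENNReal.ofReal_le_ofReal ?_
    calc ((J n).card : ℝ) * (C * (1 / 4) ^ n) ≤ (2 * N + 1) * 2 ^ n * (C * (1 / 4) ^ n) := by
          gcongr
          exact hcard n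
      _ = (2 * N + 1) * C * (2 ^ n * (1 / 4) ^ n) := by ring
      _ = _ := by rw [← mul_pow]; norm_num
  have hsum : ∑' n, P (E n) ≠ ∞ := by
    refine ne_top_of_le_ne_top ?_ (ENNReal.tsum_le_tsum hE)
    have : Summable fun n : ℕ => (2 * N + 1) * (C : ℝ) * (1 / 2) ^ n :=
      (summable_geometric_of_lt_one (by norm_num) (by norm_num)).mul_left _
    exact this.tsum_ofReal_ne_top
  filter_upwards [ae_eventually_notMem hsum] with ω hω
  obtain ⟨n₀, hn₀⟩ := eventually_atTop.1 hω
  refine exists_holder_of_dyadic_increments (hS ω) hβ' (n₀ := n₀) fun n hn j hj => ?_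
  by_contra hcon
  refine hn₀ n hn (Set.mem_biUnion (x := j) ?_ (not_le.1 hcon).le)
  simp only [J, Finset.coe_Icc, Set.mem_Icc]
  exact abs_le.1 hj

end HolderPaths

/-! ### Steinhaus sums: sub-Gaussian tails. -/

section SteinhausSums

/-- The Steinhaus phase `exp (2 π i t)`. -/
noncomputable def phase (t : ℝ) : ℂ := Complex.exp (2 * Real.pi * Complex.I * t)

theorem norm_phase (t : ℝ) : ‖phase t‖ = 1 := by
  rw [phase, show 2 * (Real.pi : ℂ) * Complex.I * t = ((2 * Real.pi * t : ℝ) : ℂ) * Complex.I by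
    push_cast; ring, Complex.norm_exp_ofReal_mul_I]

theorem continuous_phase : Continuous phase := by
  unfold phase
  fun_prop

theorem integral_phase : ∫ t in Set.Icc (0 : ℝ) 1, phase t = 0 := by
  rw [integral_Icc_eq_integral_Ioc, ← intervalIntegral.integral_of_le zero_le_one]
  have h : (2 * Real.pi * Complex.I : ℂ) ≠ 0 := Complex.two_pi_I_ne_zero
  simp only [phase]
  rw [integral_exp_mul_complex h]
  simp [Complex.exp_two_pi_mul_I]

variable {Ω : Type*}

/-- The random variable `∑ c n * exp (2 π i θ n)`. -/
noncomputable def steinhausSum (c : ℕ → ℂ) (θ : ℕ → Ω → ℝ) (ω : Ω) : ℂ :=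
  ∑' n, c n * phase (θ n ω)

theorem summable_steinhaus {c : ℕ → ℂ} (hc : Summable fun n => ‖c n‖) (t : ℕ → ℝ) :
    Summable fun n => c n * phase (t n) :=
  Summable.of_norm (by simpa [norm_phase] using hc)

theorem norm_sum_steinhaus_le {c : ℕ → ℂ} (hc : Summable fun n => ‖c n‖) (t : ℕ → ℝ)
    (s : Finset ℕ) : ‖∑ n ∈ s, c n * phase (t n)‖ ≤ ∑' n, ‖c n‖ := by
  refine (norm_sum_le _ _).trans ?_
  simp only [norm_mul, norm_phase, mul_one]
  exact hc.sum_le_tsum s fun _ _ => norm_nonneg _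

theorem norm_steinhausSum_le {c : ℕ → ℂ} (hc : Summable fun n => ‖c n‖) (θ : ℕ → Ω → ℝ) (ω : Ω) :
    ‖steinhausSum c θ ω‖ ≤ ∑' n, ‖c n‖ := by
  refine (norm_tsum_le_tsum_norm (by simpa [norm_phase] using hc)).trans (le_of_eq ?_)
  simp [norm_phase]

theorem tendsto_sum_steinhaus {c : ℕ → ℂ} (hc : Summable fun n => ‖c n‖) (θ : ℕ → Ω → ℝ) (ω : Ω) :
    Tendsto (fun N => ∑ n ∈ Finset.range N, c n * phase (θ n ω)) atTop
      (𝓝 (steinhausSum c θ ω)) :=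
  (summable_steinhaus hc fun n => θ n ω).hasSum.tendsto_sum_nat

variable [MeasurableSpace Ω] {P : Measure Ω}

theorem measurable_steinhausSum {c : ℕ → ℂ} (hc : Summable fun n => ‖c n‖) {θ : ℕ → Ω → ℝ}
    (hθ : ∀ n, Measurable (θ n)) : Measurable (steinhausSum c θ) := by
  refine measurable_of_tendsto_metrizable (f := fun N ω => ∑ n ∈ Finset.range N,
    c n * phase (θ n ω)) (fun N => ?_) (tendsto_pi_nhds.2 fun ω => tendsto_sum_steinhaus hc θ ω)
  exact Finset.measurable_sum _ fun n _ =>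
    (continuous_phase.measurable.comp (hθ n)).const_mul (c n)

/-- Hoeffding's lemma: the variable is centred and takes values in `[-‖c‖, ‖c‖]`. -/
theorem hasSubgaussianMGF_re_mul_phase [IsProbabilityMeasure P] {θ : Ω → ℝ} (hθ : Measurable θ)
    (hlaw : P.map θ = (volume : Measure ℝ).restrict (Set.Icc 0 1)) (c : ℂ) :
    HasSubgaussianMGF (fun ω => (c * phase (θ ω)).re) (‖c‖₊ ^ 2) P := by
  have hmeas : Measurable fun ω => (c * phase (θ ω)).re :=
    Complex.measurable_re.comp ((continuous_phase.measurable.comp hθ).const_mul c)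
  have h := hasSubgaussianMGF_of_mem_Icc_of_integral_eq_zero (μ := P) (a := -‖c‖) (b := ‖c‖)
    hmeas.aemeasurable (ae_of_all _ fun ω => ?_) ?_
  · convert h using 1
    ext
    simp only [NNReal.coe_pow, coe_nnnorm, NNReal.coe_div, Real.norm_eq_abs]
    rw [sub_neg_eq_add, ← two_mul, abs_of_nonneg (by positivity)]
    norm_num
  · have := Complex.abs_re_le_norm (c * phase (θ ω))
    rw [norm_mul, norm_phase, mul_one, abs_le] at this
    exact this
  · have h1 : ∫ ω, c * phase (θ ω) ∂P = 0 := by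
      rw [integral_const_mul]
      have : ∫ ω, phase (θ ω) ∂P = ∫ t, phase t ∂(P.map θ) :=
        (integral_map hθ.aemeasurable continuous_phase.aestronglyMeasurable).symm
      rw [this, hlaw, integral_phase, mul_zero]
    have hint : Integrable (fun ω => c * phase (θ ω)) P := by
      refine Integrable.of_bound (C := ‖c‖) ?_ (ae_of_all _ fun ω => ?_)
      · exact ((continuous_phase.measurable.comp hθ).const_mul c).aestronglyMeasurable
      · rw [norm_mul, norm_phase, mul_one]
    have h2 := integral_re hint
    simp only [RCLike.re_to_complex, h1] at h2
    simpa using h2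

/-- Independence gives the bound for partial sums. These are uniformly bounded by `∑ ‖c n‖`, so
dominated convergence passes it to the limit. -/
theorem hasSubgaussianMGF_re_steinhausSum [IsProbabilityMeasure P] {θ : ℕ → Ω → ℝ}
    (hθ : IsIIDUniform P θ) {c : ℕ → ℂ} (hc : Summable fun n => ‖c n‖) {V : ℝ≥0}
    (hV : ∀ N, ∑ n ∈ Finset.range N, ‖c n‖₊ ^ 2 ≤ V) :
    HasSubgaussianMGF (fun ω => (steinhausSum c θ ω).re) V P := by
  obtain ⟨hm, hind, hlaw⟩ := hθ
  have hmeas := measurable_steinhausSum hc hm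
  have hfin : ∀ N, HasSubgaussianMGF (fun ω => ∑ n ∈ Finset.range N, (c n * phase (θ n ω)).re)
      (∑ n ∈ Finset.range N, ‖c n‖₊ ^ 2) P := fun N =>
    HasSubgaussianMGF.sum_of_iIndepFun
      (hind.comp (fun n t => (c n * phase t).re) fun n => Complex.measurable_re.comp
        (continuous_phase.measurable.const_mul (c n)))
      fun n _ => hasSubgaussianMGF_re_mul_phase (hm n) (hlaw n) (c n)
  have hbd : ∀ z : ℂ, ‖z‖ ≤ ∑' n, ‖c n‖ → z.re ∈ Set.Icc (-∑' n, ‖c n‖) (∑' n, ‖c n‖) :=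
    fun z hz => abs_le.1 ((Complex.abs_re_le_norm z).trans hz)
  refine ⟨fun t => integrable_exp_mul_of_mem_Icc (Complex.measurable_re.comp hmeas).aemeasurable
    (ae_of_all _ fun ω => hbd _ (norm_steinhausSum_le hc θ ω)), fun t => ?_⟩
  have hlim : Tendsto (fun N => mgf (fun ω => ∑ n ∈ Finset.range N, (c n * phase (θ n ω)).re) P t)
      atTop (𝓝 (mgf (fun ω => (steinhausSum c θ ω).re) P t)) := by
    refine tendsto_integral_of_dominated_convergence (fun _ => Real.exp (|t| * ∑' n, ‖c n‖))
      (fun N => (hfin N).integrable_exp_mul t |>.aestronglyMeasurable) (integrable_const _)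
      (fun N => ae_of_all _ fun ω => ?_) (ae_of_all _ fun ω => ?_)
    · rw [Real.norm_eq_abs, Real.abs_exp, Real.exp_le_exp]
      simp only [← Complex.re_sum]
      refine (le_abs_self _).trans ?_
      rw [abs_mul]
      gcongr
      exact (Complex.abs_re_le_norm _).trans (norm_sum_steinhaus_le hc _ _)
    · have h1 := (Complex.continuous_re.tendsto _).comp (tendsto_sum_steinhaus hc θ ω)
      have h2 := (Real.continuous_exp.tendsto _).comp (h1.const_mul t)
      refine h2.congr fun N => ?_
      simp [Complex.re_sum]
  refine le_of_tendsto' hlim fun N => ((hfin N).mgf_le t).trans ?_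
  rw [Real.exp_le_exp]
  have : ((∑ n ∈ Finset.range N, ‖c n‖₊ ^ 2 : ℝ≥0) : ℝ) ≤ V := by exact_mod_cast hV N
  gcongr

/-- Gaussian tail bound for Steinhaus sums. -/
theorem measureReal_le_norm_steinhausSum_le [IsProbabilityMeasure P] {θ : ℕ → Ω → ℝ}
    (hθ : IsIIDUniform P θ) {c : ℕ → ℂ} (hc : Summable fun n => ‖c n‖) {V : ℝ≥0}
    (hV : ∀ N, ∑ n ∈ Finset.range N, ‖c n‖₊ ^ 2 ≤ V) {ε : ℝ} (hε : 0 ≤ ε) :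
    P.real {ω | ε ≤ ‖steinhausSum c θ ω‖} ≤ 4 * Real.exp (-ε ^ 2 / (8 * V)) := by
  -- A rotation `u` is absorbed into the coefficients without changing their moduli, so the
  -- real-part bound covers the four directions `±1`, `±I`.
  have hdir : ∀ u : ℂ, ‖u‖ = 1 → P.real {ω | ε / 2 ≤ (u * steinhausSum c θ ω).re} ≤
      Real.exp (-ε ^ 2 / (8 * V)) := by
    intro u hu
    have hu' : ‖u‖₊ = 1 := by ext; exact hu
    have h1 := (hasSubgaussianMGF_re_steinhausSum hθ (c := fun n => u * c n)
      (by simpa [hu] using hc) (V := V) (by simpa [hu'] using hV)).measure_ge_le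
      (ε := ε / 2) (by linarith)
    have h2 : ∀ ω, steinhausSum (fun n => u * c n) θ ω = u * steinhausSum c θ ω := by
      intro ω
      simp only [steinhausSum, mul_assoc, tsum_mul_left]
    simp only [h2] at h1
    refine h1.trans (le_of_eq ?_)
    congr 1
    rw [div_pow, ← neg_div, div_div]
    ring
  have hsub : {ω | ε ≤ ‖steinhausSum c θ ω‖} ⊆
      ({ω | ε / 2 ≤ (1 * steinhausSum c θ ω).re} ∪ {ω | ε / 2 ≤ (-1 * steinhausSum c θ ω).re}) ∪
      ({ω | ε / 2 ≤ (Complex.I * steinhausSum c θ ω).re} ∪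
        {ω | ε / 2 ≤ (-Complex.I * steinhausSum c θ ω).re}) := by
    intro ω hω
    have h1 : ε ≤ |(steinhausSum c θ ω).re| + |(steinhausSum c θ ω).im| :=
      le_trans hω (Complex.norm_le_abs_re_add_abs_im _)
    simp only [Set.mem_union, Set.mem_ofPred_eq, one_mul, neg_mul, Complex.neg_re, Complex.I_mul_re,
      neg_neg]
    by_contra! hcon
    obtain ⟨⟨h2, h3⟩, h4, h5⟩ := hcon
    have h6 : |(steinhausSum c θ ω).re| < ε / 2 := abs_lt.2 ⟨by linarith, h2⟩
    have h7 : |(steinhausSum c θ ω).im| < ε / 2 := abs_lt.2 ⟨by linarith, h5⟩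
    linarith
  refine (measureReal_mono hsub).trans ?_
  refine (measureReal_union_le _ _).trans ?_
  have h1 := measureReal_union_le (μ := P) {ω | ε / 2 ≤ (1 * steinhausSum c θ ω).re}
    {ω | ε / 2 ≤ (-1 * steinhausSum c θ ω).re}
  have h2 := measureReal_union_le (μ := P) {ω | ε / 2 ≤ (Complex.I * steinhausSum c θ ω).re}
    {ω | ε / 2 ≤ (-Complex.I * steinhausSum c θ ω).re}
  linarith [hdir 1 (by simp), hdir (-1) (by simp), hdir Complex.I (by simp),
    hdir (-Complex.I) (by simp)]

/-- From `u ^ p / p! ≤ exp u` the Gaussian tail becomes the polynomial tail of arbitrary order that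
Kolmogorov's criterion consumes. -/
theorem measure_le_norm_steinhausSum_le [IsProbabilityMeasure P] {θ : ℕ → Ω → ℝ}
    (hθ : IsIIDUniform P θ) {c : ℕ → ℂ} (hc : Summable fun n => ‖c n‖) {v : ℝ} (hv : 0 < v)
    (hV : ∀ N, ∑ n ∈ Finset.range N, ‖c n‖ ^ 2 ≤ v ^ 2) (p : ℕ) {ε : ℝ} (hε : 0 < ε) :
    P {ω | ε ≤ ‖steinhausSum c θ ω‖} ≤
      ENNReal.ofReal (4 * p.factorial * 8 ^ p) * ENNReal.ofReal (v / ε) ^ (2 * p) := by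
  have h := measureReal_le_norm_steinhausSum_le hθ hc (V := (v ^ 2).toNNReal)
    (fun N => by
      rw [← NNReal.coe_le_coe, Real.coe_toNNReal _ (by positivity)]
      push_cast
      exact hV N) hε.le
  rw [← ENNReal.ofReal_pow (by positivity), ← ENNReal.ofReal_mul (by positivity),
    ← ENNReal.ofReal_toReal (measure_ne_top P _)]
  refine ENNReal.ofReal_le_ofReal (h.trans ?_)
  rw [Real.coe_toNNReal _ (by positivity)]
  set u := ε ^ 2 / (8 * v ^ 2) with hu
  have hu0 : 0 < u := by positivity
  have h1 : Real.exp (-ε ^ 2 / (8 * v ^ 2)) ≤ p.factorial / u ^ p := by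
    rw [neg_div, ← hu, Real.exp_neg, inv_le_comm₀ (Real.exp_pos _) (by positivity), inv_div]
    exact Real.pow_div_factorial_le_exp u hu0.le p
  calc 4 * Real.exp (-ε ^ 2 / (8 * v ^ 2)) ≤ 4 * (p.factorial / u ^ p) := by gcongr
    _ = 4 * p.factorial * 8 ^ p * (v / ε) ^ (2 * p) := by
      have h2 : u⁻¹ = 8 * (v / ε) ^ 2 := by
        rw [hu]
        field_simp
      rw [div_eq_mul_inv, ← inv_pow, h2, mul_pow, ← pow_mul]
      ring

end SteinhausSums

/-! ### Block rates and weighted summability of the coefficients. -/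

section SteinhausSeriesPaths

section Rates

variable {a : ℕ → ℂ} {lam : ℕ → ℝ} {q : ℝ}

theorem blockNorm_nonneg (a : ℕ → ℂ) (lam : ℕ → ℝ) (q : ℝ) (k : ℕ) : 0 ≤ blockNorm a lam q k :=
  Real.sqrt_nonneg _

theorem blockNorm_sq (a : ℕ → ℂ) (lam : ℕ → ℝ) (q : ℝ) (k : ℕ) :
    blockNorm a lam q k ^ 2 =
      ∑' n : {n : ℕ // q ^ k ≤ lam n ∧ lam n < q ^ (k + 1)}, ‖a n‖ ^ 2 :=
  Real.sq_sqrt (tsum_nonneg fun _ => by positivity)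

theorem blockRate_eq_coe {k : ℕ} (h : 0 < blockNorm a lam q k) :
    blockRate a lam q k = ((-Real.log (blockNorm a lam q k) / (k * Real.log q) : ℝ) : EReal) := by
  rw [blockRate, ENNReal.log_ofReal_of_pos h, ← EReal.coe_neg, ← EReal.coe_div]

theorem blockRate_eq_top (hq : 1 < q) {k : ℕ} (hk : 0 < k) (h : blockNorm a lam q k = 0) :
    blockRate a lam q k = ⊤ := by
  rw [blockRate, h, ENNReal.ofReal_zero, ENNReal.log_zero, EReal.neg_bot]
  have : (0 : ℝ) < k * Real.log q := mul_pos (by exact_mod_cast hk) (Real.log_pos hq)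
  exact EReal.top_div_of_pos_ne_top (by exact_mod_cast this) (EReal.coe_ne_top _)

theorem blockNorm_le_of_lt_blockRate (hq : 1 < q) {k : ℕ} (hk : 0 < k) {c : ℝ}
    (h : (c : EReal) < blockRate a lam q k) : blockNorm a lam q k ≤ q ^ (-(c * k)) := by
  rcases (blockNorm_nonneg a lam q k).eq_or_lt with h0 | h0
  · rw [← h0]
    positivity
  rw [blockRate_eq_coe h0, EReal.coe_lt_coe_iff, lt_div_iff₀
    (mul_pos (by exact_mod_cast hk) (Real.log_pos hq))] at h
  rw [← Real.log_le_log_iff h0 (by positivity), Real.log_rpow (by positivity)]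
  linarith

theorem le_blockNorm_of_blockRate_lt (hq : 1 < q) {k : ℕ} (hk : 0 < k) {c : ℝ}
    (h : blockRate a lam q k < c) : q ^ (-(c * k)) ≤ blockNorm a lam q k := by
  rcases (blockNorm_nonneg a lam q k).eq_or_lt with h0 | h0
  · rw [blockRate_eq_top hq hk h0.symm] at h
    exact absurd h (by simp)
  rw [blockRate_eq_coe h0, EReal.coe_lt_coe_iff, div_lt_iff₀
    (mul_pos (by exact_mod_cast hk) (Real.log_pos hq))] at h
  rw [← Real.log_le_log_iff (by positivity) h0, Real.log_rpow (by positivity)]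
  linarith

theorem eventually_blockNorm_le (hq : 1 < q) {c : ℝ} (h : (c : EReal) < lowerRate a lam q) :
    ∀ᶠ k in atTop, blockNorm a lam q k ≤ q ^ (-(c * k)) := by
  filter_upwards [eventually_lt_of_lt_liminf h, eventually_gt_atTop 0] with k hk hk0
  exact blockNorm_le_of_lt_blockRate hq hk0 hk

theorem eventually_le_blockNorm (hq : 1 < q) {c : ℝ} (h : upperRate a lam q < c) :
    ∀ᶠ k : ℕ in atTop, q ^ (-(c * k)) ≤ blockNorm a lam q k := by
  filter_upwards [eventually_lt_of_limsup_lt h, eventually_gt_atTop 0] with k hk hk0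
  exact le_blockNorm_of_blockRate_lt hq hk0 hk

theorem summable_norm_sq (ha : Summable fun n => ‖a n‖) : Summable fun n => ‖a n‖ ^ 2 := by
  refine Summable.of_norm_bounded_eventually_nat ha ?_
  filter_upwards [ha.tendsto_atTop_zero.eventually (eventually_le_nhds one_pos)] with n hn
  rw [norm_pow, norm_norm]
  exact pow_le_of_le_one (norm_nonneg _) hn two_ne_zero

/-- Pick `c` with `β < c < σ`. The `k`-th block contributes at most `q ^ (2β(k + 1)) * s k ^ 2`,
which is eventually at most a constant times `q ^ (-2(c - β)k)`. -/
theorem summable_norm_sq_mul_rpow (ha : Summable fun n => ‖a n‖) (hlam : ∀ n, 1 ≤ lam n)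
    (hq : 1 < q) {β : ℝ} (hβ : 0 ≤ β) (h : (β : EReal) < lowerRate a lam q) :
    Summable fun n => ‖a n‖ ^ 2 * lam n ^ (2 * β) := by
  obtain ⟨c, hβc, hc⟩ := EReal.lt_iff_exists_real_btwn.1 h
  rw [EReal.coe_lt_coe_iff] at hβc
  have hq0 : 0 < q := by linarith
  let B : ℕ → Set ℕ := fun k => {n | q ^ k ≤ lam n ∧ lam n < q ^ (k + 1)}
  have hB : ⋃ k, B k = Set.univ := by
    refine Set.eq_univ_of_forall fun n => ?_
    obtain ⟨k, hk⟩ := exists_nat_pow_near (hlam n) hq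
    exact Set.mem_iUnion.2 ⟨k, hk⟩
  set b : ℕ → ℝ := fun k => (q ^ (k + 1)) ^ (2 * β) * blockNorm a lam q k ^ 2 with hb
  have hbsum : Summable b := by
    refine Summable.of_norm_bounded_eventually_nat
      (g := fun k => q ^ (2 * β) * (q ^ (-(2 * (c - β)))) ^ k) ?_ ?_
    · refine (summable_geometric_of_lt_one (by positivity) ?_).mul_left _
      exact Real.rpow_lt_one_of_one_lt_of_neg hq (by linarith)
    · filter_upwards [eventually_blockNorm_le hq hc] with k hk
      rw [Real.norm_of_nonneg (by positivity)]
      calc (q ^ (k + 1)) ^ (2 * β) * blockNorm a lam q k ^ 2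
          ≤ (q ^ (k + 1)) ^ (2 * β) * (q ^ (-(c * k))) ^ 2 := by
            have := blockNorm_nonneg a lam q k
            gcongr
        _ = _ := by
            rw [← Real.rpow_natCast q (k + 1), ← Real.rpow_mul hq0.le, ← Real.rpow_mul_natCast hq0.le,
              ← Real.rpow_mul_natCast hq0.le, ← Real.rpow_add hq0, ← Real.rpow_add hq0]
            congr 1
            push_cast
            ring
  have hblock : ∀ k, ∑' n : B k, ENNReal.ofReal (‖a n‖ ^ 2 * lam n ^ (2 * β)) ≤
      ENNReal.ofReal (b k) := by
    intro k
    have h1 : ∀ n : B k, ENNReal.ofReal (‖a n‖ ^ 2 * lam n ^ (2 * β)) ≤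
        ENNReal.ofReal ((q ^ (k + 1)) ^ (2 * β) * ‖a n‖ ^ 2) := by
      intro n
      refine ENNReal.ofReal_le_ofReal ?_
      rw [mul_comm]
      have := n.2.2.le
      have := hlam n
      gcongr
    refine (ENNReal.tsum_le_tsum h1).trans (le_of_eq ?_)
    have hs : Summable fun n : B k => (q ^ (k + 1)) ^ (2 * β) * ‖a n‖ ^ 2 :=
      ((summable_norm_sq ha).subtype (B k)).mul_left _
    rw [← ENNReal.ofReal_tsum_of_nonneg (fun _ => by positivity) hs, tsum_mul_left, hb]
    simp only [blockNorm_sq]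
    rfl
  have htot : ∑' n, ENNReal.ofReal (‖a n‖ ^ 2 * lam n ^ (2 * β)) ≠ ∞ := by
    rw [← tsum_univ, ← hB]
    refine ne_top_of_le_ne_top hbsum.tsum_ofReal_ne_top ?_
    exact (ENNReal.tsum_iUnion_le_tsum (fun n => ENNReal.ofReal (‖a n‖ ^ 2 * lam n ^ (2 * β)))
      B).trans (ENNReal.tsum_le_tsum hblock)
  have := ENNReal.summable_toReal htot
  refine this.congr fun n => ?_
  rw [ENNReal.toReal_ofReal]
  have := hlam n
  positivity

end Rates

/-! ### Increments and Hölder continuity of the random series. -/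

section Increments

variable {a : ℕ → ℂ} {lam : ℕ → ℝ} {φ : ℕ → ℝ → ℂ}

/-- Lipschitz control handles short distances and boundedness the others. The constant depends
neither on `n` nor on `β`. -/
theorem exists_holder_bound (hφb : UniformlyBounded φ) (hφ : LocallyUniformlyBiLipschitz φ) :
    ∃ K : ℝ, 0 < K ∧ ∀ β : ℝ, 0 ≤ β → β ≤ 1 → ∀ n u v, ‖φ n u - φ n v‖ ≤ K * |u - v| ^ β := by
  obtain ⟨C, hC⟩ := hφb
  obtain ⟨L, δ, hL, hδ, h⟩ := hφ
  have hC0 : 0 ≤ C := (norm_nonneg _).trans (hC 0 0)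
  set m := min δ 1 with hm
  have hm0 : 0 < m := lt_min hδ one_pos
  refine ⟨max L (2 * C / m), lt_max_of_lt_left (by linarith), fun β hβ0 hβ1 n u v => ?_⟩
  rcases le_or_gt |u - v| m with hle | hgt
  · calc ‖φ n u - φ n v‖ ≤ L * |u - v| := (h n u v (hle.trans (min_le_left _ _))).2
      _ ≤ L * |u - v| ^ β := by
        gcongr
        exact Real.self_le_rpow_of_le_one (abs_nonneg _) (hle.trans (min_le_right _ _)) hβ1
      _ ≤ _ := by gcongr; exact le_max_left _ _
  · calc ‖φ n u - φ n v‖ ≤ ‖φ n u‖ + ‖φ n v‖ := norm_sub_le _ _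
      _ ≤ 2 * C := by linarith [hC n u, hC n v]
      _ = 2 * C / m * m := by field_simp
      _ ≤ 2 * C / m * |u - v| ^ β := by
        gcongr
        exact (Real.self_le_rpow_of_le_one hm0.le (min_le_right _ _) hβ1).trans (by gcongr)
      _ ≤ _ := by gcongr; exact le_max_right _ _

theorem continuous_of_holder_bound (hφb : UniformlyBounded φ)
    (hφ : LocallyUniformlyBiLipschitz φ) (n : ℕ) : Continuous (φ n) := by
  obtain ⟨K, hK, h⟩ := exists_holder_bound hφb hφ
  refine (LipschitzWith.of_dist_le_mul (K := K.toNNReal) fun u v => ?_).continuous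
  rw [dist_eq_norm, Real.dist_eq, Real.coe_toNNReal _ hK.le]
  simpa using h 1 zero_le_one le_rfl n u v

theorem phaseSeries_eq (t : ℕ → ℝ) (x : ℝ) :
    phaseSeries a lam φ t x = ∑' n, a n * φ n (lam n * x) * phase (t n) := by
  rw [phaseSeries]
  refine tsum_congr fun n => ?_
  rw [phase]
  ring

theorem summable_norm_coeff (hφb : UniformlyBounded φ) (ha : Summable fun n => ‖a n‖) (x : ℝ) :
    Summable fun n => ‖a n * φ n (lam n * x)‖ := by
  obtain ⟨C, hC⟩ := hφb
  refine Summable.of_nonneg_of_le (fun _ => norm_nonneg _) (fun n => ?_) (ha.mul_right C)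
  rw [norm_mul]
  gcongr
  exact hC n _

theorem summable_norm_increment (hφb : UniformlyBounded φ) (ha : Summable fun n => ‖a n‖)
    (x y : ℝ) : Summable fun n => ‖a n * (φ n (lam n * x) - φ n (lam n * y))‖ := by
  refine Summable.of_nonneg_of_le (fun _ => norm_nonneg _) (fun n => ?_)
    ((summable_norm_coeff (lam := lam) hφb ha x).add (summable_norm_coeff (lam := lam) hφb ha y))
  rw [mul_sub]
  exact norm_sub_le _ _

theorem phaseSeries_sub {Ω : Type*} (hφb : UniformlyBounded φ) (ha : Summable fun n => ‖a n‖)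
    (θ : ℕ → Ω → ℝ) (ω : Ω) (x y : ℝ) :
    phaseSeries a lam φ (fun n => θ n ω) x - phaseSeries a lam φ (fun n => θ n ω) y =
      steinhausSum (fun n => a n * (φ n (lam n * x) - φ n (lam n * y))) θ ω := by
  rw [phaseSeries_eq, phaseSeries_eq, steinhausSum,
    ← (summable_steinhaus (summable_norm_coeff hφb ha x) _).tsum_sub
      (summable_steinhaus (summable_norm_coeff hφb ha y) _)]
  refine tsum_congr fun n => ?_
  ring

theorem continuous_phaseSeries (hφb : UniformlyBounded φ) (hφ : LocallyUniformlyBiLipschitz φ)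
    (ha : Summable fun n => ‖a n‖) (t : ℕ → ℝ) : Continuous (phaseSeries a lam φ t) := by
  have hcont := continuous_of_holder_bound hφb hφ
  obtain ⟨C, hC⟩ := hφb
  have : phaseSeries a lam φ t = fun x => ∑' n, a n * φ n (lam n * x) * phase (t n) :=
    funext (phaseSeries_eq t)
  rw [this]
  refine continuous_tsum (u := fun n => ‖a n‖ * C) (fun n => ?_) (ha.mul_right C) fun n x => ?_
  · have := hcont n
    fun_prop
  · rw [norm_mul, norm_phase, mul_one, norm_mul]
    gcongr
    exact hC n _

theorem locallyHolder_zero_phaseSeries (hφb : UniformlyBounded φ) (ha : Summable fun n => ‖a n‖)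
    (t : ℕ → ℝ) : LocallyHolder 0 (phaseSeries a lam φ t) := by
  obtain ⟨C, hC⟩ := id hφb
  have hC0 : 0 ≤ C := (norm_nonneg _).trans (hC 0 0)
  have hbd : ∀ x, ‖phaseSeries a lam φ t x‖ ≤ (∑' n, ‖a n‖) * C := by
    intro x
    have h1 := summable_norm_coeff (lam := lam) hφb ha x
    rw [phaseSeries_eq, ← tsum_mul_right]
    refine (norm_tsum_le_tsum_norm (by simpa [norm_phase] using h1)).trans ?_
    refine Summable.tsum_le_tsum (fun n => ?_) (by simpa [norm_phase] using h1) (ha.mul_right C)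
    rw [norm_mul, norm_phase, mul_one, norm_mul]
    gcongr
    exact hC n _
  have hpos : 0 ≤ (∑' n, ‖a n‖) * C := mul_nonneg (tsum_nonneg fun _ => norm_nonneg _) hC0
  refine fun N => ⟨2 * ((∑' n, ‖a n‖) * C), by positivity, fun x _ y _ => ?_⟩
  rw [Real.rpow_zero, mul_one]
  exact (norm_sub_le _ _).trans (by linarith [hbd x, hbd y])

/-- For `γ` slightly above `β` the increment has variance proxy at most `K² |x - y| ^ (2γ) ∑ ‖a n‖ ^
2 * lam n ^ (2γ)`; the gap between `γ` and `β` is what Kolmogorov's criterion spends. -/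
theorem ae_locallyHolder_phaseSeries {Ω : Type*} [MeasurableSpace Ω] {P : Measure Ω}
    [IsProbabilityMeasure P] {θ : ℕ → Ω → ℝ} (hθ : IsIIDUniform P θ)
    (hφb : UniformlyBounded φ) (hφ : LocallyUniformlyBiLipschitz φ)
    (ha : Summable fun n => ‖a n‖) (hlam : ∀ n, 1 ≤ lam n) {q : ℝ} (hq : 1 < q) {β : ℝ}
    (hβ0 : 0 < β) (hβ1 : β < 1) (h : (β : EReal) < lowerRate a lam q) :
    ∀ᵐ ω ∂P, LocallyHolder β (phaseSeries a lam φ fun n => θ n ω) := by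
  obtain ⟨γ, hβγ, hγ1, hγ⟩ : ∃ γ : ℝ, β < γ ∧ γ ≤ 1 ∧ (γ : EReal) < lowerRate a lam q := by
    obtain ⟨γ, h1, h2⟩ := EReal.lt_iff_exists_real_btwn.1 h
    refine ⟨min γ 1, lt_min (by exact_mod_cast h1) hβ1, min_le_right _ _, lt_of_le_of_lt ?_ h2⟩
    exact_mod_cast min_le_left _ _
  have hγ0 : 0 ≤ γ := by linarith
  have hsum := summable_norm_sq_mul_rpow ha hlam hq hγ0 hγ
  obtain ⟨K, hK, hbound⟩ := exists_holder_bound hφb hφ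
  have hterm0 : ∀ n, 0 ≤ ‖a n‖ ^ 2 * lam n ^ (2 * γ) := fun n => by
    have := hlam n
    positivity
  set B := ∑' n, ‖a n‖ ^ 2 * lam n ^ (2 * γ) with hB
  have hB0 : 0 ≤ B := tsum_nonneg hterm0
  set D := K * Real.sqrt (B + 1) with hD
  have hD0 : 0 < D := by positivity
  refine ae_locallyHolder_of_measure_le (β := γ)
    (fun ω => continuous_phaseSeries hφb hφ ha fun n => θ n ω) hβ0 (fun p => ?_) hβγ
  refine ⟨(4 * p.factorial * 8 ^ p * D ^ (2 * p)).toNNReal, fun x y hxy ε hε => ?_⟩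
  have hh : 0 < |x - y| := abs_pos.2 (sub_ne_zero.2 hxy)
  simp only [phaseSeries_sub hφb ha]
  refine (measure_le_norm_steinhausSum_le hθ (summable_norm_increment hφb ha x y)
    (v := D * |x - y| ^ γ) (by positivity) (fun N => ?_) p hε).trans (le_of_eq ?_)
  · calc ∑ n ∈ Finset.range N, ‖a n * (φ n (lam n * x) - φ n (lam n * y))‖ ^ 2
        ≤ ∑ n ∈ Finset.range N, K ^ 2 * (|x - y| ^ γ) ^ 2 * (‖a n‖ ^ 2 * lam n ^ (2 * γ)) := by
          refine Finset.sum_le_sum fun n _ => ?_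
          have hl : 0 ≤ lam n := zero_le_one.trans (hlam n)
          have h1 := hbound γ hγ0 hγ1 n (lam n * x) (lam n * y)
          rw [← mul_sub, abs_mul, abs_of_nonneg hl, Real.mul_rpow hl (abs_nonneg _)] at h1
          rw [norm_mul, mul_pow]
          calc ‖a n‖ ^ 2 * ‖φ n (lam n * x) - φ n (lam n * y)‖ ^ 2
              ≤ ‖a n‖ ^ 2 * (K * (lam n ^ γ * |x - y| ^ γ)) ^ 2 := by gcongr
            _ = _ := by
              rw [mul_comm 2 γ, Real.rpow_mul hl, Real.rpow_two]
              ring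
      _ = K ^ 2 * (|x - y| ^ γ) ^ 2 * ∑ n ∈ Finset.range N, ‖a n‖ ^ 2 * lam n ^ (2 * γ) := by
          rw [Finset.mul_sum]
      _ ≤ K ^ 2 * (|x - y| ^ γ) ^ 2 * (B + 1) := by
          gcongr
          linarith [hsum.sum_le_tsum (Finset.range N) fun n _ => hterm0 n]
      _ = _ := by
          rw [hD, mul_pow, mul_pow, Real.sq_sqrt (by positivity)]
          ring
  · rw [mul_div_assoc, ENNReal.ofReal_mul hD0.le, mul_pow, ← mul_assoc,
      ← ENNReal.ofReal_pow hD0.le, ← ENNReal.ofReal_mul (by positivity), ENNReal.ofReal]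

end Increments

end SteinhausSeriesPaths

/-! ### Decay of the Bessel function. -/

section BesselDecay

/-- The Bessel function `J₀`, as the characteristic function of `cos (2 π θ)`. -/
noncomputable def besselJ (u : ℝ) : ℝ := ∫ t in (0 : ℝ)..1, Real.cos (u * Real.cos (2 * Real.pi * t))

theorem four_mul_le_sin {t : ℝ} (h0 : 0 ≤ t) (h1 : t ≤ 1 / 4) : 4 * t ≤ Real.sin (2 * Real.pi * t) := by
  have h := Real.mul_le_sin (x := 2 * Real.pi * t) (by positivity) (by nlinarith [Real.pi_pos])
  have e : 2 / Real.pi * (2 * Real.pi * t) = 4 * t := by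
    field_simp
    ring
  linarith

theorem four_mul_eps_le_sin {t ε : ℝ} (hε : 0 ≤ ε) (h0 : ε ≤ t) (h1 : t ≤ 1 / 2 - ε) :
    4 * ε ≤ Real.sin (2 * Real.pi * t) := by
  rcases le_total t (1 / 4) with h | h
  · linarith [four_mul_le_sin (hε.trans h0) h]
  · have := four_mul_le_sin (t := 1 / 2 - t) (by linarith) (by linarith)
    rw [show 2 * Real.pi * (1 / 2 - t) = Real.pi - 2 * Real.pi * t by ring, Real.sin_pi_sub] at this
    linarith

theorem continuous_cos_mul_cos (u : ℝ) :
    Continuous fun t : ℝ => Real.cos (u * Real.cos (2 * Real.pi * t)) := by fun_prop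

/-- Away from the stationary points `0` and `1 / 2` of the phase, integrate by parts after dividing
by `sin (2πt)`, which is at least `4 * ε` there. -/
theorem abs_integral_cos_mul_cos_le {u ε : ℝ} (hu : 0 < u) (hε : 0 < ε) (hε1 : ε ≤ 1 / 4) :
    |∫ t in ε..(1 / 2 - ε), Real.cos (u * Real.cos (2 * Real.pi * t))| ≤ 1 / (u * ε ^ 2) := by
  have hle : ε ≤ 1 / 2 - ε := by linarith
  have hsin : ∀ t ∈ Set.uIcc ε (1 / 2 - ε), 4 * ε ≤ Real.sin (2 * Real.pi * t) := by
    intro t ht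
    rw [Set.uIcc_of_le hle] at ht
    exact four_mul_eps_le_sin hε.le ht.1 ht.2
  have hsin0 : ∀ t ∈ Set.uIcc ε (1 / 2 - ε), 0 < Real.sin (2 * Real.pi * t) := fun t ht =>
    lt_of_lt_of_le (by linarith) (hsin t ht)
  have hpi := Real.pi_pos
  let F : ℝ → ℝ := fun t => (Real.sin (2 * Real.pi * t))⁻¹
  let F' : ℝ → ℝ := fun t => -(Real.cos (2 * Real.pi * t) * (2 * Real.pi)) /
    Real.sin (2 * Real.pi * t) ^ 2
  let G : ℝ → ℝ := fun t => -Real.sin (u * Real.cos (2 * Real.pi * t)) / (2 * Real.pi * u)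
  let G' : ℝ → ℝ := fun t => Real.cos (u * Real.cos (2 * Real.pi * t)) *
    Real.sin (2 * Real.pi * t)
  have hlin : ∀ t : ℝ, HasDerivAt (fun t : ℝ => 2 * Real.pi * t) (2 * Real.pi) t := fun t => by
    simpa using (hasDerivAt_id t).const_mul (2 * Real.pi)
  have hF : ∀ t ∈ Set.uIcc ε (1 / 2 - ε), HasDerivAt F (F' t) t := fun t ht =>
    ((Real.hasDerivAt_sin _).comp t (hlin t)).inv (hsin0 t ht).ne'
  have hG : ∀ t ∈ Set.uIcc ε (1 / 2 - ε), HasDerivAt G (G' t) t := by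
    intro t _
    have h1 := ((Real.hasDerivAt_cos _).comp t (hlin t)).const_mul u
    have h2 := (((Real.hasDerivAt_sin _).comp t h1).neg).div_const (2 * Real.pi * u)
    convert! h2 using 1
    simp only [G', Function.comp_apply]
    field_simp
  have hF'c : ContinuousOn F' (Set.uIcc ε (1 / 2 - ε)) := by
    refine ContinuousOn.div (by fun_prop) (by fun_prop) fun t ht => ?_
    exact pow_ne_zero 2 (hsin0 t ht).ne'
  have hparts := intervalIntegral.integral_mul_deriv_eq_deriv_mul hF hG
    hF'c.intervalIntegrable (by apply Continuous.intervalIntegrable; fun_prop)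
  have hcongr : ∫ t in ε..(1 / 2 - ε), Real.cos (u * Real.cos (2 * Real.pi * t)) =
      ∫ t in ε..(1 / 2 - ε), F t * G' t := by
    refine intervalIntegral.integral_congr fun t ht => ?_
    have := (hsin0 t ht).ne'
    simp only [F, G']
    field_simp
  have hFb : ∀ t ∈ Set.uIcc ε (1 / 2 - ε), |F t| ≤ 1 / (4 * ε) := by
    intro t ht
    simp only [F]
    rw [abs_of_pos (inv_pos.2 (hsin0 t ht)), ← one_div]
    exact one_div_le_one_div_of_le (by linarith) (hsin t ht)
  have hGb : ∀ t, |G t| ≤ 1 / (2 * Real.pi * u) := by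
    intro t
    simp only [G]
    rw [abs_div, abs_neg, abs_of_pos (by positivity : 0 < 2 * Real.pi * u)]
    gcongr
    exact Real.abs_sin_le_one _
  have hF'b : ∀ t ∈ Set.uIcc ε (1 / 2 - ε), |F' t| ≤ 2 * Real.pi / (4 * ε) ^ 2 := by
    intro t ht
    have := hsin t ht
    simp only [F']
    rw [abs_div, abs_neg, abs_mul, abs_of_pos (by positivity : 0 < 2 * Real.pi),
      abs_of_pos (pow_pos (hsin0 t ht) 2)]
    exact div_le_div₀ (by positivity)
      (mul_le_of_le_one_left (by positivity) (Real.abs_cos_le_one _)) (by positivity)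
      (pow_le_pow_left₀ (by positivity) this 2)
  have hint : |∫ t in ε..(1 / 2 - ε), F' t * G t| ≤
      2 * Real.pi / (4 * ε) ^ 2 * (1 / (2 * Real.pi * u)) * |1 / 2 - ε - ε| := by
    rw [← Real.norm_eq_abs]
    refine intervalIntegral.norm_integral_le_of_norm_le_const fun t ht => ?_
    rw [Real.norm_eq_abs, abs_mul]
    have := hF'b t (Set.uIoc_subset_uIcc ht)
    have := hGb t
    gcongr
  rw [hcongr, hparts]
  have h1 : |F (1 / 2 - ε) * G (1 / 2 - ε)| ≤ 1 / (4 * ε) * (1 / (2 * Real.pi * u)) := by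
    rw [abs_mul]
    exact mul_le_mul (hFb _ Set.right_mem_uIcc) (hGb _) (abs_nonneg _) (by positivity)
  have h2 : |F ε * G ε| ≤ 1 / (4 * ε) * (1 / (2 * Real.pi * u)) := by
    rw [abs_mul]
    exact mul_le_mul (hFb _ Set.left_mem_uIcc) (hGb _) (abs_nonneg _) (by positivity)
  have h3 : |1 / 2 - ε - ε| ≤ 1 / 2 := by rw [abs_le]; constructor <;> linarith
  have h4 : 2 * Real.pi / (4 * ε) ^ 2 * (1 / (2 * Real.pi * u)) * |1 / 2 - ε - ε| ≤
      1 / (u * ε ^ 2) * (1 / 32) := by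
    calc _ ≤ 2 * Real.pi / (4 * ε) ^ 2 * (1 / (2 * Real.pi * u)) * (1 / 2) := by gcongr
      _ = _ := by field_simp; norm_num
  have h5 : 1 / (4 * ε) * (1 / (2 * Real.pi * u)) ≤ 1 / (u * ε ^ 2) * (1 / 32) := by
    have e : 1 / (4 * ε) * (1 / (2 * Real.pi * u)) =
        1 / (u * ε ^ 2) * (1 / 32) * (4 * ε / Real.pi) := by
      field_simp; norm_num
    rw [e]
    refine mul_le_of_le_one_right (by positivity) ?_
    rw [div_le_one hpi]
    linarith [Real.pi_gt_three]
  have hpos : 0 < 1 / (u * ε ^ 2) := by positivity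
  have h6 := abs_sub (F (1 / 2 - ε) * G (1 / 2 - ε) - F ε * G ε) (∫ t in ε..(1 / 2 - ε), F' t * G t)
  have h7 := abs_sub (F (1 / 2 - ε) * G (1 / 2 - ε)) (F ε * G ε)
  linarith

theorem besselJ_eq_two_mul (u : ℝ) :
    besselJ u = 2 * ∫ t in (0 : ℝ)..(1 / 2), Real.cos (u * Real.cos (2 * Real.pi * t)) := by
  have hi : ∀ a b : ℝ, IntervalIntegrable
      (fun t : ℝ => Real.cos (u * Real.cos (2 * Real.pi * t))) volume a b :=
    fun a b => (continuous_cos_mul_cos u).intervalIntegrable a b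
  have h := intervalIntegral.integral_comp_sub_left
    (fun t : ℝ => Real.cos (u * Real.cos (2 * Real.pi * t))) (a := 0) (b := 1 / 2) 1
  have hs : ∀ t : ℝ, Real.cos (2 * Real.pi * (1 - t)) = Real.cos (2 * Real.pi * t) := by
    intro t
    rw [show 2 * Real.pi * (1 - t) = 2 * Real.pi - 2 * Real.pi * t by ring, Real.cos_two_pi_sub]
  simp only [hs] at h
  norm_num at h
  rw [besselJ, ← intervalIntegral.integral_add_adjacent_intervals (hi 0 (1 / 2)) (hi (1 / 2) 1),
    ← h]
  norm_num
  ring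

theorem abs_besselJ_le {u ε : ℝ} (hu : 0 < u) (hε : 0 < ε) (hε1 : ε ≤ 1 / 4) :
    |besselJ u| ≤ 4 * ε + 2 / (u * ε ^ 2) := by
  have hi : ∀ a b : ℝ, IntervalIntegrable
      (fun t : ℝ => Real.cos (u * Real.cos (2 * Real.pi * t))) volume a b :=
    fun a b => (continuous_cos_mul_cos u).intervalIntegrable a b
  have hsmall : ∀ a b : ℝ, |∫ t in a..b, Real.cos (u * Real.cos (2 * Real.pi * t))| ≤ |b - a| := by
    intro a b
    rw [← Real.norm_eq_abs, ← one_mul |b - a|]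
    exact intervalIntegral.norm_integral_le_of_norm_le_const fun t _ => Real.abs_cos_le_one _
  have h1 := hsmall 0 ε
  have h2 := hsmall (1 / 2 - ε) (1 / 2)
  have h3 := abs_integral_cos_mul_cos_le hu hε hε1
  rw [sub_zero, abs_of_pos hε] at h1
  rw [sub_sub_cancel, abs_of_pos hε] at h2
  rw [besselJ_eq_two_mul, abs_mul, abs_two,
    ← intervalIntegral.integral_add_adjacent_intervals (hi 0 (1 / 2 - ε)) (hi (1 / 2 - ε) (1 / 2)),
    ← intervalIntegral.integral_add_adjacent_intervals (hi 0 ε) (hi ε (1 / 2 - ε))]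
  have h4 := abs_add_three (∫ t in (0 : ℝ)..ε, Real.cos (u * Real.cos (2 * Real.pi * t)))
    (∫ t in ε..(1 / 2 - ε), Real.cos (u * Real.cos (2 * Real.pi * t)))
    (∫ t in (1 / 2 - ε)..(1 / 2), Real.cos (u * Real.cos (2 * Real.pi * t)))
  have e : 2 / (u * ε ^ 2) = 2 * (1 / (u * ε ^ 2)) := by ring
  rw [e]
  linarith

/-- The choice `ε = u ^ (-1/3)` balances the two error terms and gives `|J₀ u| ≤ 6 u ^ (-1/3)`. This
is not the sharp rate `u ^ (-1/2)`, but a high power makes up for it. -/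
theorem abs_besselJ_pow_mul_le {u : ℝ} (hu : 64 ≤ u) : |besselJ u| ^ 12 * u ^ 4 ≤ 6 ^ 12 := by
  have hu0 : 0 < u := by linarith
  set v : ℝ := u ^ (1 / 3 : ℝ) with hv
  have hv3 : v ^ 3 = u := by
    rw [hv, ← Real.rpow_mul_natCast hu0.le]
    norm_num
  have hv0 : 0 < v := by positivity
  have hv4 : 4 ≤ v := by
    by_contra hlt
    have : v ^ 3 < 4 ^ 3 := pow_lt_pow_left₀ (not_le.1 hlt) hv0.le (by norm_num)
    rw [hv3] at this
    linarith
  have h := abs_besselJ_le hu0 (ε := 1 / v) (by positivity) (one_div_le_one_div_of_le (by norm_num) hv4)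
  have h2 : |besselJ u| * v ≤ 6 := by
    rw [← le_div_iff₀ hv0]
    refine h.trans (le_of_eq ?_)
    rw [← hv3]
    field_simp
    norm_num
  calc |besselJ u| ^ 12 * u ^ 4 = (|besselJ u| * v) ^ 12 := by
        rw [← hv3]; ring
    _ ≤ 6 ^ 12 := pow_le_pow_left₀ (by positivity) h2 12

theorem abs_besselJ_le_one (u : ℝ) : |besselJ u| ≤ 1 := by
  rw [besselJ, ← Real.norm_eq_abs]
  refine (intervalIntegral.norm_integral_le_of_norm_le_const
    fun t _ => Real.abs_cos_le_one _).trans ?_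
  norm_num

theorem integral_sub_le_of_le_on {f : ℝ → ℝ} (hf : Continuous f) (h0 : ∀ t, 0 ≤ f t) {a b : ℝ}
    (ha : 0 ≤ a) (hab : a ≤ b) (hb : b ≤ 1) : ∫ t in a..b, f t ≤ ∫ t in (0 : ℝ)..1, f t :=
  intervalIntegral.integral_mono_interval ha hab hb (ae_of_all _ h0) (hf.intervalIntegrable _ _)

theorem exists_abs_besselJ_le (U : ℝ) (hU : 1 ≤ U) :
    ∃ κ : ℝ, 0 < κ ∧ ∀ u, 0 ≤ u → u ≤ U → |besselJ u| ≤ 1 - κ * u ^ 2 := by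
  have hpi := Real.pi_gt_three
  -- On `[a, 1/4]` the argument `u * cos (2πt)` lies in `[0, 1]` for all `u ≤ U`. There `1 - cos` is
  -- quadratically large and `cos` is nonnegative, which bounds `J₀` away from `1` and from `-1`.
  set a : ℝ := 1 / 4 - 1 / (2 * Real.pi * U) with ha
  have hpos : 0 < 1 / (2 * Real.pi * U) := by positivity
  have hsm : 1 / (2 * Real.pi * U) ≤ 1 / 4 := by
    refine one_div_le_one_div_of_le (by norm_num) ?_
    nlinarith
  have ha0 : 0 ≤ a := by linarith
  have ha1 : a < 1 / 4 := by linarith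
  have hcos : ∀ t ∈ Set.Icc a (1 / 4), 0 ≤ Real.cos (2 * Real.pi * t) ∧
      U * Real.cos (2 * Real.pi * t) ≤ 1 := by
    intro t ht
    have hs : Real.cos (2 * Real.pi * t) = Real.sin (2 * Real.pi * (1 / 4 - t)) := by
      rw [← Real.sin_pi_div_two_sub]
      congr 1
      ring
    constructor
    · rw [hs]
      refine Real.sin_nonneg_of_nonneg_of_le_pi ?_ ?_
      · have := ht.2
        exact mul_nonneg (by positivity) (by linarith)
      · nlinarith [ht.1]
    · rw [hs]
      have h1 := Real.sin_le (x := 2 * Real.pi * (1 / 4 - t))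
        (mul_nonneg (by positivity) (by linarith [ht.2]))
      have h2 : 1 / 4 - t ≤ 1 / (2 * Real.pi * U) := by linarith [ht.1]
      calc U * Real.sin (2 * Real.pi * (1 / 4 - t)) ≤ U * (2 * Real.pi * (1 / 4 - t)) := by gcongr
        _ ≤ U * (2 * Real.pi * (1 / (2 * Real.pi * U))) := by gcongr
        _ = 1 := by field_simp
  set κ₁ := ∫ t in a..(1 / 4), (1 / 8) * Real.cos (2 * Real.pi * t) ^ 2 with hκ₁
  have hκ₁pos : 0 < κ₁ := by
    refine intervalIntegral.intervalIntegral_pos_of_pos_on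
      (by apply Continuous.intervalIntegrable; fun_prop) (fun t ht => ?_) ha1
    have : 0 < Real.cos (2 * Real.pi * t) := by
      refine Real.cos_pos_of_mem_Ioo ⟨?_, ?_⟩
      · nlinarith [ht.1]
      · nlinarith [ht.2]
    positivity
  set κ₂ := (1 / 4 - a) / U ^ 2 / 2 with hκ₂
  have hκ₂pos : 0 < κ₂ := by
    have : 0 < 1 / 4 - a := by linarith
    positivity
  refine ⟨min κ₁ κ₂, lt_min hκ₁pos hκ₂pos, fun u hu huU => ?_⟩
  have hint : ∀ f : ℝ → ℝ, Continuous f → ∀ x y : ℝ, IntervalIntegrable f volume x y :=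
    fun f hf x y => hf.intervalIntegrable x y
  have hsub : 1 - besselJ u = ∫ t in (0 : ℝ)..1, (1 - Real.cos (u * Real.cos (2 * Real.pi * t))) := by
    rw [besselJ, intervalIntegral.integral_sub (hint _ continuous_const _ _)
      (hint _ (continuous_cos_mul_cos u) _ _)]
    simp
  have hadd : 1 + besselJ u = ∫ t in (0 : ℝ)..1, (1 + Real.cos (u * Real.cos (2 * Real.pi * t))) := by
    rw [besselJ, intervalIntegral.integral_add (hint _ continuous_const _ _)
      (hint _ (continuous_cos_mul_cos u) _ _)]
    simp
  have hucos : ∀ t ∈ Set.Icc a (1 / 4), 0 ≤ u * Real.cos (2 * Real.pi * t) ∧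
      u * Real.cos (2 * Real.pi * t) ≤ 1 := fun t ht =>
    ⟨mul_nonneg hu (hcos t ht).1,
      (mul_le_mul_of_nonneg_right huU (hcos t ht).1).trans (hcos t ht).2⟩
  have h1 : κ₁ * u ^ 2 ≤ 1 - besselJ u := by
    rw [hsub]
    refine le_trans ?_ (integral_sub_le_of_le_on (by fun_prop)
      (fun t => by linarith [Real.cos_le_one (u * Real.cos (2 * Real.pi * t))]) ha0 ha1.le
      (by norm_num))
    rw [hκ₁, ← intervalIntegral.integral_mul_const]
    refine intervalIntegral.integral_mono_on ha1.le (hint _ (by fun_prop) _ _)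
      (hint _ (by fun_prop) _ _) fun t ht => ?_
    obtain ⟨h0, h1⟩ := hucos t ht
    have h2 := Real.cos_le_one_sub_mul_cos_sq (x := u * Real.cos (2 * Real.pi * t))
      (by rw [abs_of_nonneg h0]; linarith)
    have h3 : 1 / 8 ≤ 2 / Real.pi ^ 2 := by
      rw [div_le_div_iff₀ (by norm_num) (by positivity)]
      nlinarith [Real.pi_le_four]
    have h4 := mul_le_mul_of_nonneg_right h3 (sq_nonneg (u * Real.cos (2 * Real.pi * t)))
    rw [mul_pow] at h2 h4
    linarith
  have h2 : κ₂ * u ^ 2 ≤ 1 + besselJ u := by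
    rw [hadd]
    refine le_trans ?_ (integral_sub_le_of_le_on (by fun_prop)
      (fun t => by linarith [Real.neg_one_le_cos (u * Real.cos (2 * Real.pi * t))]) ha0 ha1.le
      (by norm_num))
    have hconst : ∫ _ in a..(1 / 4), (1 : ℝ) = 1 / 4 - a := by simp
    have h3 : κ₂ * u ^ 2 ≤ 1 / 4 - a := by
      have : u ^ 2 ≤ U ^ 2 := by gcongr
      calc κ₂ * u ^ 2 ≤ κ₂ * U ^ 2 := by gcongr
        _ = (1 / 4 - a) / 2 := by rw [hκ₂]; field_simp
        _ ≤ _ := by linarith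
    refine h3.trans ?_
    rw [← hconst]
    refine intervalIntegral.integral_mono_on ha1.le (hint _ (by fun_prop) _ _)
      (hint _ (by fun_prop) _ _) fun t ht => ?_
    obtain ⟨h0, h1⟩ := hucos t ht
    have : 0 ≤ Real.cos (u * Real.cos (2 * Real.pi * t)) :=
      Real.cos_nonneg_of_neg_pi_div_two_le_of_le (by linarith) (by linarith)
    linarith
  have h3 : min κ₁ κ₂ * u ^ 2 ≤ κ₁ * u ^ 2 := by gcongr; exact min_le_left _ _
  have h4 : min κ₁ κ₂ * u ^ 2 ≤ κ₂ * u ^ 2 := by gcongr; exact min_le_right _ _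
  rw [abs_le]
  constructor <;> linarith

/-- A quadratic gap below `1` on a bounded range and power decay beyond it combine into one
inequality for all `u`. Its form `1 + c u²` is what multiplies well over many coefficients. -/
theorem exists_abs_besselJ_pow_mul_le :
    ∃ c : ℝ, 0 < c ∧ ∀ u, 0 ≤ u → |besselJ u| ^ 12 * (1 + c * u ^ 2) ≤ 1 := by
  obtain ⟨κ, hκ, h⟩ := exists_abs_besselJ_le (2 * 6 ^ 12) (by norm_num)
  refine ⟨min 1 (12 * κ), by positivity, fun u hu => ?_⟩
  rcases le_total u (2 * 6 ^ 12) with hle | hge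
  · have h1 : |besselJ u| ≤ Real.exp (-(κ * u ^ 2)) := by
      refine (h u hu hle).trans ?_
      have := Real.add_one_le_exp (-(κ * u ^ 2))
      linarith
    have h2 : 1 + min 1 (12 * κ) * u ^ 2 ≤ Real.exp (12 * κ * u ^ 2) := by
      have := Real.add_one_le_exp (12 * κ * u ^ 2)
      have h3 : min 1 (12 * κ) * u ^ 2 ≤ 12 * κ * u ^ 2 := by gcongr; exact min_le_right _ _
      linarith
    calc |besselJ u| ^ 12 * (1 + min 1 (12 * κ) * u ^ 2)
        ≤ Real.exp (-(κ * u ^ 2)) ^ 12 * Real.exp (12 * κ * u ^ 2) := by gcongr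
      _ = 1 := by
        rw [← Real.exp_nat_mul, ← Real.exp_add, Real.exp_eq_one_iff]
        push_cast
        ring
  · have hu64 : 64 ≤ u := le_trans (by norm_num) hge
    have h1 := abs_besselJ_pow_mul_le hu64
    have hu0 : 0 < u := by linarith
    have h2 : 1 + min 1 (12 * κ) * u ^ 2 ≤ 2 * u ^ 2 := by
      have : min 1 (12 * κ) * u ^ 2 ≤ 1 * u ^ 2 := by gcongr; exact min_le_left _ _
      nlinarith
    have h3 : |besselJ u| ^ 12 * (2 * u ^ 2) * u ^ 2 ≤ 1 * u ^ 2 := by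
      nlinarith
    exact (mul_le_mul_of_nonneg_left h2 (by positivity)).trans
      (le_of_mul_le_mul_right h3 (by positivity))

end BesselDecay

/-! ### Characteristic functions and Gaussian averages of Steinhaus sums. -/

section GaussianAverages

theorem phase_re (t : ℝ) : (phase t).re = Real.cos (2 * Real.pi * t) := by
  rw [phase, show 2 * (Real.pi : ℂ) * Complex.I * t = ((2 * Real.pi * t : ℝ) : ℂ) * Complex.I by
    push_cast; ring, Complex.exp_ofReal_mul_I_re]

theorem exists_eq_norm_mul_phase (w : ℂ) : ∃ α : ℝ, ∀ t, w * phase t = ‖w‖ * phase (t + α) := by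
  refine ⟨w.arg / (2 * Real.pi), fun t => ?_⟩
  conv_lhs => rw [← Complex.norm_mul_exp_arg_mul_I w]
  rw [phase, phase, mul_assoc, ← Complex.exp_add]
  congr 2
  have : (Real.pi : ℂ) ≠ 0 := by exact_mod_cast Real.pi_ne_zero
  push_cast
  field_simp
  ring

theorem integral_exp_mul_cos (u : ℝ) :
    ∫ t in (0 : ℝ)..1, Complex.exp (((u * Real.cos (2 * Real.pi * t) : ℝ) : ℂ) * Complex.I) =
      besselJ u := by
  have hi : ∀ f : ℝ → ℂ, Continuous f → IntervalIntegrable f volume 0 1 :=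
    fun f hf => hf.intervalIntegrable 0 1
  -- Shifting `t` by half a period changes the sign of the integrand.
  have hodd : ∫ t in (0 : ℝ)..1, Real.sin (u * Real.cos (2 * Real.pi * t)) = 0 := by
    have hper : Function.Periodic (fun t : ℝ => Real.sin (u * Real.cos (2 * Real.pi * t))) 1 := by
      intro t
      simp only [mul_add, mul_one, Real.cos_add_two_pi]
    have h1 := hper.intervalIntegral_add_eq (1 / 2) 0
    have h2 := intervalIntegral.integral_comp_add_right
      (fun t : ℝ => Real.sin (u * Real.cos (2 * Real.pi * t))) (a := 0) (b := 1) (1 / 2)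
    have h3 : ∀ t : ℝ, Real.sin (u * Real.cos (2 * Real.pi * (t + 1 / 2))) =
        -Real.sin (u * Real.cos (2 * Real.pi * t)) := by
      intro t
      rw [show 2 * Real.pi * (t + 1 / 2) = 2 * Real.pi * t + Real.pi by ring, Real.cos_add_pi,
        mul_neg, Real.sin_neg]
    simp only [h3, intervalIntegral.integral_neg] at h2
    rw [zero_add, add_comm 1 (1 / 2 : ℝ), h1, zero_add] at h2
    linarith
  have hsplit : ∀ t : ℝ,
      Complex.exp (((u * Real.cos (2 * Real.pi * t) : ℝ) : ℂ) * Complex.I) =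
      ((Real.cos (u * Real.cos (2 * Real.pi * t)) : ℝ) : ℂ) +
        ((Real.sin (u * Real.cos (2 * Real.pi * t)) : ℝ) : ℂ) * Complex.I := by
    intro t
    rw [Complex.exp_mul_I, Complex.ofReal_cos, Complex.ofReal_sin]
  simp only [hsplit]
  rw [intervalIntegral.integral_add (hi _ (by fun_prop)) (hi _ (by fun_prop)),
    intervalIntegral.integral_mul_const, intervalIntegral.integral_ofReal,
    intervalIntegral.integral_ofReal, hodd, besselJ]
  simp

theorem integral_exp_re_mul_phase (w : ℂ) :
    ∫ t in Set.Icc (0 : ℝ) 1, Complex.exp (((w * phase t).re : ℂ) * Complex.I) = besselJ ‖w‖ := by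
  obtain ⟨α, hα⟩ := exists_eq_norm_mul_phase w
  have h : ∀ t, (w * phase t).re = ‖w‖ * Real.cos (2 * Real.pi * (t + α)) := by
    intro t
    rw [hα, Complex.re_ofReal_mul, phase_re]
  have hper : Function.Periodic (fun t : ℝ => Complex.exp
      (((‖w‖ * Real.cos (2 * Real.pi * t) : ℝ) : ℂ) * Complex.I)) 1 := by
    intro t
    simp only [mul_add, mul_one, Real.cos_add_two_pi]
  rw [integral_Icc_eq_integral_Ioc, ← intervalIntegral.integral_of_le zero_le_one,
    ← integral_exp_mul_cos]
  simp only [h]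
  rw [intervalIntegral.integral_comp_add_right (fun t : ℝ => Complex.exp
      (((‖w‖ * Real.cos (2 * Real.pi * t) : ℝ) : ℂ) * Complex.I)), zero_add, add_comm 1 α]
  have := hper.intervalIntegral_add_eq α 0
  rwa [zero_add] at this

variable {Ω : Type*} [MeasurableSpace Ω] {P : Measure Ω}

theorem charFun_map_mul_phase {θ : Ω → ℝ} (hθ : Measurable θ)
    (hlaw : P.map θ = (volume : Measure ℝ).restrict (Set.Icc 0 1)) (c ξ : ℂ) :
    charFun (P.map fun ω => c * phase (θ ω)) ξ = besselJ (‖c‖ * ‖ξ‖) := by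
  have hc : Measurable fun t => c * phase t := continuous_phase.measurable.const_mul c
  have hmap : (P.map fun ω => c * phase (θ ω)) =
      ((volume : Measure ℝ).restrict (Set.Icc 0 1)).map fun t => c * phase t := by
    rw [← hlaw, Measure.map_map hc hθ]
    rfl
  rw [hmap, charFun_apply, integral_map hc.aemeasurable (by fun_prop)]
  have h1 : ∀ t, ⟪c * phase t, ξ⟫_ℝ = (starRingEnd ℂ ξ * c * phase t).re := by
    intro t
    rw [Complex.inner, ← Complex.conj_re]
    congr 1
    simp
    ring
  simp only [h1]
  rw [integral_exp_re_mul_phase, norm_mul, RCLike.norm_conj, mul_comm]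

theorem charFun_map_sum_steinhaus [IsProbabilityMeasure P] {θ : ℕ → Ω → ℝ}
    (hθ : IsIIDUniform P θ) (c : ℕ → ℂ) (s : Finset ℕ) (ξ : ℂ) :
    charFun (P.map fun ω => ∑ n ∈ s, c n * phase (θ n ω)) ξ =
      ∏ n ∈ s, (besselJ (‖c n‖ * ‖ξ‖) : ℂ) := by
  obtain ⟨hm, hind, hlaw⟩ := hθ
  have hmeas : ∀ n, Measurable fun t => c n * phase t :=
    fun n => continuous_phase.measurable.const_mul (c n)
  have h := iIndepFun.charFun_map_fun_finsetSum_eq_prod (P := P) (s := s)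
    (X := fun n ω => c n * phase (θ n ω)) (fun n _ => ((hmeas n).comp (hm n)).aemeasurable)
    ((hind.comp (fun n t => c n * phase t) hmeas).restrict _)
  rw [h, Finset.prod_apply]
  exact Finset.prod_congr rfl fun n _ => charFun_map_mul_phase (hm n) (hlaw n) (c n) ξ

theorem one_add_sum_le_prod {ι : Type*} (s : Finset ι) {f : ι → ℝ} (hf : ∀ i, 0 ≤ f i) :
    1 + ∑ i ∈ s, f i ≤ ∏ i ∈ s, (1 + f i) := by
  classical
  induction s using Finset.induction_on with
  | empty => simp
  | insert a s ha ih =>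
    rw [Finset.sum_insert ha, Finset.prod_insert ha]
    have h1 := Finset.sum_nonneg fun i (_ : i ∈ s) => hf i
    nlinarith [hf a]

/-- Decay of the characteristic function of a Steinhaus sum with many independent large parts. -/
theorem exists_prod_abs_besselJ_le :
    ∃ b : ℝ, 0 < b ∧ ∀ (c : ℕ → ℂ) (F : Fin 24 → Finset ℕ) (s : Finset ℕ) (R ρ : ℝ),
      Pairwise (Function.onFun Disjoint F) → (∀ i, F i ⊆ s) → 0 ≤ ρ →
      (∀ i, R ^ 2 ≤ ∑ n ∈ F i, ‖c n‖ ^ 2) →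
      ∏ n ∈ s, |besselJ (‖c n‖ * ρ)| ≤ ((1 + b * R ^ 2 * ρ ^ 2) ^ 2)⁻¹ := by
  obtain ⟨b, hb, hJ⟩ := exists_abs_besselJ_pow_mul_le
  refine ⟨b, hb, fun c F s R ρ hF hFs hρ hR => ?_⟩
  classical
  set x : ℕ → ℝ := fun n => |besselJ (‖c n‖ * ρ)| ^ 12 with hx
  have hx0 : ∀ n, 0 ≤ x n := fun n => by positivity
  have hx1 : ∀ n, x n ≤ 1 := fun n => pow_le_one₀ (abs_nonneg _) (abs_besselJ_le_one _)
  have hone : 0 < 1 + b * R ^ 2 * ρ ^ 2 := by positivity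
  have hblock : ∀ i, ∏ n ∈ F i, x n ≤ (1 + b * R ^ 2 * ρ ^ 2)⁻¹ := by
    intro i
    have h1 : 1 + b * R ^ 2 * ρ ^ 2 ≤ ∏ n ∈ F i, (1 + b * (‖c n‖ * ρ) ^ 2) := by
      refine le_trans ?_ (one_add_sum_le_prod _ fun n => by positivity)
      simp only [mul_pow, ← Finset.sum_mul, ← Finset.mul_sum]
      have := hR i
      rw [← mul_assoc]
      gcongr
    have h2 : (∏ n ∈ F i, x n) * ∏ n ∈ F i, (1 + b * (‖c n‖ * ρ) ^ 2) ≤ 1 := by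
      rw [← Finset.prod_mul_distrib]
      exact Finset.prod_le_one (fun n _ => by positivity) fun n _ => hJ _ (by positivity)
    rw [← one_div, le_div_iff₀ hone]
    exact (mul_le_mul_of_nonneg_left h1 (Finset.prod_nonneg fun n _ => hx0 n)).trans h2
  have hunion : ∏ n ∈ s, x n ≤ ∏ n ∈ Finset.univ.biUnion F, x n := by
    rw [← Finset.prod_sdiff (Finset.biUnion_subset.2 fun i _ => hFs i)]
    exact mul_le_of_le_one_left (Finset.prod_nonneg fun n _ => hx0 n)
      (Finset.prod_le_one (fun n _ => hx0 n) fun n _ => hx1 n)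
  rw [Finset.prod_biUnion fun i _ j _ hij => hF hij] at hunion
  -- Each of the 24 blocks yields one factor for the twelfth powers; the twelfth root leaves
  -- exponent `2`, enough for integrability in the plane.
  have h3 : ∏ n ∈ s, x n ≤ ((1 + b * R ^ 2 * ρ ^ 2)⁻¹) ^ 24 := by
    refine hunion.trans ((Finset.prod_le_prod (fun i _ => Finset.prod_nonneg fun n _ => hx0 n)
      fun i _ => hblock i).trans (le_of_eq ?_))
    simp
  have h4 : (∏ n ∈ s, |besselJ (‖c n‖ * ρ)|) ^ 12 ≤ (((1 + b * R ^ 2 * ρ ^ 2) ^ 2)⁻¹) ^ 12 := by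
    rw [← Finset.prod_pow]
    refine h3.trans (le_of_eq ?_)
    rw [← inv_pow, ← pow_mul]
  exact le_of_pow_le_pow_left₀ (by norm_num) (by positivity) h4

theorem integral_inv_one_add_mul_sq {b : ℝ} (hb : 0 < b) :
    ∫ x : ℝ, (1 + b * x ^ 2)⁻¹ = Real.pi / Real.sqrt b := by
  have h := Measure.integral_comp_mul_left (fun x : ℝ => (1 + x ^ 2)⁻¹) (Real.sqrt b)
  simp only [mul_pow, Real.sq_sqrt hb.le, integral_univ_inv_one_add_sq, smul_eq_mul] at h
  rw [h, abs_of_pos (by positivity)]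
  ring

theorem integrable_inv_one_add_mul_sq {b : ℝ} (hb : 0 < b) :
    Integrable fun x : ℝ => (1 + b * x ^ 2)⁻¹ := by
  have h := integrable_inv_one_add_sq.comp_mul_left' (R := Real.sqrt b) (by positivity)
  simpa only [mul_pow, Real.sq_sqrt hb.le] using h

theorem integral_gaussianReal_inv_one_add_mul_sq_le {b : ℝ} (hb : 0 < b) {v : ℝ≥0} (hv : v ≠ 0) :
    ∫ x, (1 + b * x ^ 2)⁻¹ ∂(gaussianReal 0 v) ≤
      (Real.sqrt (2 * Real.pi * v))⁻¹ * (Real.pi / Real.sqrt b) := by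
  rw [integral_gaussianReal_eq_integral_smul hv, ← integral_inv_one_add_mul_sq hb,
    ← integral_const_mul]
  have hle : ∀ x, gaussianPDFReal 0 v x ≤ (Real.sqrt (2 * Real.pi * v))⁻¹ := by
    intro x
    rw [gaussianPDFReal_def]
    refine mul_le_of_le_one_right (by positivity) (Real.exp_le_one_iff.2 ?_)
    rw [neg_div]
    exact neg_nonpos.2 (by positivity)
  refine integral_mono_of_nonneg (ae_of_all _ fun x => ?_)
    ((integrable_inv_one_add_mul_sq hb).const_mul _) (ae_of_all _ fun x => ?_)
  · exact mul_nonneg (gaussianPDFReal_nonneg 0 v x) (by positivity)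
  · exact mul_le_mul_of_nonneg_right (hle x) (by positivity)

/-- The Gaussian function as a Gaussian average of characters. -/
theorem integral_exp_gaussianReal_prod (v : ℝ≥0) (z : ℂ) :
    ∫ g : ℝ × ℝ, Complex.exp ((⟪z, (g.1 : ℂ) + g.2 * Complex.I⟫_ℝ : ℂ) * Complex.I)
      ∂((gaussianReal 0 v).prod (gaussianReal 0 v)) =
      ((Real.exp (-(v * ‖z‖ ^ 2 / 2)) : ℝ) : ℂ) := by
  have h1 : ∀ g : ℝ × ℝ, Complex.exp ((⟪z, (g.1 : ℂ) + g.2 * Complex.I⟫_ℝ : ℂ) * Complex.I) =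
      Complex.exp (z.re * g.1 * Complex.I) * Complex.exp (z.im * g.2 * Complex.I) := by
    intro g
    have : ⟪z, (g.1 : ℂ) + g.2 * Complex.I⟫_ℝ = z.re * g.1 + z.im * g.2 := by
      rw [Complex.inner]
      simp
      ring
    rw [this, ← Complex.exp_add]
    congr 1
    push_cast
    ring
  simp only [h1]
  rw [integral_prod_mul (fun x : ℝ => Complex.exp (z.re * x * Complex.I))
    (fun x : ℝ => Complex.exp (z.im * x * Complex.I)), ← charFun_apply_real, ← charFun_apply_real,
    charFun_gaussianReal, charFun_gaussianReal, ← Complex.exp_add, Complex.ofReal_exp,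
    Complex.sq_norm, Complex.normSq_apply]
  congr 1
  push_cast
  ring

/-- Writing the Gaussian as an average of characters turns the expectation into the mean of the
characteristic function at a Gaussian point of variance `v`. Since `(1 + s + t)² ≥ (1 + s)(1 + t)`
for `s, t ≥ 0`, its bound splits over the coordinates. The Gaussian density is at most `(2πv) ^
(-1/2)`, so each coordinate contributes `O(1 / (√v R))`. -/
theorem exists_integral_exp_neg_norm_sum_le :
    ∃ C : ℝ, 0 < C ∧ ∀ {Ω : Type*} [MeasurableSpace Ω] (P : Measure Ω) [IsProbabilityMeasure P]
      (θ : ℕ → Ω → ℝ) (_ : IsIIDUniform P θ) (c : ℕ → ℂ) (F : Fin 24 → Finset ℕ) (s : Finset ℕ)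
      (R : ℝ), Pairwise (Function.onFun Disjoint F) → (∀ i, F i ⊆ s) → 0 < R →
      (∀ i, R ^ 2 ≤ ∑ n ∈ F i, ‖c n‖ ^ 2) → ∀ v : ℝ≥0, v ≠ 0 →
      ∫ ω, Real.exp (-(v * ‖∑ n ∈ s, c n * phase (θ n ω)‖ ^ 2 / 2)) ∂P ≤ C / (v * R ^ 2) := by
  obtain ⟨b, hb, hprod⟩ := exists_prod_abs_besselJ_le
  refine ⟨Real.pi / (2 * b), by positivity, ?_⟩
  intro Ω _ P _ θ hθ c F s R hF hFs hR hFR v hv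
  set Z : Ω → ℂ := fun ω => ∑ n ∈ s, c n * phase (θ n ω) with hZ
  have hZm : Measurable Z := Finset.measurable_sum _ fun n _ =>
    (continuous_phase.measurable.comp (hθ.1 n)).const_mul (c n)
  set γ := (gaussianReal 0 v).prod (gaussianReal 0 v) with hγ
  let κ : Ω → ℝ × ℝ → ℂ := fun ω g =>
    Complex.exp ((⟪Z ω, (g.1 : ℂ) + g.2 * Complex.I⟫_ℝ : ℂ) * Complex.I)
  have hκm : Measurable (Function.uncurry κ) := by
    refine Complex.measurable_exp.comp (Measurable.mul_const ?_ _)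
    refine Complex.measurable_ofReal.comp ?_
    refine Measurable.inner (hZm.comp measurable_fst) ?_
    fun_prop
  have hκn : ∀ ω g, ‖κ ω g‖ = 1 := fun ω g => Complex.norm_exp_ofReal_mul_I _
  have hκi : Integrable (Function.uncurry κ) (P.prod γ) :=
    Integrable.of_bound hκm.aestronglyMeasurable (C := 1) (ae_of_all _ fun p => (hκn p.1 p.2).le)
  have hswap : ((∫ ω, Real.exp (-(v * ‖Z ω‖ ^ 2 / 2)) ∂P : ℝ) : ℂ) =
      ∫ g, charFun (P.map Z) ((g.1 : ℂ) + g.2 * Complex.I) ∂γ := by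
    rw [← integral_complex_ofReal]
    simp only [← integral_exp_gaussianReal_prod]
    rw [integral_integral_swap hκi]
    refine integral_congr_ae (ae_of_all _ fun g => ?_)
    simp only [charFun_apply]
    rw [integral_map hZm.aemeasurable (by fun_prop)]
  have hbR : 0 < b * R ^ 2 := by positivity
  have hbound : ∀ g : ℝ × ℝ, ‖charFun (P.map Z) ((g.1 : ℂ) + g.2 * Complex.I)‖ ≤
      (1 + b * R ^ 2 * g.1 ^ 2)⁻¹ * (1 + b * R ^ 2 * g.2 ^ 2)⁻¹ := by
    intro g
    rw [hZ, charFun_map_sum_steinhaus hθ, norm_prod]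
    simp only [Complex.norm_real, Real.norm_eq_abs]
    refine (hprod c F s R _ hF hFs (norm_nonneg _) hFR).trans ?_
    rw [← mul_inv]
    refine inv_anti₀ (by positivity) ?_
    have : ‖(g.1 : ℂ) + g.2 * Complex.I‖ ^ 2 = g.1 ^ 2 + g.2 ^ 2 := by
      rw [Complex.sq_norm, Complex.normSq_add_mul_I]
    rw [this]
    have h1 : 0 ≤ b * R ^ 2 * g.1 ^ 2 := by positivity
    have h2 : 0 ≤ b * R ^ 2 * g.2 ^ 2 := by positivity
    nlinarith
  have hint : Integrable (fun x : ℝ => (1 + b * R ^ 2 * x ^ 2)⁻¹) (gaussianReal 0 v) := by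
    refine Integrable.of_bound (C := 1) (by fun_prop) (ae_of_all _ fun x => ?_)
    rw [Real.norm_of_nonneg (by positivity)]
    exact inv_le_one_of_one_le₀ (by nlinarith [sq_nonneg x, hbR.le, mul_nonneg hbR.le (sq_nonneg x)])
  have hnonneg : 0 ≤ ∫ ω, Real.exp (-(v * ‖Z ω‖ ^ 2 / 2)) ∂P :=
    integral_nonneg fun ω => (Real.exp_pos _).le
  have hone := integral_gaussianReal_inv_one_add_mul_sq_le hbR hv
  calc ∫ ω, Real.exp (-(v * ‖Z ω‖ ^ 2 / 2)) ∂P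
      = ‖((∫ ω, Real.exp (-(v * ‖Z ω‖ ^ 2 / 2)) ∂P : ℝ) : ℂ)‖ := by
        rw [Complex.norm_real, Real.norm_of_nonneg hnonneg]
    _ ≤ ∫ g : ℝ × ℝ, (1 + b * R ^ 2 * g.1 ^ 2)⁻¹ * (1 + b * R ^ 2 * g.2 ^ 2)⁻¹ ∂γ := by
        rw [hswap]
        exact norm_integral_le_of_norm_le (hint.mul_prod hint) (ae_of_all _ hbound)
    _ = (∫ x, (1 + b * R ^ 2 * x ^ 2)⁻¹ ∂(gaussianReal 0 v)) *
          ∫ x, (1 + b * R ^ 2 * x ^ 2)⁻¹ ∂(gaussianReal 0 v) :=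
        integral_prod_mul (fun x : ℝ => (1 + b * R ^ 2 * x ^ 2)⁻¹)
          (fun x : ℝ => (1 + b * R ^ 2 * x ^ 2)⁻¹)
    _ ≤ ((Real.sqrt (2 * Real.pi * v))⁻¹ * (Real.pi / Real.sqrt (b * R ^ 2))) *
          ((Real.sqrt (2 * Real.pi * v))⁻¹ * (Real.pi / Real.sqrt (b * R ^ 2))) := by
        have : 0 ≤ ∫ x, (1 + b * R ^ 2 * x ^ 2)⁻¹ ∂(gaussianReal 0 v) :=
          integral_nonneg fun x => by positivity
        gcongr
    _ = Real.pi ^ 2 / (Real.sqrt (2 * Real.pi * v) ^ 2 * Real.sqrt (b * R ^ 2) ^ 2) := by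
        field_simp
    _ = Real.pi / (2 * b) / (v * R ^ 2) := by
        have hv0 : (0 : ℝ) < v := lt_of_le_of_ne v.coe_nonneg (by exact_mod_cast hv.symm)
        rw [Real.sq_sqrt (by positivity), Real.sq_sqrt hbR.le]
        have := Real.pi_pos
        field_simp

end GaussianAverages

/-! ### Small ball estimates. -/

section SmallBall

/-- Small ball estimate for Steinhaus sums. -/
theorem exists_measure_norm_steinhausSum_le :
    ∃ C : ℝ, 0 < C ∧ ∀ {Ω : Type*} [MeasurableSpace Ω] (P : Measure Ω) [IsProbabilityMeasure P]
      (θ : ℕ → Ω → ℝ) (_ : IsIIDUniform P θ) (c : ℕ → ℂ) (_ : Summable fun n => ‖c n‖)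
      (F : Fin 24 → Finset ℕ) (R : ℝ), Pairwise (Function.onFun Disjoint F) → 0 < R →
      (∀ i, R ^ 2 ≤ ∑ n ∈ F i, ‖c n‖ ^ 2) → ∀ r : ℝ, 0 < r →
      P {ω | ‖steinhausSum c θ ω‖ ≤ r} ≤ ENNReal.ofReal (C * (r / R) ^ 2) := by
  obtain ⟨C, hC, h⟩ := exists_integral_exp_neg_norm_sum_le
  refine ⟨C * Real.exp (1 / 2), by positivity, ?_⟩
  intro Ω _ P _ θ hθ c hc F R hF hR hFR r hr
  -- With this variance the Gaussian weight is at least `exp (-1/2)` on the ball of radius `r`, and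
  -- Markov's inequality applies.
  set v : ℝ≥0 := ((r ^ 2)⁻¹).toNNReal with hv
  have hvr : (v : ℝ) = (r ^ 2)⁻¹ := Real.coe_toNNReal _ (by positivity)
  have hv0 : v ≠ 0 := by
    intro h0
    rw [h0] at hvr
    have : (0 : ℝ) < (r ^ 2)⁻¹ := by positivity
    rw [← hvr] at this
    simp at this
  have hZm := measurable_steinhausSum hc hθ.1
  have hle1 : ∀ z : ℂ, ‖Real.exp (-(v * ‖z‖ ^ 2 / 2))‖ ≤ 1 := by
    intro z
    rw [Real.norm_of_nonneg (Real.exp_pos _).le, Real.exp_le_one_iff]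
    exact neg_nonpos.2 (by positivity)
  have hlim : Tendsto (fun N => ∫ ω, Real.exp (-(v * ‖∑ n ∈ Finset.range N,
      c n * phase (θ n ω)‖ ^ 2 / 2)) ∂P) atTop
      (𝓝 (∫ ω, Real.exp (-(v * ‖steinhausSum c θ ω‖ ^ 2 / 2)) ∂P)) := by
    refine tendsto_integral_of_dominated_convergence (fun _ => 1) (fun N => ?_)
      (integrable_const _) (fun N => ae_of_all _ fun ω => hle1 _) (ae_of_all _ fun ω => ?_)
    · have hm : Measurable fun ω => ∑ n ∈ Finset.range N, c n * phase (θ n ω) :=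
        Finset.measurable_sum _ fun n _ =>
          (continuous_phase.measurable.comp (hθ.1 n)).const_mul (c n)
      exact Measurable.aestronglyMeasurable (by fun_prop)
    · have hcont : Continuous fun z : ℂ => Real.exp (-(v * ‖z‖ ^ 2 / 2)) := by fun_prop
      exact (hcont.tendsto _).comp (tendsto_sum_steinhaus hc θ ω)
  obtain ⟨N₀, hN₀⟩ := (Finset.univ.biUnion F).exists_nat_subset_range
  have hbound : ∫ ω, Real.exp (-(v * ‖steinhausSum c θ ω‖ ^ 2 / 2)) ∂P ≤ C / (v * R ^ 2) := by
    refine le_of_tendsto hlim (eventually_atTop.2 ⟨N₀, fun N hN => ?_⟩)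
    refine h P θ hθ c F (Finset.range N) R hF (fun i => ?_) hR hFR v hv0
    exact (Finset.subset_biUnion_of_mem F (Finset.mem_univ i)).trans
      (hN₀.trans (Finset.range_mono hN))
  have hmarkov := mul_meas_ge_le_integral_of_nonneg (μ := P)
    (f := fun ω => Real.exp (-(v * ‖steinhausSum c θ ω‖ ^ 2 / 2)))
    (ae_of_all _ fun ω => (Real.exp_pos _).le)
    (Integrable.of_bound (C := 1) (Measurable.aestronglyMeasurable (by fun_prop))
      (ae_of_all _ fun ω => hle1 _)) (Real.exp (-(1 / 2)))
  have hsub : {ω | ‖steinhausSum c θ ω‖ ≤ r} ⊆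
      {ω | Real.exp (-(1 / 2)) ≤ Real.exp (-(v * ‖steinhausSum c θ ω‖ ^ 2 / 2))} := by
    intro ω hω
    have h1 : ‖steinhausSum c θ ω‖ ≤ r := hω
    simp only [Set.mem_ofPred_eq, Real.exp_le_exp, neg_le_neg_iff, hvr]
    have : (r ^ 2)⁻¹ * ‖steinhausSum c θ ω‖ ^ 2 ≤ (r ^ 2)⁻¹ * r ^ 2 := by gcongr
    rw [inv_mul_cancel₀ (by positivity)] at this
    linarith
  rw [← ENNReal.ofReal_toReal (measure_ne_top P _)]
  refine ENNReal.ofReal_le_ofReal ((measureReal_mono hsub).trans ?_)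
  have h2 := hmarkov.trans hbound
  rw [← le_div_iff₀' (Real.exp_pos _)] at h2
  refine h2.trans (le_of_eq ?_)
  rw [Real.exp_neg, hvr]
  field_simp

theorem exists_finset_half_le_sum {ι : Type*} {f : ι → ℝ} (hf : Summable f)
    (h : 0 < ∑' i, f i) : ∃ s : Finset ι, (∑' i, f i) / 2 ≤ ∑ i ∈ s, f i :=
  ((hf.hasSum.eventually (eventually_ge_nhds (half_lt_self h)))).exists

/-- Small ball estimate for the increments of the random series. -/
theorem exists_measure_norm_increment_le {a : ℕ → ℂ} {lam : ℕ → ℝ} {φ : ℕ → ℝ → ℂ} {q τ : ℝ}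
    {Ω : Type*} [MeasurableSpace Ω] {P : Measure Ω}
    [IsProbabilityMeasure P] {θ : ℕ → Ω → ℝ} (hθ : IsIIDUniform P θ)
    (hφb : UniformlyBounded φ) (hφ : LocallyUniformlyBiLipschitz φ)
    (ha : Summable fun n => ‖a n‖) (hq : 1 < q) (hτ0 : 0 ≤ τ) (hτ : upperRate a lam q < τ) :
    ∃ C h₀ : ℝ, 0 < C ∧ 0 < h₀ ∧ ∀ x y : ℝ, x ≠ y → |x - y| ≤ h₀ → ∀ r : ℝ, 0 < r →
      P {ω | ‖phaseSeries a lam φ (fun n => θ n ω) x - phaseSeries a lam φ (fun n => θ n ω) y‖ ≤ r}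
        ≤ ENNReal.ofReal (C * (r / |x - y| ^ τ) ^ 2) := by
  obtain ⟨C, hC, hball⟩ := exists_measure_norm_steinhausSum_le
  obtain ⟨L, δ, hL, hδ, hφL⟩ := id hφ
  obtain ⟨k₀, hk₀⟩ := eventually_atTop.1 (eventually_le_blockNorm hq hτ)
  have hq0 : 0 < q := by linarith
  have hL0 : 0 < L := by linarith
  set D := δ / (L * q ^ 25) with hD
  have hD0 : 0 < D := by positivity
  refine ⟨C * (2 * δ ^ τ / D) ^ 2, δ / q ^ (k₀ + 25), by positivity, by positivity, ?_⟩
  intro x y hxy hle r hr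
  have hh : 0 < |x - y| := abs_pos.2 (sub_ne_zero.2 hxy)
  set h := |x - y| with hhdef
  have hratio : q ^ (k₀ + 25) ≤ δ / h := by
    rw [le_div_iff₀ hh]
    rwa [le_div_iff₀ (by positivity), mul_comm] at hle
  -- In the 24 blocks `m - 1 - i` one has `δ / q ^ 25 ≤ lam n * h ≤ δ`, so the lower Lipschitz bound
  -- applies and keeps a fixed fraction `D` of `‖a n‖`. The bound on `h` keeps all these block
  -- indices above `k₀`.
  obtain ⟨m, hm1, hm2⟩ := exists_nat_pow_near ((one_le_pow₀ hq.le).trans hratio) hq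
  have hmk : k₀ + 25 ≤ m := by
    have := (pow_lt_pow_iff_right₀ hq).1 (hratio.trans_lt hm2)
    omega
  simp only [phaseSeries_sub hφb ha]
  set c : ℕ → ℂ := fun n => a n * (φ n (lam n * x) - φ n (lam n * y)) with hc
  let B : ℕ → Set ℕ := fun k => {n | q ^ k ≤ lam n ∧ lam n < q ^ (k + 1)}
  have hcn : ∀ i < 24, ∀ n ∈ B (m - 1 - i), D * ‖a n‖ ≤ ‖c n‖ := by
    intro i hi n hn
    have hl0 : 0 < lam n := lt_of_lt_of_le (by positivity) hn.1
    have hlow : q ^ (m - 24) ≤ lam n := (pow_le_pow_right₀ hq.le (by omega)).trans hn.1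
    have hup : lam n ≤ q ^ m := hn.2.le.trans (pow_le_pow_right₀ hq.le (by omega))
    have habs : |lam n * x - lam n * y| = lam n * h := by
      rw [← mul_sub, abs_mul, abs_of_pos hl0]
    have hsmall : |lam n * x - lam n * y| ≤ δ := by
      rw [habs]
      calc lam n * h ≤ q ^ m * h := by gcongr
        _ ≤ δ / h * h := by gcongr
        _ = δ := by field_simp
    have h1 := (hφL n (lam n * x) (lam n * y) hsmall).1
    rw [habs] at h1
    have h2 : D ≤ L⁻¹ * (lam n * h) := by
      have h3 : δ < q ^ (m + 1) * h := by rwa [div_lt_iff₀ hh] at hm2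
      have h4 : q ^ (m + 1) = q ^ (m - 24) * q ^ 25 := by
        rw [← pow_add]
        congr 1
        omega
      rw [hD, div_le_iff₀ (by positivity)]
      calc δ ≤ q ^ (m - 24) * q ^ 25 * h := by rw [← h4]; exact h3.le
        _ ≤ lam n * q ^ 25 * h := by gcongr
        _ = _ := by field_simp
    rw [hc]
    simp only [norm_mul]
    rw [mul_comm]
    gcongr
    exact h2.trans h1
  -- The factor `1 / 2` pays for replacing each block by a finite subset carrying half of its
  -- squared norm.
  set R := D * (h / δ) ^ τ / 2 with hR
  have hR0 : 0 < R := by positivity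
  have hex : ∀ i : Fin 24, ∃ F : Finset ℕ, (∀ n ∈ F, n ∈ B (m - 1 - i)) ∧
      R ^ 2 ≤ ∑ n ∈ F, ‖c n‖ ^ 2 := by
    intro i
    set k := m - 1 - (i : ℕ) with hk
    have hi := i.2
    have hs := hk₀ k (by omega)
    have hs' : (h / δ) ^ τ ≤ blockNorm a lam q k := by
      refine le_trans ?_ hs
      have h5 : q ^ k ≤ δ / h := (pow_le_pow_right₀ hq.le (by omega)).trans hm1
      rw [← neg_mul, mul_comm, Real.rpow_mul hq0.le, Real.rpow_natCast, Real.rpow_neg (by positivity),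
        ← Real.inv_rpow (by positivity)]
      refine Real.rpow_le_rpow (by positivity) ?_ hτ0
      rw [← inv_div]
      exact inv_anti₀ (by positivity) h5
    have hpos : 0 < ∑' n : B k, ‖a n‖ ^ 2 := by
      have h6 := blockNorm_sq a lam q k
      have : 0 < blockNorm a lam q k := lt_of_lt_of_le (by positivity) hs'
      rw [show ∑' n : B k, ‖a n‖ ^ 2 = blockNorm a lam q k ^ 2 from h6.symm]
      positivity
    obtain ⟨T, hT⟩ := exists_finset_half_le_sum ((summable_norm_sq ha).subtype (B k)) hpos
    refine ⟨T.map (Function.Embedding.subtype _), fun n hn => ?_, ?_⟩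
    · obtain ⟨n', -, rfl⟩ := Finset.mem_map.1 hn
      exact n'.2
    · rw [Finset.sum_map]
      have h7 : ∑ n ∈ T, (D * ‖a n.1‖) ^ 2 ≤ ∑ n ∈ T, ‖c n.1‖ ^ 2 :=
        Finset.sum_le_sum fun n _ => by
          have := hcn i hi n.1 n.2
          gcongr
      refine le_trans ?_ h7
      simp only [mul_pow, ← Finset.mul_sum]
      have h8 : blockNorm a lam q k ^ 2 / 2 ≤ ∑ n ∈ T, ‖a n.1‖ ^ 2 := by
        rw [blockNorm_sq]
        exact hT
      have h9 : ((h / δ) ^ τ) ^ 2 ≤ blockNorm a lam q k ^ 2 := by gcongr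
      calc R ^ 2 = D ^ 2 * (((h / δ) ^ τ) ^ 2 / 4) := by rw [hR]; ring
        _ ≤ D ^ 2 * ∑ n ∈ T, ‖a n.1‖ ^ 2 := by
          gcongr
          nlinarith [sq_nonneg ((h / δ) ^ τ)]
  choose F hFB hFR using hex
  have hdisj : Pairwise (Function.onFun Disjoint F) := by
    intro i j hij
    refine Finset.disjoint_left.2 fun n hni hnj => hij ?_
    have h1 := hFB i n hni
    have h2 := hFB j n hnj
    have h3 := (pow_lt_pow_iff_right₀ hq).1 (h1.1.trans_lt h2.2)
    have h4 := (pow_lt_pow_iff_right₀ hq).1 (h2.1.trans_lt h1.2)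
    have := i.2
    have := j.2
    ext
    omega
  refine (hball P θ hθ c (summable_norm_increment hφb ha x y) F R hdisj hR0 hFR r hr).trans
    (le_of_eq ?_)
  congr 1
  rw [hR, Real.div_rpow hh.le hδ.le]
  have : 0 < h ^ τ := by positivity
  have : 0 < δ ^ τ := by positivity
  field_simp

end SmallBall

/-! ### Mass distribution principle and Riesz potentials. -/

section MassDistribution

theorem abs_sub_le_dist_graph (f : ℝ → ℂ) (x y : ℝ) :
    |x - y| ≤ dist (!₂[x, (f x).re, (f x).im] : EuclideanSpace ℝ (Fin 3))
      !₂[y, (f y).re, (f y).im] := by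
  rw [EuclideanSpace.dist_eq, Fin.sum_univ_three]
  refine Real.le_sqrt_of_sq_le ?_
  simp [Real.dist_eq]
  nlinarith [sq_nonneg ((f x).re - (f y).re), sq_nonneg ((f x).im - (f y).im)]

theorem norm_sub_le_dist_graph (f : ℝ → ℂ) (x y : ℝ) :
    ‖f x - f y‖ ≤ dist (!₂[x, (f x).re, (f x).im] : EuclideanSpace ℝ (Fin 3))
      !₂[y, (f y).re, (f y).im] := by
  rw [EuclideanSpace.dist_eq, Fin.sum_univ_three]
  refine Real.le_sqrt_of_sq_le ?_
  rw [Complex.sq_norm, Complex.normSq_apply]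
  simp [Real.dist_eq]
  nlinarith [sq_nonneg (x - y)]

/-- The mass distribution principle on a graph. -/
theorem le_dimH_graphOver_of_ae_measure_le {f : ℝ → ℂ} {A : Set ℝ} {μ : Measure ℝ}
    (hμ : μ ≠ 0) (hA : μ Aᶜ = 0) {t : ℝ≥0}
    (h : ∀ᵐ x ∂μ, ∃ M : ℕ, ∀ k : ℕ, μ {y | |x - y| ≤ 2⁻¹ ^ k ∧ ‖f x - f y‖ ≤ 2⁻¹ ^ k} ≤
      M * ENNReal.ofReal (2⁻¹ ^ k) ^ (t : ℝ)) : (t : ℝ≥0∞) ≤ dimH (graphOver f A) := by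
  rcases eq_or_ne t 0 with rfl | ht0
  · simp
  have ht : 0 < (t : ℝ) := by exact_mod_cast pos_iff_ne_zero.2 ht0
  set g : ℝ → EuclideanSpace ℝ (Fin 3) := fun x => !₂[x, (f x).re, (f x).im] with hg
  let E : ℕ → Set ℝ := fun M => {x | x ∈ A ∧ ∀ k : ℕ,
    μ {y | |x - y| ≤ 2⁻¹ ^ k ∧ ‖f x - f y‖ ≤ 2⁻¹ ^ k} ≤ M * ENNReal.ofReal (2⁻¹ ^ k) ^ (t : ℝ)}
  obtain ⟨M, hM⟩ : ∃ M, μ (E M) ≠ 0 := by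
    by_contra! hcon
    have hU : μ (⋃ M, E M) = 0 := measure_iUnion_null hcon
    refine hμ (Measure.measure_univ_eq_zero.1 (le_antisymm ?_ zero_le))
    have h2 : μ (⋃ M, E M)ᶜ = 0 := by
      have hA' : ∀ᵐ x ∂μ, x ∈ A := hA
      have : ∀ᵐ x ∂μ, x ∈ ⋃ M, E M := by
        filter_upwards [h, hA'] with x hx hxA
        obtain ⟨M, hM⟩ := hx
        exact Set.mem_iUnion.2 ⟨M, hxA, hM⟩
      exact this
    rw [← Set.union_compl_self (⋃ M, E M)]
    exact (measure_union_le _ _).trans (by rw [hU, h2, add_zero])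
  set K : ℝ≥0∞ := (M + 1) * 2 ^ (t : ℝ) with hK
  have h2t0 : (2 : ℝ≥0∞) ^ (t : ℝ) ≠ 0 := by simp
  have h2tt : (2 : ℝ≥0∞) ^ (t : ℝ) ≠ ∞ := ENNReal.rpow_ne_top_of_nonneg ht.le (by simp)
  have hK0 : K ≠ 0 := mul_ne_zero (by simp) h2t0
  have hKt : K ≠ ∞ := ENNReal.mul_ne_top (by simp) h2tt
  have hcover : ∀ s : Set (EuclideanSpace ℝ (Fin 3)), Metric.ediam s ≤ 1 →
      μ (g ⁻¹' s ∩ E M) ≤ K * Metric.ediam s ^ (t : ℝ) := by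
    intro s hs
    rcases (g ⁻¹' s ∩ E M).eq_empty_or_nonempty with hemp | ⟨x, hxs, hxE⟩
    · simp [hemp]
    have hst : Metric.ediam s ≠ ∞ := ne_top_of_le_ne_top ENNReal.one_ne_top hs
    set d := (Metric.ediam s).toReal with hd
    have hd1 : d ≤ 1 := ENNReal.toReal_le_of_le_ofReal zero_le_one (by simpa using hs)
    have hdist : ∀ y ∈ g ⁻¹' s ∩ E M, dist (g x) (g y) ≤ d := by
      intro y hy
      rw [dist_edist]
      exact ENNReal.toReal_mono hst (Metric.edist_le_ediam_of_mem hxs hy.1)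
    have hk : ∀ k : ℕ, d ≤ 2⁻¹ ^ k →
        μ (g ⁻¹' s ∩ E M) ≤ M * ENNReal.ofReal (2⁻¹ ^ k) ^ (t : ℝ) := by
      intro k hdk
      refine (measure_mono fun y hy => ?_).trans (hxE.2 k)
      have := (hdist y hy).trans hdk
      exact ⟨(abs_sub_le_dist_graph f x y).trans this, (norm_sub_le_dist_graph f x y).trans this⟩
    have hd0 : 0 ≤ d := ENNReal.toReal_nonneg
    -- If `s` has diameter `0`, the bound holds at every scale and letting `k → ∞` gives measure
    -- zero.
    rcases hd0.eq_or_lt with h0 | hpos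
    · have hlim : Tendsto (fun k : ℕ => (M : ℝ≥0∞) * ENNReal.ofReal (2⁻¹ ^ k) ^ (t : ℝ)) atTop
          (𝓝 0) := by
        have h1 : Tendsto (fun k : ℕ => ENNReal.ofReal ((2 : ℝ)⁻¹ ^ k)) atTop (𝓝 0) := by
          rw [← ENNReal.ofReal_zero]
          exact ENNReal.tendsto_ofReal
            (tendsto_pow_atTop_nhds_zero_of_lt_one (by norm_num) (by norm_num))
        have h2 := ((ENNReal.continuous_rpow_const (y := (t : ℝ))).tendsto 0).comp h1
        rw [ENNReal.zero_rpow_of_pos ht] at h2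
        simpa [Function.comp_def] using ENNReal.Tendsto.const_mul h2 (Or.inr (ENNReal.natCast_ne_top M))
      refine (ge_of_tendsto' hlim fun k => hk k ?_).trans zero_le
      rw [← h0]
      positivity
    · obtain ⟨k, hk1, hk2⟩ := exists_nat_pow_near_of_lt_one hpos hd1
        (by norm_num : (0 : ℝ) < 2⁻¹) (by norm_num)
      refine (hk k hk2).trans ?_
      have h3 : ENNReal.ofReal (2⁻¹ ^ k) ≤ 2 * Metric.ediam s := by
        have e : 2 * Metric.ediam s = ENNReal.ofReal (2 * d) := by
          rw [ENNReal.ofReal_mul zero_le_two, ENNReal.ofReal_toReal hst, ENNReal.ofReal_ofNat]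
        rw [e]
        refine ENNReal.ofReal_le_ofReal ?_
        rw [pow_succ] at hk1
        linarith
      calc (M : ℝ≥0∞) * ENNReal.ofReal (2⁻¹ ^ k) ^ (t : ℝ)
          ≤ (M + 1) * (2 * Metric.ediam s) ^ (t : ℝ) := by
            gcongr
            exact le_self_add
        _ = _ := by rw [ENNReal.mul_rpow_of_nonneg _ _ ht.le, hK, mul_assoc]
  -- Outer measures are used because neither `E M` nor the graph map is assumed measurable.
  let ν : OuterMeasure (EuclideanSpace ℝ (Fin 3)) :=
    K⁻¹ • OuterMeasure.map g (OuterMeasure.restrict (E M) μ.toOuterMeasure)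
  have hνapp : ∀ s, ν s = K⁻¹ * μ (g ⁻¹' s ∩ E M) := by
    simp [ν]
  have hν : ν ≤ OuterMeasure.mkMetric fun r => r ^ (t : ℝ) := by
    refine OuterMeasure.le_mkMetric _ ν 1 one_pos fun s hs => ?_
    rw [hνapp]
    calc K⁻¹ * μ (g ⁻¹' s ∩ E M) ≤ K⁻¹ * (K * Metric.ediam s ^ (t : ℝ)) := by
          gcongr
          exact hcover s hs
      _ = Metric.ediam s ^ (t : ℝ) := by
          rw [← mul_assoc, ENNReal.inv_mul_cancel hK0 hKt, one_mul]
  refine le_dimH_of_hausdorffMeasure_ne_zero fun hzero => ?_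
  have h4 := hν (graphOver f A)
  have h5 : (OuterMeasure.mkMetric fun r => r ^ (t : ℝ)) (graphOver f A) =
      μH[(t : ℝ)] (graphOver f A) := by
    rw [Measure.hausdorffMeasure, ← Measure.mkMetric_toOuterMeasure]
    rfl
  rw [h5, hzero, hνapp, nonpos_iff_eq_zero, mul_eq_zero] at h4
  rcases h4 with h4 | h4
  · exact hKt (ENNReal.inv_eq_zero.1 h4)
  · have hsub : E M ⊆ g ⁻¹' graphOver f A ∩ E M := fun x hx => ⟨⟨x, hx.1, rfl⟩, hx⟩
    exact hM (measure_mono_null hsub h4)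

/-- Frostman measures have finite Riesz potentials of lower order. -/
theorem exists_lintegral_rpow_neg_le {μ : Measure ℝ} [IsFiniteMeasure μ] {C : ℝ≥0} {s γ : ℝ}
    (hμ : ∀ x r : ℝ, 0 < r → μ (Metric.closedBall x r) ≤ C * ENNReal.ofReal r ^ s)
    (hγ0 : 0 ≤ γ) (hγ : γ < s) :
    ∃ M : ℝ≥0∞, M ≠ ∞ ∧ ∀ x, ∫⁻ y, ENNReal.ofReal (|x - y| ^ (-γ)) ∂μ ≤ M := by
  set b : ℕ → ℝ := fun k => (C : ℝ) * 2 ^ γ * (2 ^ (γ - s)) ^ k with hb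
  have hbsum : Summable b := by
    refine (summable_geometric_of_lt_one (by positivity) ?_).mul_left _
    exact Real.rpow_lt_one_of_one_lt_of_neg (by norm_num) (by linarith)
  refine ⟨μ Set.univ + ∑' k, ENNReal.ofReal (b k),
    ENNReal.add_ne_top.2 ⟨measure_ne_top _ _, hbsum.tsum_ofReal_ne_top⟩, fun x => ?_⟩
  have hpt : ∀ y, ENNReal.ofReal (|x - y| ^ (-γ)) ≤ 1 + ∑' k : ℕ,
      (Metric.closedBall x (2⁻¹ ^ k)).indicator (fun _ => ENNReal.ofReal ((2 ^ (k + 1)) ^ γ)) y := by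
    intro y
    -- On the diagonal the convention `0 ^ (-γ) = 0` for `γ ≠ 0`, and `1` for `γ = 0`, makes the
    -- bound immediate; points will be null for the measures in use.
    rcases eq_or_ne x y with rfl | hxy
    · refine le_trans ?_ le_self_add
      rw [sub_self, abs_zero, ← ENNReal.ofReal_one]
      refine ENNReal.ofReal_le_ofReal ?_
      rcases hγ0.eq_or_lt with rfl | hγ1
      · simp
      · rw [Real.zero_rpow (by linarith)]
        exact zero_le_one
    have hpos : 0 < |x - y| := abs_pos.2 (sub_ne_zero.2 hxy)
    rcases le_or_gt |x - y| 1 with hle | hgt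
    · obtain ⟨k, hk1, hk2⟩ := exists_nat_pow_near_of_lt_one hpos hle
        (by norm_num : (0 : ℝ) < 2⁻¹) (by norm_num)
      refine le_trans ?_ (le_trans (ENNReal.le_tsum k) le_add_self)
      rw [Set.indicator_of_mem (by rwa [Metric.mem_closedBall, Real.dist_eq, abs_sub_comm])]
      refine ENNReal.ofReal_le_ofReal ?_
      rw [Real.rpow_neg hpos.le, ← Real.inv_rpow hpos.le]
      refine Real.rpow_le_rpow (by positivity) ?_ hγ0
      rw [← inv_inv ((2 : ℝ) ^ (k + 1)), ← inv_pow]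
      exact inv_anti₀ (by positivity) hk1.le
    · refine le_trans ?_ le_self_add
      rw [← ENNReal.ofReal_one]
      exact ENNReal.ofReal_le_ofReal (Real.rpow_le_one_of_one_le_of_nonpos hgt.le (by linarith))
  refine (lintegral_mono hpt).trans ?_
  rw [lintegral_add_left measurable_const, lintegral_one, lintegral_tsum fun k =>
    (measurable_const.indicator measurableSet_closedBall).aemeasurable]
  gcongr with k
  rw [lintegral_indicator_const measurableSet_closedBall]
  refine (mul_le_mul_right (hμ x _ (by positivity)) _).trans (le_of_eq ?_)
  have hpow : (((2 : ℝ)⁻¹ ^ k) ^ s) = (2 ^ (-s)) ^ k := by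
    rw [← Real.rpow_natCast, ← Real.rpow_natCast, ← Real.rpow_mul (by norm_num),
      ← Real.rpow_mul (by norm_num), Real.inv_rpow (by norm_num), ← Real.rpow_neg (by norm_num)]
    congr 1
    ring
  have hpow2 : ((2 : ℝ) ^ (k + 1)) ^ γ = 2 ^ γ * (2 ^ γ) ^ k := by
    rw [pow_succ, Real.mul_rpow (by positivity) (by norm_num), ← Real.rpow_natCast,
      ← Real.rpow_natCast, ← Real.rpow_mul (by norm_num), ← Real.rpow_mul (by norm_num),
      mul_comm γ, mul_comm]
  rw [ENNReal.ofReal_rpow_of_pos (by positivity), ← ENNReal.ofReal_coe_nnreal,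
    ← ENNReal.ofReal_mul C.coe_nonneg, ← ENNReal.ofReal_mul (by positivity), hpow, hpow2]
  simp only [hb]
  rw [sub_eq_add_neg, Real.rpow_add (by norm_num), mul_pow]
  congr 1
  ring

/-- Interpolation between `p ≤ 1` and the small ball bound. For `t ≤ 2` one compares with the power
`t` of `ρ / h ^ τ`; for `t > 2` one multiplies by `(ρ / h) ^ (t - 2) ≥ 1`. The two regimes produce
the two terms of the minimum in the theorem. -/
theorem rpow_min_bound {C h ρ τ t : ℝ} (hh : 0 < h) (hρ : 0 < ρ) (hhρ : h ≤ ρ)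
    (ht : 0 < t) {p : ℝ} (hp1 : p ≤ 1) (hp : p ≤ C * (ρ / h ^ τ) ^ 2) :
    p ≤ max 1 C * (ρ ^ t * h ^ (-(if t ≤ 2 then t * τ else t - 2 + 2 * τ))) := by
  have hhτ : 0 < h ^ τ := by positivity
  split_ifs with h2
  · have e : ρ ^ t * h ^ (-(t * τ)) = (ρ / h ^ τ) ^ t := by
      rw [Real.div_rpow hρ.le hhτ.le, ← Real.rpow_mul hh.le, mul_comm τ t, Real.rpow_neg hh.le]
      rfl
    rw [e]
    rcases le_or_gt (ρ / h ^ τ) 1 with hle | hgt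
    · refine hp.trans ?_
      have h3 : (ρ / h ^ τ) ^ 2 ≤ (ρ / h ^ τ) ^ t := by
        rw [← Real.rpow_two]
        exact Real.rpow_le_rpow_of_exponent_ge (by positivity) hle h2
      gcongr
      exact le_max_right _ _
    · have h3 : 1 ≤ (ρ / h ^ τ) ^ t := Real.one_le_rpow hgt.le ht.le
      nlinarith [le_max_left 1 C]
  · refine hp.trans ?_
    have e : ρ ^ t * h ^ (-(t - 2 + 2 * τ)) = (ρ / h ^ τ) ^ 2 * (ρ / h) ^ (t - 2) := by
      rw [Real.div_rpow hρ.le hh.le, div_pow, ← Real.rpow_mul_natCast hh.le, neg_add, Real.rpow_add hh,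
        Real.rpow_neg hh.le, Real.rpow_neg hh.le, Real.rpow_sub hρ, Real.rpow_two,
        mul_comm τ]
      push_cast
      field_simp
    have h3 : 1 ≤ (ρ / h) ^ (t - 2) :=
      Real.one_le_rpow (by rwa [le_div_iff₀ hh, one_mul]) (by linarith)
    rw [e]
    calc C * (ρ / h ^ τ) ^ 2 = C * ((ρ / h ^ τ) ^ 2 * 1) := by rw [mul_one]
      _ ≤ _ := by
        gcongr
        exact le_max_right _ _

end MassDistribution

/-! ### Expected energy of the lifted measure. -/

section Energy

theorem measure_singleton_eq_zero_of_frostman {μ : Measure ℝ} {C : ℝ≥0} {s : ℝ} (hs : 0 < s)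
    (hμ : ∀ x r : ℝ, 0 < r → μ (Metric.closedBall x r) ≤ C * ENNReal.ofReal r ^ s) (x : ℝ) :
    μ {x} = 0 := by
  have hlim : Tendsto (fun k : ℕ => (C : ℝ≥0∞) * ENNReal.ofReal (2⁻¹ ^ k) ^ s) atTop (𝓝 0) := by
    have h1 : Tendsto (fun k : ℕ => ENNReal.ofReal ((2 : ℝ)⁻¹ ^ k)) atTop (𝓝 0) := by
      rw [← ENNReal.ofReal_zero]
      exact ENNReal.tendsto_ofReal
        (tendsto_pow_atTop_nhds_zero_of_lt_one (by norm_num) (by norm_num))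
    have h2 := ((ENNReal.continuous_rpow_const (y := s)).tendsto 0).comp h1
    rw [ENNReal.zero_rpow_of_pos hs] at h2
    simpa [Function.comp_def] using ENNReal.Tendsto.const_mul h2 (Or.inr (ENNReal.coe_ne_top))
  refine le_antisymm (ge_of_tendsto' hlim fun k => ?_) zero_le
  refine (measure_mono ?_).trans (hμ x (2⁻¹ ^ k) (by positivity))
  rw [Set.singleton_subset_iff]
  exact Metric.mem_closedBall_self (by positivity)

variable {Ω : Type*} [MeasurableSpace Ω] {P : Measure Ω} [IsProbabilityMeasure P]
  {F : Ω → ℝ → ℂ}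

theorem measurableSet_close_pairs (hFc : ∀ ω, Continuous (F ω))
    (hFm : ∀ x, Measurable fun ω => F ω x) (ρ : ℝ) :
    MeasurableSet {p : (Ω × ℝ) × ℝ | |p.1.2 - p.2| ≤ ρ ∧ ‖F p.1.1 p.1.2 - F p.1.1 p.2‖ ≤ ρ} := by
  have hG : Measurable fun p : ℝ × Ω => F p.2 p.1 :=
    measurable_uncurry_of_continuous_of_measurable (u := fun x ω => F ω x) hFc hFm
  have h1 : Measurable fun p : (Ω × ℝ) × ℝ => F p.1.1 p.1.2 :=
    hG.comp ((measurable_snd.comp measurable_fst).prodMk (measurable_fst.comp measurable_fst))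
  have h2 : Measurable fun p : (Ω × ℝ) × ℝ => F p.1.1 p.2 :=
    hG.comp (measurable_snd.prodMk (measurable_fst.comp measurable_fst))
  have h3 : Measurable fun p : (Ω × ℝ) × ℝ => |p.1.2 - p.2| :=
    continuous_abs.measurable.comp ((measurable_snd.comp measurable_fst).sub measurable_snd)
  exact (measurableSet_le h3 measurable_const).inter
    (measurableSet_le (h1.sub h2).norm measurable_const)

/-- The expected energy at scale `ρ` of the lift of a Frostman measure to a random graph. -/
theorem lintegral_measure_close_le (hFc : ∀ ω, Continuous (F ω))
    (hFm : ∀ x, Measurable fun ω => F ω x) {μ : Measure ℝ} [IsFiniteMeasure μ]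
    (hμ0 : ∀ x, μ {x} = 0) {B : Set ℝ} (hB : μ Bᶜ = 0) {h₀ C τ t γ : ℝ} {M : ℝ≥0∞}
    (hdiam : ∀ x ∈ B, ∀ y ∈ B, |x - y| ≤ h₀)
    (hsmall : ∀ x y : ℝ, x ≠ y → |x - y| ≤ h₀ → ∀ r : ℝ, 0 < r →
      P {ω | ‖F ω x - F ω y‖ ≤ r} ≤ ENNReal.ofReal (C * (r / |x - y| ^ τ) ^ 2))
    (ht : 0 < t) (hγ : γ = if t ≤ 2 then t * τ else t - 2 + 2 * τ) (hC : 0 < C)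
    (hM : ∀ x, ∫⁻ y, ENNReal.ofReal (|x - y| ^ (-γ)) ∂μ ≤ M) {ρ : ℝ} (hρ : 0 < ρ) :
    ∫⁻ ω, ∫⁻ x, μ {y | |x - y| ≤ ρ ∧ ‖F ω x - F ω y‖ ≤ ρ} ∂μ ∂P ≤
      ENNReal.ofReal (max 1 C * ρ ^ t) * M * μ Set.univ := by
  have hD := measurableSet_close_pairs hFc hFm ρ
  have hV : Measurable fun p : Ω × ℝ => μ {y | |p.2 - y| ≤ ρ ∧ ‖F p.1 p.2 - F p.1 y‖ ≤ ρ} :=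
    measurable_measure_prodMk_left hD
  rw [lintegral_lintegral_swap hV.aemeasurable, ← lintegral_const]
  refine lintegral_mono_ae ?_
  have hBae : ∀ᵐ x ∂μ, x ∈ B := hB
  filter_upwards [hBae] with x hx
  have hDx : MeasurableSet {p : Ω × ℝ | |x - p.2| ≤ ρ ∧ ‖F p.1 x - F p.1 p.2‖ ≤ ρ} :=
    hD.preimage ((measurable_fst.prodMk measurable_const).prodMk measurable_snd)
  have hswap : ∫⁻ ω, μ {y | |x - y| ≤ ρ ∧ ‖F ω x - F ω y‖ ≤ ρ} ∂P =
      ∫⁻ y, P {ω | |x - y| ≤ ρ ∧ ‖F ω x - F ω y‖ ≤ ρ} ∂μ :=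
    (Measure.prod_apply hDx).symm.trans (Measure.prod_apply_symm hDx)
  rw [hswap]
  have hne : ∀ᵐ y ∂μ, y ≠ x := by
    rw [ae_iff]
    simpa using hμ0 x
  refine (lintegral_mono_ae (g := fun y => ENNReal.ofReal (max 1 C * ρ ^ t) *
    ENNReal.ofReal (|x - y| ^ (-γ))) ?_).trans ?_
  · filter_upwards [hBae, hne] with y hy hyx
    by_cases hxy : |x - y| ≤ ρ
    · have hpos : 0 < |x - y| := abs_pos.2 (sub_ne_zero.2 hyx.symm)
      have h1 : P {ω | |x - y| ≤ ρ ∧ ‖F ω x - F ω y‖ ≤ ρ} ≤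
          ENNReal.ofReal (C * (ρ / |x - y| ^ τ) ^ 2) :=
        (measure_mono fun ω hω => hω.2).trans (hsmall x y hyx.symm (hdiam x hx y hy) ρ hρ)
      rw [← ENNReal.ofReal_mul (by positivity), ← ENNReal.ofReal_toReal (measure_ne_top P _), mul_assoc]
      refine ENNReal.ofReal_le_ofReal ?_
      rw [hγ]
      exact rpow_min_bound hpos hρ hxy ht
        (ENNReal.toReal_le_of_le_ofReal zero_le_one (by simpa using prob_le_one))
        (ENNReal.toReal_le_of_le_ofReal (by positivity) h1)
    · simp [hxy]
  · rw [lintegral_const_mul' _ _ ENNReal.ofReal_ne_top]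
    gcongr
    exact hM x

/-- The expected mass at scale `2⁻ᵏ` is `O(2 ^ (-tk))`. Weighted by `2 ^ (t'k)` with `t' < t` it is
summable, so by Fubini the weighted sum is finite, hence its terms bounded, at almost every `(ω,
x)`. -/
theorem ae_ae_exists_measure_close_le (hFc : ∀ ω, Continuous (F ω))
    (hFm : ∀ x, Measurable fun ω => F ω x) {μ : Measure ℝ} [IsFiniteMeasure μ]
    (hμ0 : ∀ x, μ {x} = 0) {B : Set ℝ} (hB : μ Bᶜ = 0) {h₀ C τ t γ t' : ℝ} {M : ℝ≥0∞}
    (hdiam : ∀ x ∈ B, ∀ y ∈ B, |x - y| ≤ h₀)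
    (hsmall : ∀ x y : ℝ, x ≠ y → |x - y| ≤ h₀ → ∀ r : ℝ, 0 < r →
      P {ω | ‖F ω x - F ω y‖ ≤ r} ≤ ENNReal.ofReal (C * (r / |x - y| ^ τ) ^ 2))
    (ht : 0 < t) (hγ : γ = if t ≤ 2 then t * τ else t - 2 + 2 * τ) (hC : 0 < C) (hMt : M ≠ ∞)
    (hM : ∀ x, ∫⁻ y, ENNReal.ofReal (|x - y| ^ (-γ)) ∂μ ≤ M) (htt' : t' < t) :
    ∀ᵐ ω ∂P, ∀ᵐ x ∂μ, ∃ N : ℕ, ∀ k : ℕ,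
      μ {y | |x - y| ≤ 2⁻¹ ^ k ∧ ‖F ω x - F ω y‖ ≤ 2⁻¹ ^ k} ≤
        N * ENNReal.ofReal (2⁻¹ ^ k) ^ t' := by
  set V : ℕ → Ω → ℝ → ℝ≥0∞ := fun k ω x =>
    μ {y | |x - y| ≤ 2⁻¹ ^ k ∧ ‖F ω x - F ω y‖ ≤ 2⁻¹ ^ k} with hVdef
  have hV : ∀ k, Measurable fun p : Ω × ℝ => V k p.1 p.2 := fun k =>
    measurable_measure_prodMk_left (measurableSet_close_pairs hFc hFm (2⁻¹ ^ k))
  have hVω : ∀ k ω, Measurable (V k ω) := fun k ω => (hV k).of_uncurry_left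
  set w : ℕ → ℝ≥0∞ := fun k => ENNReal.ofReal ((2 ^ k) ^ t') with hw
  have hwinv : ∀ k, w k * ENNReal.ofReal (2⁻¹ ^ k) ^ t' = 1 := by
    intro k
    rw [ENNReal.ofReal_rpow_of_pos (by positivity), hw, ← ENNReal.ofReal_mul (by positivity),
      ← Real.mul_rpow (by positivity) (by positivity), ← mul_pow]
    norm_num
  have hinner : ∀ ω, ∫⁻ x, ∑' k, w k * V k ω x ∂μ = ∑' k, w k * ∫⁻ x, V k ω x ∂μ := by
    intro ω
    rw [lintegral_tsum fun k => ((hVω k ω).const_mul _).aemeasurable]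
    exact tsum_congr fun k => lintegral_const_mul _ (hVω k ω)
  have hVint : ∀ k, Measurable fun ω => ∫⁻ x, V k ω x ∂μ := fun k => (hV k).lintegral_prod_right'
  have hfin : ∫⁻ ω, ∫⁻ x, ∑' k, w k * V k ω x ∂μ ∂P ≠ ∞ := by
    simp only [hinner]
    rw [lintegral_tsum fun k => ((hVint k).const_mul _).aemeasurable]
    simp only [fun k => lintegral_const_mul (μ := P) (w k) (hVint k)]
    set b : ℕ → ℝ := fun k => max 1 C * (2 ^ (t' - t)) ^ k with hb
    have hbsum : Summable b := by
      refine (summable_geometric_of_lt_one (by positivity) ?_).mul_left _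
      exact Real.rpow_lt_one_of_one_lt_of_neg (by norm_num) (by linarith)
    have hle : ∀ k, w k * ∫⁻ ω, ∫⁻ x, V k ω x ∂μ ∂P ≤
        ENNReal.ofReal (b k) * (M * μ Set.univ) := by
      intro k
      have e : b k = (2 ^ k) ^ t' * (max 1 C * (2⁻¹ ^ k) ^ t) := by
        simp only [hb]
        rw [sub_eq_add_neg, Real.rpow_add (by norm_num), mul_pow, ← Real.rpow_pow_comm (by norm_num),
          ← Real.rpow_pow_comm (by norm_num), Real.rpow_neg (by norm_num), inv_pow,
          Real.inv_rpow (by positivity), inv_pow]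
        ring
      rw [e, ENNReal.ofReal_mul (by positivity), mul_assoc, ← mul_assoc (ENNReal.ofReal (max _ _ * _))]
      gcongr
      exact lintegral_measure_close_le hFc hFm hμ0 hB hdiam hsmall ht hγ hC hM (by positivity)
    refine ne_top_of_le_ne_top ?_ (ENNReal.tsum_le_tsum hle)
    rw [ENNReal.tsum_mul_right]
    exact ENNReal.mul_ne_top hbsum.tsum_ofReal_ne_top (ENNReal.mul_ne_top hMt (measure_ne_top _ _))
  have hmeas1 : Measurable fun ω => ∫⁻ x, ∑' k, w k * V k ω x ∂μ := by
    simp only [hinner]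
    exact Measurable.tsum fun k => (hVint k).const_mul _
  filter_upwards [ae_lt_top hmeas1 hfin] with ω hω
  have hmeas2 : Measurable fun x => ∑' k, w k * V k ω x :=
    Measurable.tsum fun k => (hVω k ω).const_mul _
  filter_upwards [ae_lt_top hmeas2 hω.ne] with x hx
  obtain ⟨N, hN⟩ := ENNReal.exists_nat_gt hx.ne
  refine ⟨N, fun k => ?_⟩
  calc V k ω x = (w k * V k ω x) * ENNReal.ofReal (2⁻¹ ^ k) ^ t' := by
        rw [mul_right_comm, hwinv, one_mul]
    _ ≤ N * ENNReal.ofReal (2⁻¹ ^ k) ^ t' := by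
        gcongr
        exact (ENNReal.le_tsum k).trans hN.le

/-- Almost surely the graph over `A` of a Steinhaus series has at least the dimension predicted by
the decay of its coefficients. -/
theorem ae_le_dimH_graphOver {a : ℕ → ℂ} {lam : ℕ → ℝ} {φ : ℕ → ℝ → ℂ} {q τ : ℝ}
    {θ : ℕ → Ω → ℝ} (hθ : IsIIDUniform P θ)
    (hφb : UniformlyBounded φ) (hφ : LocallyUniformlyBiLipschitz φ)
    (ha : Summable fun n => ‖a n‖) (hq : 1 < q) (hτ0 : 0 ≤ τ) (hτ : upperRate a lam q < τ)
    {A : Set ℝ} (hA : MeasurableSet A) {s : ℝ≥0} (hs0 : 0 < s) (hs : s < dimH A) {t : ℝ} {t' : ℝ≥0}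
    (htt' : t' < t) (hγ : (if t ≤ 2 then t * τ else t - 2 + 2 * τ) < s) :
    ∀ᵐ ω ∂P, (t' : ℝ≥0∞) ≤ dimH (graphOver (phaseSeries a lam φ fun n => θ n ω) A) := by
  have ht : 0 < t := t'.coe_nonneg.trans_lt htt'
  have hγ0 : 0 ≤ if t ≤ 2 then t * τ else t - 2 + 2 * τ := by
    split_ifs with h2
    · positivity
    · linarith
  obtain ⟨C, h₀, hC, hh₀, hsmall⟩ := exists_measure_norm_increment_le hθ hφb hφ ha hq hτ0 hτ
  -- The small ball estimate is local, so `A` is cut into pieces of length `h₀`; by countable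
  -- stability one of them still has dimension above `s`.
  have hcover : A = ⋃ j : ℤ, A ∩ Set.Ico (j * h₀) ((j + 1) * h₀) := by
    rw [← Set.inter_iUnion]
    rw [eq_comm, Set.inter_eq_left]
    intro x _
    refine Set.mem_iUnion.2 ⟨⌊x / h₀⌋, ?_, ?_⟩
    · exact (le_div_iff₀ hh₀).1 (Int.floor_le _)
    · exact (div_lt_iff₀ hh₀).1 (Int.lt_floor_add_one _)
  obtain ⟨j, hj⟩ : ∃ j : ℤ, s < dimH (A ∩ Set.Ico (j * h₀) ((j + 1) * h₀)) := by
    rw [hcover, dimH_iUnion] at hs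
    exact lt_iSup_iff.1 hs
  set B := A ∩ Set.Ico (j * h₀) ((j + 1) * h₀)
  obtain ⟨μ, hfin, hμ, hB, K, hK⟩ := exists_frostman_measure hs0 (hA.inter measurableSet_Ico) hj
  have hs0' : (0 : ℝ) < s := by exact_mod_cast hs0
  obtain ⟨M, hMt, hM⟩ := exists_lintegral_rpow_neg_le hK hγ0 hγ
  have hdiam : ∀ x ∈ B, ∀ y ∈ B, |x - y| ≤ h₀ := by
    rintro x ⟨-, hx1, hx2⟩ y ⟨-, hy1, hy2⟩
    rw [abs_le]
    constructor <;> linarith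
  have hFm : ∀ x, Measurable fun ω => phaseSeries a lam φ (fun n => θ n ω) x := by
    intro x
    simp only [phaseSeries_eq]
    exact measurable_steinhausSum (summable_norm_coeff hφb ha x) hθ.1
  filter_upwards [ae_ae_exists_measure_close_le
    (fun ω => continuous_phaseSeries hφb hφ ha fun n => θ n ω) hFm
    (measure_singleton_eq_zero_of_frostman hs0' hK) hB hdiam hsmall ht rfl hC hMt hM
    htt'] with ω hω
  exact (le_dimH_graphOver_of_ae_measure_le hμ hB hω).trans
    (dimH_mono (Set.image_mono Set.inter_subset_left))

end Energy

/-! ### Optimising the exponents. -/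

section DimensionBounds

variable {Ω : Type*} [MeasurableSpace Ω] {P : Measure Ω} [IsProbabilityMeasure P]
  {a : ℕ → ℂ} {lam : ℕ → ℝ} {φ : ℕ → ℝ → ℂ} {q : ℝ} {θ : ℕ → Ω → ℝ}

/-- The left side of `hud` is the Riesz exponent at `t = u`, written without cases so as to be
visibly continuous. This leaves room to increase both `u` and `τ` by `ε`, as the strict inequalities
of the energy argument require. -/
theorem ae_ofReal_le_dimH_graphOver {τ : ℝ} (hθ : IsIIDUniform P θ)
    (hφb : UniformlyBounded φ) (hφ : LocallyUniformlyBiLipschitz φ)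
    (ha : Summable fun n => ‖a n‖) (hq : 1 < q) (hτ0 : 0 ≤ τ) (hτ : upperRate a lam q ≤ τ)
    {A : Set ℝ} (hA : MeasurableSet A) {d : ℝ≥0} (hd : dimH A = d) {u : ℝ} (hu : 0 ≤ u)
    (hud : min u 2 * τ + max (u - 2) 0 < d) :
    ∀ᵐ ω ∂P, ENNReal.ofReal u ≤ dimH (graphOver (phaseSeries a lam φ fun n => θ n ω) A) := by
  have hcont : Continuous fun ε : ℝ => min (u + ε) 2 * (τ + ε) + max (u + ε - 2) 0 := by fun_prop
  have hev : ∀ᶠ ε in 𝓝[>] (0 : ℝ), min (u + ε) 2 * (τ + ε) + max (u + ε - 2) 0 < d :=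
    (hcont.continuousAt.eventually_lt_const (by simpa using hud)).filter_mono nhdsWithin_le_nhds
  obtain ⟨ε, hε, hε0⟩ := (hev.and self_mem_nhdsWithin).exists
  obtain ⟨s, hs1, hs2⟩ := exists_between hε
  have hs0 : 0 < s := by
    refine lt_of_le_of_lt ?_ hs1
    have : 0 ≤ min (u + ε) 2 := le_min (by linarith) zero_le_two
    positivity
  have hτε : upperRate a lam q < ((τ + ε : ℝ) : EReal) :=
    hτ.trans_lt (by exact_mod_cast lt_add_of_pos_right τ hε0)
  refine ae_le_dimH_graphOver hθ hφb hφ ha hq (by positivity) hτε hA (s := s.toNNReal)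
    (t := u + ε) (t' := u.toNNReal) (Real.toNNReal_pos.2 hs0) ?_ ?_ ?_
  · rw [hd, ENNReal.coe_lt_coe, ← NNReal.coe_lt_coe, Real.coe_toNNReal _ hs0.le]
    exact hs2
  · rw [Real.coe_toNNReal _ hu]
    linarith
  · rw [Real.coe_toNNReal _ hs0.le]
    refine lt_of_le_of_lt (le_of_eq ?_) hs1
    split_ifs with h2
    · rw [min_eq_left h2, max_eq_right (by linarith), add_zero]
    · rw [min_eq_right (not_le.1 h2).le, max_eq_left (by linarith [not_le.1 h2])]
      ring

theorem ae_ofReal_le_dimH_graphOver_of_forall_lt {τ : ℝ} (hθ : IsIIDUniform P θ)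
    (hφb : UniformlyBounded φ) (hφ : LocallyUniformlyBiLipschitz φ)
    (ha : Summable fun n => ‖a n‖) (hq : 1 < q) (hτ0 : 0 ≤ τ) (hτ : upperRate a lam q ≤ τ)
    {A : Set ℝ} (hA : MeasurableSet A) {d : ℝ≥0} (hd : dimH A = d) {m : ℝ}
    (hm : ∀ u, 0 ≤ u → u < m → min u 2 * τ + max (u - 2) 0 < d) :
    ∀ᵐ ω ∂P, ENNReal.ofReal m ≤ dimH (graphOver (phaseSeries a lam φ fun n => θ n ω) A) := by
  have hall : ∀ᵐ ω ∂P, ∀ u : ℚ, 0 ≤ (u : ℝ) → (u : ℝ) < m →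
      ENNReal.ofReal u ≤ dimH (graphOver (phaseSeries a lam φ fun n => θ n ω) A) := by
    rw [ae_all_iff]
    intro u
    by_cases hu : 0 ≤ (u : ℝ) ∧ (u : ℝ) < m
    · filter_upwards [ae_ofReal_le_dimH_graphOver hθ hφb hφ ha hq hτ0 hτ hA hd hu.1
        (hm u hu.1 hu.2)] with ω hω _ _ using hω
    · exact Eventually.of_forall fun ω h1 h2 => absurd ⟨h1, h2⟩ hu
  filter_upwards [hall] with ω hω
  refine le_of_forall_lt_imp_le_of_dense fun c hc => ?_
  have hct : c ≠ ∞ := hc.ne_top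
  obtain ⟨u, hu1, hu2⟩ := exists_rat_btwn ((ENNReal.lt_ofReal_iff_toReal_lt hct).1 hc)
  rw [← ENNReal.ofReal_toReal hct]
  exact (ENNReal.ofReal_le_ofReal hu1.le).trans
    (hω u (ENNReal.toReal_nonneg.trans hu1.le) hu2)

/-- Rational `β` tending to `σ` need only countably many null sets. The exceptional set does not
depend on `A`, since the Hölder bounds are deterministic once the path is fixed. -/
theorem ae_dimH_graphOver_le {σ : ℝ} (hθ : IsIIDUniform P θ)
    (hφb : UniformlyBounded φ) (hφ : LocallyUniformlyBiLipschitz φ)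
    (ha : Summable fun n => ‖a n‖) (hlam : ∀ n, 1 ≤ lam n) (hq : 1 < q) (hσ0 : 0 < σ)
    (hσ1 : σ ≤ 1) (hσ : σ ≤ lowerRate a lam q) :
    ∀ᵐ ω ∂P, ∀ (A : Set ℝ) (d : ℝ≥0), dimH A = d →
      dimH (graphOver (phaseSeries a lam φ fun n => θ n ω) A) ≤
        ENNReal.ofReal (min (d / σ) (d + 2 - 2 * σ)) := by
  have hall : ∀ᵐ ω ∂P, ∀ β : ℚ, 0 < (β : ℝ) → (β : ℝ) < σ →
      LocallyHolder β (phaseSeries a lam φ fun n => θ n ω) := by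
    rw [ae_all_iff]
    intro β
    by_cases hβ : 0 < (β : ℝ) ∧ (β : ℝ) < σ
    · filter_upwards [ae_locallyHolder_phaseSeries hθ hφb hφ ha hlam hq hβ.1 (hβ.2.trans_le hσ1)
        (lt_of_lt_of_le (by exact_mod_cast hβ.2) hσ)] with ω hω _ _ using hω
    · exact Eventually.of_forall fun ω h1 h2 => absurd ⟨h1, h2⟩ hβ
  filter_upwards [hall] with ω hω A d hd
  set D := dimH (graphOver (phaseSeries a lam φ fun n => θ n ω) A)
  have hadd : ∀ β : ℚ, 0 < (β : ℝ) → (β : ℝ) < σ → D ≤ ENNReal.ofReal (d + (2 - 2 * β)) := by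
    intro β h0 h1
    have := dimH_graphOver_le_add h0.le (h1.le.trans hσ1) (hω β h0 h1) A
    rwa [hd, ← ENNReal.ofReal_coe_nnreal, ← ENNReal.ofReal_add d.coe_nonneg (by linarith)] at this
  have hdiv : ∀ β : ℚ, 0 < (β : ℝ) → (β : ℝ) < σ → D ≤ ENNReal.ofReal (d / β) := by
    intro β h0 h1
    have hβ := hω β h0 h1
    lift (β : ℝ) to ℝ≥0 using h0.le with b hb
    have hb0 : 0 < b := by exact_mod_cast h0
    have := dimH_graphOver_le_div hb0 (by exact_mod_cast h1.le.trans hσ1) hβ A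
    rwa [hd, ← ENNReal.ofReal_coe_nnreal, ← ENNReal.ofReal_coe_nnreal,
      ← ENNReal.ofReal_div_of_pos h0] at this
  obtain ⟨β₀, hβ1, hβ2⟩ := exists_rat_btwn hσ0
  have hDt : D ≠ ∞ := ne_top_of_le_ne_top ENNReal.ofReal_ne_top (hadd β₀ hβ1 hβ2)
  have hd0 : (0 : ℝ) ≤ d := d.coe_nonneg
  rw [← ENNReal.ofReal_toReal hDt]
  refine ENNReal.ofReal_le_ofReal (le_min ?_ ?_)
  · by_contra! hlt
    have hD0 : 0 < D.toReal := lt_of_le_of_lt (by positivity) hlt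
    have h1 : d / D.toReal < σ := by
      rwa [div_lt_iff₀ hD0, mul_comm, ← div_lt_iff₀ hσ0]
    obtain ⟨β, hβ3, hβ4⟩ := exists_rat_btwn h1
    have hβ0 : 0 < (β : ℝ) := lt_of_le_of_lt (by positivity) hβ3
    have h2 := ENNReal.toReal_le_of_le_ofReal (by positivity) (hdiv β hβ0 hβ4)
    rw [div_lt_iff₀ hD0] at hβ3
    rw [le_div_iff₀ hβ0] at h2
    linarith
  · by_contra! hlt
    have h1 : max 0 ((d + 2 - D.toReal) / 2) < σ := max_lt hσ0 (by linarith)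
    obtain ⟨β, hβ3, hβ4⟩ := exists_rat_btwn h1
    obtain ⟨hβ0, hβ5⟩ := max_lt_iff.1 hβ3
    have h2 := ENNReal.toReal_le_of_le_ofReal (by linarith) (hadd β hβ0 hβ4)
    linarith

theorem exists_dimH_eq_coe (A : Set ℝ) : ∃ d : ℝ≥0, dimH A = d := by
  have h : dimH A ≤ 1 := (dimH_mono (Set.subset_univ A)).trans_eq Real.dimH_univ
  exact ⟨(dimH A).toNNReal, (ENNReal.coe_toNNReal (ne_top_of_le_ne_top ENNReal.one_ne_top h)).symm⟩

end DimensionBounds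

end SteinhausSeries

/-! ### The theorem. -/

theorem theorem1p2 {Ω : Type*} [MeasurableSpace Ω] (P : Measure Ω) [IsProbabilityMeasure P]
    (θ : ℕ → Ω → ℝ) (hθ : SteinhausSeries.IsIIDUniform P θ)
    (φ : ℕ → ℝ → ℂ) (hφb : SteinhausSeries.UniformlyBounded φ)
    (hφ : SteinhausSeries.LocallyUniformlyBiLipschitz φ)
    (a : ℕ → ℂ) (ha0 : ∀ n, a n ≠ 0) (ha : Summable fun n => ‖a n‖)
    (lam : ℕ → ℝ) (hlam0 : lam 0 = 1) (hlam : Monotone lam)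
    (q : ℝ) (hq : IsLUB (Set.range fun n => lam (n + 1) / lam n) q) (hq1 : 1 < q)
    (σ τ : EReal) (hσ : σ = SteinhausSeries.lowerRate a lam q)
    (hτ : τ = SteinhausSeries.upperRate a lam q) :
    (0 < σ → σ ≤ τ → τ ≤ 1 → ∀ A : Set ℝ, MeasurableSet A → ∀ᵐ ω ∂P,
      min ((dimH A : EReal) / τ) ((dimH A : EReal) + 2 - 2 * τ) ≤
          (dimH (SteinhausSeries.graphOver
            (SteinhausSeries.phaseSeries a lam φ fun n => θ n ω) A) : EReal) ∧
        (dimH (SteinhausSeries.graphOver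
            (SteinhausSeries.phaseSeries a lam φ fun n => θ n ω) A) : EReal) ≤
          min ((dimH A : EReal) / σ) ((dimH A : EReal) + 2 - 2 * σ)) ∧
    (τ = 0 → ∀ A : Set ℝ, MeasurableSet A → 0 < dimH A → ∀ᵐ ω ∂P,
      dimH (SteinhausSeries.graphOver
        (SteinhausSeries.phaseSeries a lam φ fun n => θ n ω) A) = 2 + dimH A) := by
  have hlam1 : ∀ n, 1 ≤ lam n := fun n => hlam0.symm.trans_le (hlam (Nat.zero_le n))
  have hmin : ∀ (d : NNReal) (x : ℝ), min (((d : ENNReal) : EReal) / x)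
      (((d : ENNReal) : EReal) + 2 - 2 * x) = ((min (d / x) (d + 2 - 2 * x) : ℝ) : EReal) := by
    intro d x
    rw [EReal.coe_strictMono.monotone.map_min]
    norm_cast
  refine ⟨fun hσ0 hστ hτ1 A hA => ?_, fun hτ0 A hA hA0 => ?_⟩
  · obtain ⟨d, hd⟩ := SteinhausSeries.exists_dimH_eq_coe A
    lift τ to ℝ using ⟨(hτ1.trans_lt (EReal.coe_lt_top 1)).ne, (hσ0.trans_le hστ).ne_bot⟩
    lift σ to ℝ using ⟨(hστ.trans_lt (EReal.coe_lt_top τ)).ne, hσ0.ne_bot⟩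
    have hσ0' : 0 < σ := by exact_mod_cast hσ0
    have hστ' : σ ≤ τ := by exact_mod_cast hστ
    have hτ1' : τ ≤ 1 := by exact_mod_cast hτ1
    have hτ0 : 0 < τ := hσ0'.trans_le hστ'
    filter_upwards [SteinhausSeries.ae_ofReal_le_dimH_graphOver_of_forall_lt hθ hφb hφ ha hq1
        hτ0.le hτ.ge hA hd (m := min (d / τ) (d + 2 - 2 * τ)) fun u hu hum => by
          -- The condition on the Riesz exponent is `u * τ < d` when `u ≤ 2` and `u - 2 + 2 * τ < d`
          -- when `u ≥ 2`; each follows from one term of the minimum.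
          obtain ⟨h1, h2⟩ := lt_min_iff.1 hum
          rcases le_total u 2 with h | h
          · rw [min_eq_left h, max_eq_right (by linarith), add_zero]
            exact (lt_div_iff₀ hτ0).1 h1
          · rw [min_eq_right h, max_eq_left (by linarith)]
            linarith,
      SteinhausSeries.ae_dimH_graphOver_le hθ hφb hφ ha hlam1 hq1 hσ0' (hστ'.trans hτ1') hσ.le]
      with ω h1 h2
    rw [hd, hmin, hmin]
    constructor
    · refine le_trans ?_ (EReal.coe_ennreal_le_coe_ennreal_iff.2 h1)
      rw [EReal.coe_ennreal_ofReal]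
      exact_mod_cast le_max_left _ _
    · refine (EReal.coe_ennreal_le_coe_ennreal_iff.2 (h2 A d hd)).trans_eq ?_
      have hd0 : (0 : ℝ) ≤ d := d.coe_nonneg
      have hnn : 0 ≤ min ((d : ℝ) / σ) (d + 2 - 2 * σ) := le_min (by positivity) (by linarith)
      rw [EReal.coe_ennreal_ofReal, max_eq_left hnn]
  · obtain ⟨d, hd⟩ := SteinhausSeries.exists_dimH_eq_coe A
    have hd0 : (0 : ℝ) < d := by
      rw [hd] at hA0
      exact_mod_cast hA0
    have e : (2 : ENNReal) + d = ENNReal.ofReal (2 + d) := by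
      rw [ENNReal.ofReal_add zero_le_two hd0.le, ENNReal.ofReal_coe_nnreal, ENNReal.ofReal_ofNat]
    filter_upwards [SteinhausSeries.ae_ofReal_le_dimH_graphOver_of_forall_lt hθ hφb hφ ha hq1
        le_rfl (τ := 0) (by rw [← hτ, hτ0, EReal.coe_zero]) hA hd (m := 2 + d) fun u hu hum => by
          rw [mul_zero, zero_add]
          exact max_lt (by linarith) hd0] with ω h1
    refine le_antisymm ?_ (by rwa [hd, e])
    -- The upper bound holds for every `ω`, because the series is bounded and so Hölder of exponent
    -- `0`.
    have h2 := SteinhausSeries.dimH_graphOver_le_add le_rfl zero_le_one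
      (SteinhausSeries.locallyHolder_zero_phaseSeries (lam := lam) hφb ha fun n => θ n ω) A
    rwa [mul_zero, sub_zero, ENNReal.ofReal_ofNat, add_comm] at h2
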